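/- **Setting.** Let $k\ge 2$, $r\ge 1$ and $\kappa,c_0,\varepsilon>0$ be fixed. For each $n$ let $\boldsymbol v_1,\dots,\boldsymbol v_r\in\mathbb R^n$ be orthonormal, let $\beta_1,\dots,\beta_r\in\mathbb R$ with $|\beta_1|=\max_j|\beta_j|$, and let $$\boldsymbol X=\sum_{j=1}^r\beta_j\boldsymbol v_j^{\otimes k}+\boldsymbol Z\in\otimes^k\mathbb R^n ,$$ where $\boldsymbol Z$ has $n^k$ i.i.d. $\mathcal N(0,1/n)$ entries. For a tensor $\boldsymbol\tau$ of order $k$ and $\boldsymbol w\in\mathbb R^n$ let $\boldsymbol\tau[\boldsymbol w^{\otimes(k-1)}]\in\mathbb R^n$ be the vector with entries $\langle\boldsymbol\tau,\boldsymbol e_i\otimes\boldsymbol w^{\otimes(k-1)}\rangle$, and $\boldsymbol\tau[\boldsymbol w^{\otimes k}]=\langle\boldsymbol\tau,\boldsymbol w^{\otimes k}\rangle$. Power iteration is $\boldsymbol u_0=\boldsymbol u$, $\boldsymbol u_{t+1}=\boldsymbol X[\boldsymbol u_t^{\otimes(k-1)}]/\|\boldsymbol X[\boldsymbol u_t^{\otimes(k-1)}]\|_2$,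 where $\boldsymbol u\in\mathbb R^n$ is deterministic, $\|\boldsymbol u\|_2=1$ and $|\langle\boldsymbol u,\boldsymbol v_j\rangle|\ge c_0/\sqrt n$ for $1\le j\le r$. Assume: * (comparable overlaps) $1/\kappa\le|\langle\boldsymbol u,\boldsymbol v_i\rangle/\langle\boldsymbol u,\boldsymbol v_j\rangle|\le\kappa$ for all $1\le i,j\le r$; * (dominant index) $j_*$ maximizes $|\beta_j\langle\boldsymbol u,\boldsymbol v_j\rangle^{k-2}|$, and $|\beta_j\langle\boldsymbol u,\boldsymbol v_j\rangle^{k-2}|\le(1-1/\kappa)|\beta_{j_*}\langle\boldsymbol u,\boldsymbol v_{j_*}\rangle^{k-2}|$ for all $j\ne j_*$; * (signal strength) $|\beta_{j_*}\langle\boldsymbol u,\boldsymbol v_{j_*}\rangle^{k-2}|\ge n^\varepsilon$. **Theorem.** (a) *Convergence.* Say that $(\boldsymbol X[\boldsymbol u_t^{\otimes k}],\boldsymbol u_t)$ converges to $(b,\boldsymbol w)$ if for every $\delta>0$ there is $N=N(k,\kappa,r,c_0,\varepsilon,\delta)$ such that for all $n\ge N$, with probability at least $1-\delta$, the pair has a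 limit $(b',\boldsymbol w')$ as $t\to\infty$ and $|b'-b|\le\delta$, $\|\boldsymbol w'-\boldsymbol w\|_2\le\delta$. Let $s=\operatorname{sgn}\langle\boldsymbol u,\boldsymbol v_{j_*}\rangle$. Then: 1. if $k$ is odd and $\beta_{j_*}>0$, $(\boldsymbol X[\boldsymbol u_t^{\otimes k}],\boldsymbol u_t)$ converges to $(\beta_{j_*},\boldsymbol v_{j_*})$; 2. if $k$ is odd and $\beta_{j_*}<0$, it converges to $(-\beta_{j_*},-\boldsymbol v_{j_*})$; 3. if $k$ is even and $\beta_{j_*}>0$, it converges to $(\beta_{j_*},s\,\boldsymbol v_{j_*})$; 4. if $k$ is even and $\beta_{j_*}<0$, it does not converge but alternates between $(\beta_{j_*},s\,\boldsymbol v_{j_*})$ and $(\beta_{j_*},-s\,\boldsymbol v_{j_*})$: for every $\delta>0$ and all $n\ge N$, with probability at least $1-\delta$, the pair has no limit as $t\to\infty$, but tends to some $(b',\boldsymbol w')$ along even $t$ and to $(b',-\boldsymbol w')$ along odd $t$, with $|b'-\beta_{j_*}|\le\delta$ and $\|\boldsymbol w'-s\,\boldsymbol v_{j_*}\|_2\le\delta$.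 (b) *Expansions.* Let $k\ge3$ and $$T_0=1+\frac1\varepsilon\Big(\frac12+\frac{2\log|\beta_1|}{\log n}\Big)+\frac{\log\log(\sqrt n|\beta_1|)}{\log(k-1)} .$$ There is $\varepsilon_0=\varepsilon_0(k,\kappa)>0$ such that the following holds for every unit vector $\boldsymbol a\in\mathbb R^n$ and every integer $T$ with $T\ge T_0$ if $\varepsilon\le\varepsilon_0$, and with $T\ge \max\{T_0,\,T_0+\log\kappa/\log(k-1)\}$ if $\varepsilon>\varepsilon_0$. Let $(b,\boldsymbol w)$ be $(\beta_{j_*},\boldsymbol v_{j_*})$, $(-\beta_{j_*},-\boldsymbol v_{j_*})$, $(\beta_{j_*},s\,\boldsymbol v_{j_*})$, $(\beta_{j_*},(-1)^Ts\,\boldsymbol v_{j_*})$ in cases 1, 2, 3, 4 respectively, and let $\boldsymbol\xi=\boldsymbol Z[\boldsymbol w^{\otimes(k-1)}]$, a vector with i.i.d. $\mathcal N(0,1/n)$ entries. Then $\widehat{\boldsymbol v}=\boldsymbol u_T$ and $\widehat\beta=\boldsymbol X[\boldsymbol u_T^{\otimes k}]$ satisfy $$\langle\boldsymbol a,\widehat{\boldsymbol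 v}\rangle=\Big(1-\frac1{2b^2}\Big)\langle\boldsymbol a,\boldsymbol w\rangle+\frac{\langle\boldsymbol a,\boldsymbol\xi\rangle-\langle\boldsymbol a,\boldsymbol w\rangle\langle\boldsymbol w,\boldsymbol\xi\rangle}{b}+O_{\mathbb P}\Big(\frac{\log n}{\sqrt n}\Big(\frac{\log n}{\sqrt n|\beta_1|}\Big)^{k-1}+\frac{\log n}{|\beta_1|^2\sqrt n}+\frac{(\log n)^{3/2}}{|\beta_1|^{3/2}n^{3/4}}+\frac1{|\beta_1|^4}\Big),$$ $$\widehat\beta=b+\langle\boldsymbol\xi,\boldsymbol w\rangle-\frac{k/2-1}{b}+O_{\mathbb P}\Big(\frac{\log n}{\sqrt n}\Big(\frac{\log n}{\sqrt n|\beta_1|}\Big)^{k-1}+\frac{\log n}{|\beta_1|\sqrt n}+\frac{(\log n)^{3/2}}{|\beta_1|^{1/2}n^{3/4}}+\frac1{|\beta_1|^3}\Big).$$ Here $O_{\mathbb P}$ means: for every $\delta>0$ there are $C,N$ depending only on $k,\kappa,r,c_0,\varepsilon,\delta$ such that for all $n\ge N$, with probability at least $1-\delta$, both error terms are at most $C$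 times the displayed rates. -/

import Mathlib

open MeasureTheory ProbabilityTheory Filter Topology

open scoped RealInnerProductSpace NNReal

noncomputable section

namespace SpikedTensor

/-- Euclidean `n`-space. -/
abbrev Vec (n : ℕ) : Type := EuclideanSpace ℝ (Fin n)

/-- Real tensors of order `k` over `ℝⁿ`, as arrays of `n ^ k` entries. -/
abbrev Tensor (n k : ℕ) : Type := (Fin k → Fin n) → ℝ

/-- The tensor power `w ^ ⊗k`. -/
def tpow {n : ℕ} (w : Vec n) (k : ℕ) : Tensor n k := fun I => ∏ s, w (I s)

/-- The inner product of two tensors of the same order. -/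
def tinner {n k : ℕ} (τ η : Tensor n k) : ℝ := ∑ I, τ I * η I

/-- The action `τ[η]` of a tensor of order `m + 1` on a tensor of order `m`: the vector with
entries `τ[η](i) = ∑ τ_{i i₁ … i_m} η_{i₁ … i_m}`. -/
def act {n m : ℕ} (τ : Tensor n (m + 1)) (η : Tensor n m) : Vec n :=
  WithLp.toLp 2 fun i => ∑ J : Fin m → Fin n, τ (Fin.cons i J) * η J

/-- The rank-`r` signal plus noise `X = ∑ⱼ βⱼ vⱼ ^ ⊗k + Z`. -/
def observation {n k r : ℕ} (β : Fin r → ℝ) (v : Fin r → Vec n) (Z : Tensor n k) : Tensor n k :=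
  ∑ j, β j • tpow (v j) k + Z

/-- The law of the noise tensor: the entries are independent `N(0, 1/n)` variables. -/
def noise (n k : ℕ) : Measure (Tensor n k) :=
  Measure.pi fun _ => gaussianReal 0 ((n : ℝ≥0)⁻¹)

/-- Power iteration: `u₀ = u`, `u_{t+1} = X[u_t ^ ⊗(k-1)] / ‖X[u_t ^ ⊗(k-1)]‖`, where `X` has
order `k = m + 1`. -/
def powerIter {n m : ℕ} (X : Tensor n (m + 1)) (u : Vec n) : ℕ → Vec n
  | 0 => u
  | t + 1 => ‖act X (tpow (powerIter X u t) m)‖⁻¹ • act X (tpow (powerIter X u t) m)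

/-- The estimator of the signal strength at time `t`: `X[u_t ^ ⊗k] = ⟨X, u_t ^ ⊗k⟩`. -/
def strength {n m : ℕ} (X : Tensor n (m + 1)) (u : Vec n) (t : ℕ) : ℝ :=
  tinner X (tpow (powerIter X u t) (m + 1))

/-- The assumptions on the signals `(βⱼ, vⱼ)`, the initialization `u` and the dominant index `p`
(often written `j_*`). The index `0 : Fin r` is that of the largest `|βⱼ|`. -/
structure Admissible (k r n : ℕ) [NeZero r] (κ c₀ ε : ℝ) (β : Fin r → ℝ) (v : Fin r → Vec n)
    (u : Vec n) (p : Fin r) : Prop where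
  orthonormal : Orthonormal ℝ v
  abs_le_first : ∀ j, |β j| ≤ |β 0|
  unit_init : ‖u‖ = 1
  overlap : ∀ j, c₀ / √n ≤ |⟪u, v j⟫|
  comparable : ∀ i j, 1 / κ ≤ |⟪u, v i⟫ / ⟪u, v j⟫| ∧ |⟪u, v i⟫ / ⟪u, v j⟫| ≤ κ
  argmax : ∀ j, |β j * ⟪u, v j⟫ ^ (k - 2)| ≤ |β p * ⟪u, v p⟫ ^ (k - 2)|
  dominant : ∀ j, j ≠ p →
    |β j * ⟪u, v j⟫ ^ (k - 2)| ≤ (1 - 1 / κ) * |β p * ⟪u, v p⟫ ^ (k - 2)|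
  strong : (n : ℝ) ^ ε ≤ |β p * ⟪u, v p⟫ ^ (k - 2)|

/-- The pair `(X[u_t ^ ⊗k], u_t)` converges as `t → ∞`, to a limit within `δ` of `(b, w)`. -/
def ConvergesNear {n m : ℕ} (X : Tensor n (m + 1)) (u : Vec n) (b : ℝ) (w : Vec n) (δ : ℝ) :
    Prop :=
  ∃ (b' : ℝ) (w' : Vec n),
    Tendsto (fun t => (strength X u t, powerIter X u t)) atTop (𝓝 (b', w')) ∧
    |b' - b| ≤ δ ∧ ‖w' - w‖ ≤ δ

/-- The pair `(X[u_t ^ ⊗k], u_t)` does not converge, but alternates: along even times it converges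
to some `(b', w')` within `δ` of `(b, w)`, and along odd times to `(b', -w')`. -/
def AlternatesNear {n m : ℕ} (X : Tensor n (m + 1)) (u : Vec n) (b : ℝ) (w : Vec n) (δ : ℝ) :
    Prop :=
  (¬ ∃ l, Tendsto (fun t => (strength X u t, powerIter X u t)) atTop (𝓝 l)) ∧
  ∃ (b' : ℝ) (w' : Vec n),
    Tendsto (fun t => (strength X u (2 * t), powerIter X u (2 * t))) atTop (𝓝 (b', w')) ∧
    Tendsto (fun t => (strength X u (2 * t + 1), powerIter X u (2 * t + 1))) atTop
      (𝓝 (b', -w')) ∧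
    |b' - b| ≤ δ ∧ ‖w' - w‖ ≤ δ

/-- The number of iterations
`1 + (1/ε) (1/2 + 2 log B / log n) + log log (√n B) / log (k - 1)`, for `B = |β₁|`. -/
def iterTime (k n : ℕ) (ε B : ℝ) : ℝ :=
  1 + 1 / ε * (1 / 2 + 2 * Real.log B / Real.log n)
    + Real.log (Real.log (√n * B)) / Real.log ((k : ℝ) - 1)

/-- The error rate of the expansion of `⟨a, u_T⟩`, for `B = |β₁|`. -/
def vecRate (k n : ℕ) (B : ℝ) : ℝ :=
  Real.log n / √n * (Real.log n / (√n * B)) ^ (k - 1)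
    + Real.log n / (B ^ 2 * √n)
    + Real.log n ^ (3 / 2 : ℝ) / (B ^ (3 / 2 : ℝ) * (n : ℝ) ^ (3 / 4 : ℝ))
    + 1 / B ^ 4

/-- The error rate of the expansion of `X[u_T ^ ⊗k]`, for `B = |β₁|`. -/
def strengthRate (k n : ℕ) (B : ℝ) : ℝ :=
  Real.log n / √n * (Real.log n / (√n * B)) ^ (k - 1)
    + Real.log n / (B * √n)
    + Real.log n ^ (3 / 2 : ℝ) / (B ^ (1 / 2 : ℝ) * (n : ℝ) ^ (3 / 4 : ℝ))
    + 1 / B ^ 3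

/-- The first order Gaussian expansions around `(b, w)` with `ξ = Z[w ^ ⊗(k-1)]`, `k = m + 1`:
`ξ` has independent `N(0, 1/n)` entries, and with probability at least `1 - δ` both expansions hold
at time `T` up to `C` times the error rates. -/
def GaussianExpansion {n r : ℕ} [NeZero r] (m : ℕ) (β : Fin r → ℝ) (v : Fin r → Vec n)
    (u a : Vec n) (T : ℕ) (b : ℝ) (w : Vec n) (C δ : ℝ) : Prop :=
  (noise n (m + 1)).map (fun Z (i : Fin n) => act Z (tpow w m) i)
      = Measure.pi (fun _ : Fin n => gaussianReal 0 ((n : ℝ≥0)⁻¹)) ∧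
  1 - δ ≤ (noise n (m + 1)).real {Z |
    |⟪a, powerIter (observation β v Z) u T⟫
        - ((1 - 1 / (2 * b ^ 2)) * ⟪a, w⟫
          + (⟪a, act Z (tpow w m)⟫ - ⟪a, w⟫ * ⟪w, act Z (tpow w m)⟫) / b)|
      ≤ C * vecRate (m + 1) n |β 0| ∧
    |strength (observation β v Z) u T
        - (b + ⟪act Z (tpow w m), w⟫ - (((m + 1 : ℕ) : ℝ) / 2 - 1) / b)|
      ≤ C * strengthRate (m + 1) n |β 0|}

end SpikedTensor

end

open MeasureTheory ProbabilityTheory Filter Topology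
open scoped RealInnerProductSpace NNReal
noncomputable section

namespace SpikedTensor

/-! ### Tensor algebra -/

/-! Write `m = k - 1` and let `p` be the dominant index. A step of the iteration sends `x` to a
multiple of `∑ⱼ βⱼ⟨vⱼ,x⟩^m vⱼ + Z[x^⊗m]`. In the projective chart `h = x/⟨v_p,x⟩ - v_p` scale and
sign disappear, and by homogeneity the iteration becomes an autonomous map (`chartMap`). Without
noise the overlap ratios `⟨vⱼ,h⟩ = ⟨vⱼ,x⟩/⟨v_p,x⟩` obey `hⱼ ↦ (βⱼ/β_p) hⱼ^m`. Initially `|βⱼ/β_p|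
|hⱼ|^(m-1) ≤ 1 - 1/κ`, so they decay doubly exponentially for `m ≥ 2` and geometrically for `m = 1`
(`FastDecay`, `decay_step`).

The noise is controlled in two ways. The injective norm of `Z` is bounded by a constant with
overwhelming probability (`noise_injBound`, an ε-net argument). This is too crude while `⟨v_p,u_t⟩`
is of order `1/√n`, because `u_t` depends on `Z`. Gaussian conditioning repairs this: given the
response `Z[q]`, the noise orthogonal to `q` is fresh (`map_resample`). Hence along boundedly many
adaptive queries the responses in a fixed direction are of order `1/√n` (`noise_adaptive_tail`). The
signal in direction `v_p` beats that by a factor of order `n^ε`, so the overlap with `v_p` gains a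
factor of order `n^ε` per step until it is of order one. A fixed number `T₁ ≥ 1/ε` of steps is
enough, and from then on the injective norm suffices because `|β_p| ≥ n^ε` (`trajInv`).

Convergence: once the ratios are small the iterate lies in a ball of the chart on which `chartMap`
is a contraction (`exists_contractionHyp`), so the chart coordinate converges. The sign of
`⟨v_p,u_t⟩` follows from `x_{t+1} β_p x_t^m > 0` alone, which produces the four cases.

Expansions: after `arrivalTime` and one more step the iterate is at distance `O(1/|β_p|)` from `v_p`
in the chart (`norm_chart_le_of_arrival`). There `chartMap` contracts by `O(1/|β_p|)`, so a few
steps later the iterate agrees, up to the allowed error, with the iterates of the same map started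
at `0`. This comparison sequence queries `Z` first at `v_p^⊗m`, with response `ξ`. Its later queries
minus their component along `v_p^⊗m` meet noise independent of `ξ`, so the corrections `w =
Z[(v_p+g)^⊗m] - ξ` have inner products of order `1/(√n |β_p|)` even with `ξ` itself
(`noise_residual_tail`). Two steps of the map give `h = β_p⁻¹(ξ + w - ⟨v_p, ξ + w⟩ v_p)` up to the
error, with `‖ξ‖² = 1 + O(1/√n)`; expanding `‖v_p + h‖⁻¹` yields both formulas (`CoreHyp`). -/

lemma sum_tensor_index {n m : ℕ} {M : Type*} [AddCommMonoid M] (F : (Fin (m + 1) → Fin n) → M) :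
    ∑ I, F I = ∑ i, ∑ J : Fin m → Fin n, F (Fin.cons i J) := by
  rw [← Fintype.sum_prod_type', ← (Fin.consEquiv fun _ : Fin (m + 1) => Fin n).sum_comp]
  rfl

lemma tinner_comm {n k : ℕ} (τ η : Tensor n k) : tinner τ η = tinner η τ := by
  simp [tinner, mul_comm]

lemma tinner_self_nonneg {n k : ℕ} (τ : Tensor n k) : 0 ≤ tinner τ τ :=
  Finset.sum_nonneg fun _ _ => mul_self_nonneg _

lemma tinner_self_eq_zero {n k : ℕ} {τ : Tensor n k} (h : tinner τ τ = 0) : τ = 0 := by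
  funext I
  have := (Finset.sum_eq_zero_iff_of_nonneg fun _ _ => mul_self_nonneg _).1 h I (Finset.mem_univ I)
  simpa using this

lemma tinner_smul_left {n k : ℕ} (c : ℝ) (τ η : Tensor n k) :
    tinner (c • τ) η = c * tinner τ η := by
  simp [tinner, Finset.mul_sum, mul_assoc]

lemma tinner_smul_right {n k : ℕ} (c : ℝ) (τ η : Tensor n k) :
    tinner τ (c • η) = c * tinner τ η := by
  rw [tinner_comm, tinner_smul_left, tinner_comm]

lemma tinner_sub_left {n k : ℕ} (τ τ' η : Tensor n k) :
    tinner (τ - τ') η = tinner τ η - tinner τ' η := by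
  simp [tinner, sub_mul, Finset.sum_sub_distrib]

lemma tinner_sub_right {n k : ℕ} (τ η η' : Tensor n k) :
    tinner τ (η - η') = tinner τ η - tinner τ η' := by
  simp [tinner, mul_sub, Finset.sum_sub_distrib]

lemma tinner_tpow {n : ℕ} (x y : Vec n) (k : ℕ) :
    tinner (tpow x k) (tpow y k) = (⟪x, y⟫ : ℝ) ^ k := by
  have : (⟪x, y⟫ : ℝ) = ∑ i, x i * y i := by simp [PiLp.inner_apply, mul_comm]
  rw [this, Finset.sum_pow', tinner]
  simp [tpow, Finset.prod_mul_distrib]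

lemma act_apply {n m : ℕ} (τ : Tensor n (m + 1)) (η : Tensor n m) (i : Fin n) :
    act τ η i = ∑ J : Fin m → Fin n, τ (Fin.cons i J) * η J := rfl

lemma act_add_left {n m : ℕ} (τ τ' : Tensor n (m + 1)) (η : Tensor n m) :
    act (τ + τ') η = act τ η + act τ' η := by
  ext i; simp [act_apply, add_mul, Finset.sum_add_distrib]

lemma act_smul_left {n m : ℕ} (c : ℝ) (τ : Tensor n (m + 1)) (η : Tensor n m) :
    act (c • τ) η = c • act τ η := by
  ext i; simp [act_apply, Finset.mul_sum, mul_assoc]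

lemma act_sum_left {n m : ℕ} {ι : Type*} (s : Finset ι) (τ : ι → Tensor n (m + 1))
    (η : Tensor n m) : act (∑ i ∈ s, τ i) η = ∑ i ∈ s, act (τ i) η := by
  induction s using Finset.cons_induction with
  | empty => ext i; simp [act_apply]
  | cons a s ha ih => rw [Finset.sum_cons, Finset.sum_cons, act_add_left, ih]

lemma act_sub_right {n m : ℕ} (τ : Tensor n (m + 1)) (η η' : Tensor n m) :
    act τ (η - η') = act τ η - act τ η' := by
  ext i; simp [act_apply, mul_sub, Finset.sum_sub_distrib]

lemma act_smul_right {n m : ℕ} (c : ℝ) (τ : Tensor n (m + 1)) (η : Tensor n m) :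
    act τ (c • η) = c • act τ η := by
  ext i; simp [act_apply, Finset.mul_sum, mul_left_comm]

lemma tpow_smul {n : ℕ} (c : ℝ) (x : Vec n) (k : ℕ) : tpow (c • x) k = c ^ k • tpow x k := by
  funext I; simp [tpow, Finset.prod_mul_distrib]

lemma act_tpow_tpow {n : ℕ} (x y : Vec n) (m : ℕ) :
    act (tpow x (m + 1)) (tpow y m) = (⟪x, y⟫ : ℝ) ^ m • x := by
  ext i
  rw [act_apply, ← tinner_tpow]
  simp only [tpow, Fin.prod_univ_succ, Fin.cons_zero, Fin.cons_succ, tinner, PiLp.smul_apply,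
    smul_eq_mul, Finset.sum_mul]
  exact Finset.sum_congr rfl fun J _ => by ring

lemma tinner_tpow_succ {n m : ℕ} (τ : Tensor n (m + 1)) (y : Vec n) :
    tinner τ (tpow y (m + 1)) = ⟪y, act τ (tpow y m)⟫ := by
  rw [tinner, sum_tensor_index]
  simp only [PiLp.inner_apply, act_apply, RCLike.inner_apply, conj_trivial]
  refine Finset.sum_congr rfl fun i _ => ?_
  rw [Finset.sum_mul]
  refine Finset.sum_congr rfl fun J _ => ?_
  simp [tpow, Fin.prod_univ_succ]; ring

lemma act_observation {n r m : ℕ} (β : Fin r → ℝ) (v : Fin r → Vec n) (Z : Tensor n (m + 1))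
    (x : Vec n) :
    act (observation β v Z) (tpow x m) =
      ∑ j, (β j * (⟪v j, x⟫ : ℝ) ^ m) • v j + act Z (tpow x m) := by
  rw [observation, act_add_left, act_sum_left]
  simp [act_smul_left, act_tpow_tpow, smul_smul]

/-! ### Gaussian noise: replacing one response by fresh noise -/

/-- The law of a vector with independent `N(0, 1/n)` entries. -/
def rowNoise (n : ℕ) : Measure (Fin n → ℝ) := Measure.pi fun _ => gaussianReal 0 ((n : ℝ≥0)⁻¹)

instance (n : ℕ) : IsProbabilityMeasure (rowNoise n) := by unfold rowNoise; infer_instance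
instance (n k : ℕ) : IsProbabilityMeasure (noise n k) := by unfold noise; infer_instance

/-- Replace the response `Z[q]` by `g`. -/
def resample {n m : ℕ} (q : Tensor n m) :
    ((Fin n → ℝ) × Tensor n (m + 1)) →ₗ[ℝ] Tensor n (m + 1) where
  toFun z := fun I => z.1 (I 0) * q (Fin.tail I) + (z.2 I - act z.2 q (I 0) * q (Fin.tail I))
  map_add' z z' := by
    funext I; simp [act_add_left]; ring
  map_smul' c z := by
    funext I; simp [act_smul_left]; ring

lemma resample_cons {n m : ℕ} (q : Tensor n m) (g : Fin n → ℝ) (Z : Tensor n (m + 1)) (i : Fin n)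
    (J : Fin m → Fin n) :
    resample q (g, Z) (Fin.cons i J) = g i * q J + (Z (Fin.cons i J) - act Z q i * q J) := by
  simp [resample]

/-- The form in which conditioning is used: with `g` fixed, the resampled tensor answers `η` by a
known vector plus the response of a fresh tensor to `η` minus its component along `q`. -/
lemma act_resample {n m : ℕ} (q η : Tensor n m) (g : Fin n → ℝ) (Z : Tensor n (m + 1)) :
    act (resample q (g, Z)) η =
      tinner q η • (WithLp.toLp 2 g : Vec n) + act Z (η - tinner q η • q) := by
  ext i
  rw [act_sub_right, act_smul_right]
  simp only [act_apply, resample_cons, PiLp.add_apply, PiLp.smul_apply, PiLp.sub_apply, smul_eq_mul,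
    tinner, add_mul, sub_mul, Finset.sum_add_distrib, Finset.sum_sub_distrib, mul_assoc,
    ← Finset.mul_sum]
  ring

lemma charFunDual_pi_gaussian {ι : Type*} [Fintype ι] [DecidableEq ι] (s : ℝ≥0)
    (L : StrongDual ℝ (ι → ℝ)) :
    charFunDual (Measure.pi fun _ : ι => gaussianReal 0 s) L =
      Complex.exp (-(s * ∑ i, (L (Pi.single i 1)) ^ 2 / 2 : ℝ)) := by
  rw [charFunDual_pi]
  have : ∀ i, charFunDual (gaussianReal 0 s) (L.comp (.single ℝ (fun _ : ι => ℝ) i)) =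
      Complex.exp (-(s * (L (Pi.single i 1)) ^ 2 / 2 : ℝ)) := by
    intro i
    rw [IsGaussian.charFunDual_eq]
    have h : (⇑(L.comp (.single ℝ (fun _ : ι => ℝ) i)) : ℝ → ℝ) =
        fun x => L (Pi.single i 1) * x := by
      funext x
      have : (Pi.single i x : ι → ℝ) = x • Pi.single i 1 := by
        rw [← Pi.single_smul]; simp
      simp [this, mul_comm]
    rw [h]
    have h1 : ∫ x, ((L (Pi.single i 1) * x : ℝ) : ℂ) ∂(gaussianReal 0 s) = 0 := by
      rw [integral_complex_ofReal, integral_const_mul, integral_id_gaussianReal]; simp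
    rw [h1, variance_const_mul, variance_fun_id_gaussianReal]
    congr 1; push_cast; ring
  simp_rw [this, ← Complex.exp_sum]
  congr 1
  push_cast
  rw [Finset.sum_neg_distrib, Finset.mul_sum]
  congr 1; exact Finset.sum_congr rfl fun i _ => by ring

/-- Computes the adjoint of `resample q`, which is what the characteristic function of the
pushforward in `map_resample` requires. -/
lemma tinner_resample {n m : ℕ} (q : Tensor n m) (c Z : Tensor n (m + 1)) (g : Fin n → ℝ) :
    tinner c (resample q (g, Z)) =
      ∑ i, act c q i * g i + tinner (fun I => c I - act c q (I 0) * q (Fin.tail I)) Z := by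
  have h : ∀ i, ∑ J : Fin m → Fin n, c (Fin.cons i J) * (act Z q i * q J) =
      ∑ J : Fin m → Fin n, act c q i * q J * Z (Fin.cons i J) := by
    intro i
    simp only [act_apply, Finset.sum_mul, Finset.mul_sum]
    rw [Finset.sum_comm]
    exact Finset.sum_congr rfl fun J _ => Finset.sum_congr rfl fun J' _ => by ring
  have h' : ∀ i, ∑ J : Fin m → Fin n, c (Fin.cons i J) * (g i * q J) = act c q i * g i := by
    intro i
    rw [act_apply, Finset.sum_mul]
    exact Finset.sum_congr rfl fun J _ => by ring
  simp only [tinner, sum_tensor_index, resample_cons, mul_add, mul_sub, sub_mul, Fin.cons_zero,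
    Fin.tail_cons, Finset.sum_add_distrib, Finset.sum_sub_distrib, h, h']

/-- Each row of `Z` is an isotropic Gaussian vector, so its component along a unit `q` is
independent of the rest and may be replaced by an independent copy. In terms of characteristic
functions this is Pythagoras for the rows of the dual vector. For `q = 0` resampling changes
nothing; this case is admitted so that zero queries need no separate treatment. -/
lemma map_resample {n m : ℕ} (q : Tensor n m) (hq : tinner q q = 1 ∨ q = 0) :
    ((rowNoise n).prod (noise n (m + 1))).map (resample q) = noise n (m + 1) := by
  classical
  set Ψ : ((Fin n → ℝ) × Tensor n (m + 1)) →L[ℝ] Tensor n (m + 1) :=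
    LinearMap.toContinuousLinearMap (resample q) with hΨ
  change ((rowNoise n).prod (noise n (m + 1))).map Ψ = noise n (m + 1)
  apply Measure.ext_of_charFunDual
  ext L
  rw [charFunDual_map, charFunDual_prod, rowNoise, noise, charFunDual_pi_gaussian,
    charFunDual_pi_gaussian, charFunDual_pi_gaussian, ← Complex.exp_add]
  congr 1
  set c : Tensor n (m + 1) := fun I => L (Pi.single I 1) with hc
  have hL : ∀ τ, L τ = tinner c τ := by
    intro τ
    conv_lhs => rw [pi_eq_sum_univ' τ]
    simp [tinner, hc, mul_comm, Pi.single]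
  have h1 : ∀ i, ((L.comp Ψ).comp (.inl ℝ _ _)) (Pi.single i 1) = act c q i := by
    intro i
    change L (resample q (Pi.single i 1, 0)) = _
    rw [hL, tinner_resample]
    simp [tinner, Pi.single_apply]
  have h2 : ∀ I, ((L.comp Ψ).comp (.inr ℝ _ _)) (Pi.single I 1) =
      c I - act c q (I 0) * q (Fin.tail I) := by
    intro I
    change L (resample q (0, Pi.single I 1)) = _
    rw [hL, tinner_resample]
    simp [tinner, Pi.single_apply]
  simp_rw [h1, h2]
  -- Pythagoras, row by row: the component of the row along `q` plus the orthogonal rest.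
  have key : ∑ i, act c q i ^ 2 + ∑ I : Fin (m + 1) → Fin n,
      (c I - act c q (I 0) * q (Fin.tail I)) ^ 2 = ∑ I, c I ^ 2 := by
    rw [sum_tensor_index, sum_tensor_index, ← Finset.sum_add_distrib]
    refine Finset.sum_congr rfl fun i _ => ?_
    simp only [Fin.cons_zero, Fin.tail_cons]
    have e : ∑ J : Fin m → Fin n, (c (Fin.cons i J) - act c q i * q J) ^ 2 =
        ∑ J : Fin m → Fin n, c (Fin.cons i J) ^ 2 - 2 * act c q i * act c q i
          + act c q i ^ 2 * tinner q q := by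
      nth_rw 3 [act_apply]
      rw [tinner, Finset.mul_sum, Finset.mul_sum, ← Finset.sum_sub_distrib,
        ← Finset.sum_add_distrib]
      exact Finset.sum_congr rfl fun J _ => by ring
    rw [e]
    rcases hq with hq | hq
    · rw [hq]; ring
    · have : act c q i = 0 := by simp [act_apply, hq]
      rw [this]; ring
  have e : ((n : ℝ≥0)⁻¹ : ℝ) * ∑ i, act c q i ^ 2 / 2 + ((n : ℝ≥0)⁻¹ : ℝ) *
      ∑ I : Fin (m + 1) → Fin n, (c I - act c q (I 0) * q (Fin.tail I)) ^ 2 / 2 =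
      ((n : ℝ≥0)⁻¹ : ℝ) * ∑ I, c I ^ 2 / 2 := by
    rw [← mul_add, ← Finset.sum_div, ← Finset.sum_div, ← Finset.sum_div, ← add_div, key]
  rw [← Complex.ofReal_neg, ← Complex.ofReal_neg, ← Complex.ofReal_neg, ← Complex.ofReal_add]
  congr 1
  push_cast at e ⊢
  linarith

/-- The Euclidean norm of a tensor. -/
def tnorm {n k : ℕ} (q : Tensor n k) : ℝ := √(tinner q q)

lemma tnorm_nonneg {n k : ℕ} (q : Tensor n k) : 0 ≤ tnorm q := Real.sqrt_nonneg _

lemma tnorm_sq {n k : ℕ} (q : Tensor n k) : tnorm q ^ 2 = tinner q q :=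
  Real.sq_sqrt (tinner_self_nonneg q)

lemma tnorm_tpow {n : ℕ} (x : Vec n) (k : ℕ) : tnorm (tpow x k) = ‖x‖ ^ k := by
  rw [tnorm, tinner_tpow, real_inner_self_eq_norm_sq, ← pow_mul, mul_comm, pow_mul,
    Real.sqrt_sq (by positivity)]

lemma exists_direction {n k : ℕ} (x : Tensor n k) :
    ∃ q : Tensor n k, (tinner q q = 1 ∨ q = 0) ∧ x = tnorm x • q ∧ tinner q x = tnorm x := by
  by_cases hx : tnorm x = 0
  · have : x = 0 := tinner_self_eq_zero (by rw [← tnorm_sq, hx]; simp)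
    refine ⟨0, Or.inr rfl, by simp [this], ?_⟩
    rw [hx]; simp [tinner]
  · have h : tinner ((tnorm x)⁻¹ • x) x = tnorm x := by
      rw [tinner_smul_left, ← tnorm_sq]; field_simp
    refine ⟨(tnorm x)⁻¹ • x, Or.inl ?_, by rw [smul_smul, mul_inv_cancel₀ hx, one_smul], h⟩
    rw [tinner_smul_right, h, inv_mul_cancel₀ hx]

/-- The part of `η` orthogonal to the direction `q`. -/
def residual {n k : ℕ} (q η : Tensor n k) : Tensor n k := η - tinner q η • q

lemma tinner_residual_self {n k : ℕ} {q : Tensor n k} (hq : tinner q q = 1 ∨ q = 0)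
    (η : Tensor n k) : tinner (residual q η) (residual q η) = tinner η η - tinner q η ^ 2 := by
  simp only [residual, tinner_sub_left, tinner_sub_right, tinner_smul_left, tinner_smul_right,
    tinner_comm η q]
  rcases hq with hq | hq
  · rw [hq]; ring
  · subst hq; simp [tinner]

lemma tinner_residual {n k : ℕ} {q : Tensor n k} (hq : tinner q q = 1 ∨ q = 0)
    (η : Tensor n k) : tinner q (residual q η) = 0 := by
  simp only [residual, tinner_sub_right, tinner_smul_right]
  rcases hq with hq | hq
  · rw [hq]; ring
  · subst hq; simp [tinner]

lemma tnorm_residual_le {n k : ℕ} {q : Tensor n k} (hq : tinner q q = 1 ∨ q = 0)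
    (η : Tensor n k) : tnorm (residual q η) ≤ tnorm η := by
  apply Real.sqrt_le_sqrt
  rw [tinner_residual_self hq]; nlinarith [sq_nonneg (tinner q η)]

lemma abs_tinner_le {n k : ℕ} {q : Tensor n k} (hq : tinner q q = 1 ∨ q = 0)
    (η : Tensor n k) : |tinner q η| ≤ tnorm η := by
  apply Real.abs_le_sqrt
  have := tinner_self_nonneg (residual q η)
  rw [tinner_residual_self hq] at this; linarith

lemma act_resample' {n m : ℕ} (q η : Tensor n m) (g : Fin n → ℝ) (Z : Tensor n (m + 1)) :
    act (resample q (g, Z)) η =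
      tinner q η • (WithLp.toLp 2 g : Vec n) + act Z (residual q η) := act_resample q η g Z

/-! ### Measurability -/

lemma measurable_tinner {n k : ℕ} : Measurable fun p : Tensor n k × Tensor n k => tinner p.1 p.2 := by
  unfold tinner; fun_prop

lemma measurable_act {n m : ℕ} :
    Measurable fun p : Tensor n (m + 1) × Tensor n m => act p.1 p.2 := by
  apply (PiLp.continuous_toLp 2 _).measurable.comp
  fun_prop

lemma measurable_tnorm {n k : ℕ} : Measurable (tnorm : Tensor n k → ℝ) :=
  (measurable_tinner.comp (measurable_id.prodMk measurable_id)).sqrt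

lemma measurable_residual {n k : ℕ} (q : Tensor n k) : Measurable (residual q) := by
  unfold residual tinner; fun_prop

lemma measurable_tpow {n : ℕ} (k : ℕ) : Measurable fun x : Vec n => tpow x k := by
  unfold tpow; fun_prop

lemma measurable_resample {n m : ℕ} (q : Tensor n m) : Measurable (resample q) :=
  (LinearMap.continuous_of_finiteDimensional (resample q)).measurable

/-! ### Conditioning on one response -/

lemma noise_apply_eq_lintegral {n m : ℕ} {q : Tensor n m} (hq : tinner q q = 1 ∨ q = 0)
    {S : Set (Tensor n (m + 1))} (hS : MeasurableSet S) :
    noise n (m + 1) S = ∫⁻ g, noise n (m + 1) {Z | resample q (g, Z) ∈ S} ∂rowNoise n := by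
  conv_lhs => rw [← map_resample q hq, Measure.map_apply (measurable_resample q) hS,
    Measure.prod_apply (measurable_resample q hS)]
  rfl

/-- Fubini over the resampled response: `b` pays for the exceptional responses, `c` bounds the
conditional probability for all others. Since `B` is not assumed measurable, its measurable hull is
integrated instead. -/
lemma noise_le_of_forall_response {n m : ℕ} {q : Tensor n m} (hq : tinner q q = 1 ∨ q = 0)
    {S : Set (Tensor n (m + 1))} (hS : MeasurableSet S) {B : Set (Fin n → ℝ)} {b c : ENNReal}
    (hB : rowNoise n B ≤ b)
    (hc : ∀ g, g ∉ B → noise n (m + 1) {Z | resample q (g, Z) ∈ S} ≤ c) :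
    noise n (m + 1) S ≤ b + c := by
  rw [noise_apply_eq_lintegral hq hS]
  calc _ ≤ ∫⁻ g, (toMeasurable (rowNoise n) B).indicator 1 g + c ∂rowNoise n := by
        refine lintegral_mono fun g => ?_
        by_cases hg : g ∈ B
        · have : g ∈ toMeasurable (rowNoise n) B := subset_toMeasurable _ _ hg
          simp only [this, Set.indicator_of_mem, Pi.one_apply]
          exact prob_le_one.trans le_self_add
        · exact (hc g hg).trans le_add_self
    _ = rowNoise n B + c := by
        rw [lintegral_add_right _ measurable_const, lintegral_indicator_one
          (measurableSet_toMeasurable _ _), measure_toMeasurable]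
        simp
    _ ≤ b + c := by gcongr

/-- After resampling, the response to `q` is the first factor of a product measure. -/
lemma map_act_noise {n m : ℕ} {q : Tensor n m} (hq : tinner q q = 1) :
    (noise n (m + 1)).map (fun Z (i : Fin n) => act Z q i) = rowNoise n := by
  have hm : Measurable fun (Z : Tensor n (m + 1)) (i : Fin n) => act Z q i := by
    simp only [act_apply]; fun_prop
  conv_lhs => rw [← map_resample q (Or.inl hq), Measure.map_map hm (measurable_resample q)]
  have : (fun (Z : Tensor n (m + 1)) (i : Fin n) => act Z q i) ∘ resample q = Prod.fst := by
    funext ⟨g, Z⟩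
    funext i
    simp only [Function.comp, act_resample, hq]
    simp [act_apply]
  rw [this, ← Measure.fst, Measure.fst_prod]

/-! ### Second moments of a Gaussian vector -/

/-- Chebyshev with variance `‖a‖² / n`. Polynomial tails are enough here, since only boundedly many
such events are ever combined and `M` may depend on the target probability. -/
lemma rowNoise_inner_tail {n : ℕ} (a : Vec n) {M : ℝ} (hM : 0 < M) :
    rowNoise n {g | M / √n * ‖a‖ < |⟪a, (WithLp.toLp 2 g : Vec n)⟫|} ≤
      ENNReal.ofReal (1 / M ^ 2) := by
  by_cases ha : a = 0
  · subst ha; simp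
  have hn : 0 < n := by
    rcases Nat.eq_zero_or_pos n with h | h
    · subst h; exact absurd (Subsingleton.elim a 0) ha
    · exact h
  have hn' : (0 : ℝ) < n := by exact_mod_cast hn
  have hmem : ∀ i, MemLp (fun x : ℝ => a i * x) 2 (gaussianReal 0 ((n : ℝ≥0)⁻¹)) := fun i =>
    (memLp_id_gaussianReal 2).const_mul (a i)
  set X : (Fin n → ℝ) → ℝ := fun g => ∑ i, a i * g i with hX
  have hmem' : ∀ i, MemLp (fun g : Fin n → ℝ => a i * g i) 2 (rowNoise n) := fun i =>
    (hmem i).comp_measurePreserving (measurePreserving_eval _ i)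
  have hXmem : MemLp X 2 (rowNoise n) := memLp_finsetSum _ fun i _ => hmem' i
  have hmean : ∫ g, X g ∂rowNoise n = 0 := by
    rw [hX, integral_finsetSum _ fun i _ => (hmem' i).integrable (by norm_num)]
    refine Finset.sum_eq_zero fun i _ => ?_
    have := integral_comp_eval (μ := fun _ : Fin n => gaussianReal 0 ((n : ℝ≥0)⁻¹)) (i := i)
      (f := fun x => a i * x) (by fun_prop)
    rw [rowNoise, this, integral_const_mul, integral_id_gaussianReal, mul_zero]
  have hvar : Var[X; rowNoise n] = ‖a‖ ^ 2 / n := by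
    have := variance_sum_pi hmem
    have e : (∑ i, fun g : Fin n → ℝ => a i * g i) = X := by funext g; simp [hX]
    rw [e] at this
    rw [rowNoise, this, EuclideanSpace.norm_sq_eq, Finset.sum_div]
    refine Finset.sum_congr rfl fun i _ => ?_
    rw [variance_const_mul, variance_fun_id_gaussianReal]
    simp [div_eq_mul_inv]
  have hc : 0 < M / √n * ‖a‖ := by positivity
  have := meas_ge_le_variance_div_sq hXmem hc
  rw [hmean, hvar] at this
  refine (measure_mono fun g hg => ?_).trans (this.trans (le_of_eq ?_))
  · simp only [Set.mem_ofPred_eq, PiLp.inner_apply, RCLike.inner_apply, conj_trivial] at hg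
    simp only [Set.mem_ofPred_eq, hX, sub_zero]
    rw [show ∑ i, a i * g i = ∑ i, g i * a i from Finset.sum_congr rfl fun i _ => mul_comm _ _]
    exact hg.le
  · congr 1
    have h2 : √(n : ℝ) ^ 2 = n := Real.sq_sqrt hn'.le
    have : ‖a‖ ≠ 0 := norm_ne_zero_iff.2 ha
    rw [mul_pow, div_pow, h2]; field_simp

/-- Chebyshev again: by scaling, `‖g‖²` has mean `1` and variance `V / n`, with `V` the variance of
the square of a standard Gaussian. -/
lemma exists_rowNoise_norm_tail : ∃ C : ℝ, 0 < C ∧ ∀ (n : ℕ) (M : ℝ), 0 < n → 0 < M →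
    rowNoise n {g | M / √n < |‖(WithLp.toLp 2 g : Vec n)‖ ^ 2 - 1|} ≤
      ENNReal.ofReal (C / M ^ 2) := by
  set V := Var[fun x : ℝ => x ^ 2; gaussianReal 0 1] with hV
  have hV0 : 0 ≤ V := variance_nonneg _ _
  refine ⟨V + 1, by positivity, fun n M hn hM => ?_⟩
  have hn' : (0 : ℝ) < n := by exact_mod_cast hn
  have h2 : √(n : ℝ) ^ 2 = n := Real.sq_sqrt hn'.le
  set μ := gaussianReal 0 ((n : ℝ≥0)⁻¹) with hμ
  have hmap : (gaussianReal 0 1).map (fun x => (√n)⁻¹ * x) = μ := by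
    rw [gaussianReal_map_const_mul, hμ, mul_zero, mul_one]
    congr 1
    ext; push_cast; rw [inv_pow, h2]
  have hmem : MemLp (fun x : ℝ => x ^ 2) 2 μ := by
    rw [memLp_two_iff_integrable_sq (by fun_prop)]
    have := (memLp_id_gaussianReal (μ := 0) (v := (n : ℝ≥0)⁻¹) 4).integrable_norm_pow
      (p := 4) (by norm_num)
    refine this.congr (Eventually.of_forall fun x => ?_)
    simp only [id, Real.norm_eq_abs]
    rw [← pow_mul, Even.pow_abs (by decide)]
  have hmean1 : ∫ x, x ^ 2 ∂μ = (n : ℝ)⁻¹ := by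
    have := variance_fun_id_gaussianReal (μ := 0) (v := (n : ℝ≥0)⁻¹)
    rw [variance_of_integral_eq_zero (by fun_prop) integral_id_gaussianReal] at this
    rw [hμ, this]; simp
  have hvar1 : Var[fun x : ℝ => x ^ 2; μ] = V / n ^ 2 := by
    rw [← hmap, variance_map (by fun_prop) (by fun_prop)]
    have : (fun x : ℝ => x ^ 2) ∘ (fun x => (√n)⁻¹ * x) = fun x => (n : ℝ)⁻¹ * x ^ 2 := by
      funext x; simp only [Function.comp]; rw [mul_pow, inv_pow, h2]
    rw [this, variance_const_mul, hV]
    field_simp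
  set X : (Fin n → ℝ) → ℝ := fun g => ∑ i, g i ^ 2 with hX
  have hmem' : ∀ i, MemLp (fun g : Fin n → ℝ => g i ^ 2) 2 (rowNoise n) := fun i =>
    hmem.comp_measurePreserving (measurePreserving_eval _ i)
  have hXmem : MemLp X 2 (rowNoise n) := memLp_finsetSum _ fun i _ => hmem' i
  have hmean : ∫ g, X g ∂rowNoise n = 1 := by
    rw [hX, integral_finsetSum _ fun i _ => (hmem' i).integrable (by norm_num)]
    have : ∀ i : Fin n, ∫ g : Fin n → ℝ, g i ^ 2 ∂rowNoise n = (n : ℝ)⁻¹ := fun i => by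
      rw [rowNoise, ← hmean1]
      exact integral_comp_eval (μ := fun _ : Fin n => gaussianReal 0 ((n : ℝ≥0)⁻¹)) (i := i)
        (f := fun x => x ^ 2) (by fun_prop)
    simp [this, hn'.ne']
  have hvar : Var[X; rowNoise n] = V / n := by
    have := variance_sum_pi (fun _ : Fin n => hmem)
    have e : (∑ i, fun g : Fin n → ℝ => g i ^ 2) = X := by funext g; simp [hX]
    rw [e] at this
    rw [rowNoise, this]
    simp [hvar1]; field_simp
  have hc : 0 < M / √n := by positivity
  have := meas_ge_le_variance_div_sq hXmem hc
  rw [hmean, hvar] at this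
  refine (measure_mono fun g hg => ?_).trans (this.trans (ENNReal.ofReal_le_ofReal ?_))
  · simp only [Set.mem_ofPred_eq, EuclideanSpace.norm_sq_eq, Real.norm_eq_abs, sq_abs] at hg
    exact hg.le
  · rw [div_pow, h2]
    have : V / n / (M ^ 2 / n) = V / M ^ 2 := by field_simp
    rw [this]; gcongr; linarith

/-! ### Adaptive queries of the noise tensor -/

/-- The states of an adaptive procedure which at each time queries `Z` in the direction `x s`, for
`s` the current state, and updates the state by `f` according to the response. -/
def orbit {n m : ℕ} {S : Type*} (f : S → Vec n → S) (x : S → Tensor n m) (Z : Tensor n (m + 1))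
    (s : S) : ℕ → S
  | 0 => s
  | t + 1 => f (orbit f x Z s t) (act Z (x (orbit f x Z s t)))

section Orbit

variable {n m : ℕ} {S : Type*} {f : S → Vec n → S} {x : S → Tensor n m}

lemma orbit_succ' (f : S → Vec n → S) (x : S → Tensor n m) (Z : Tensor n (m + 1)) (s : S) (t : ℕ) :
    orbit f x Z s (t + 1) = orbit f x Z (f s (act Z (x s))) t := by
  induction t with
  | zero => rfl
  | succ t ih => rw [orbit, ih]; rfl

/-- A run against the resampled tensor is again an adaptive procedure against `Z`: its queries are
the residuals, and the known part of each response is moved into the update. This closure property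
drives the induction in `noise_adaptive_tail`. -/
lemma orbit_resample (f : S → Vec n → S) (x : S → Tensor n m) (q : Tensor n m) (g : Fin n → ℝ)
    (Z : Tensor n (m + 1)) (s : S) (t : ℕ) :
    orbit f x (resample q (g, Z)) s t =
      orbit (fun s y => f s (tinner q (x s) • (WithLp.toLp 2 g : Vec n) + y))
        (fun s => residual q (x s)) Z s t := by
  induction t with
  | zero => rfl
  | succ t ih => rw [orbit, orbit, ih, act_resample']

variable [MeasurableSpace S]

lemma measurable_orbit (hf : Measurable fun p : S × Vec n => f p.1 p.2) (hx : Measurable x)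
    (t : ℕ) : Measurable fun p : Tensor n (m + 1) × S => orbit f x p.1 p.2 t := by
  induction t with
  | zero => exact measurable_snd
  | succ t ih => exact hf.comp (ih.prodMk (measurable_act.comp (measurable_fst.prodMk (hx.comp ih))))

/-- In an adaptive procedure of `T` queries all responses behave in a fixed direction `a` as if the
queries were chosen in advance. -/
theorem noise_adaptive_tail (T : ℕ) : ∀ {f : S → Vec n → S} {x : S → Tensor n m}
    (_ : Measurable fun p : S × Vec n => f p.1 p.2) (_ : Measurable x) (s : S) (a : Vec n)
    {M : ℝ} (_ : 0 < M),
    noise n (m + 1) {Z | ∃ t < T, T * (M / √n) * ‖a‖ * tnorm (x (orbit f x Z s t)) <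
      |⟪a, act Z (x (orbit f x Z s t))⟫|} ≤ T * ENNReal.ofReal (1 / M ^ 2) := by
  induction T with
  | zero => intros; simp
  | succ T ih =>
    intro f x hf hx s a M hM
    -- Condition on the response to the normalized first query. The exceptional responses `g` are
    -- those with an atypical component along `a`.
    obtain ⟨q, hq, hxq, hqx⟩ := exists_direction (x s)
    have hms : Measurable fun Z : Tensor n (m + 1) => Z := measurable_id
    have hmeas : ∀ t, Measurable fun Z : Tensor n (m + 1) => x (orbit f x Z s t) := fun t =>
      hx.comp ((measurable_orbit hf hx t).comp (measurable_id.prodMk measurable_const))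
    have hS : MeasurableSet {Z | ∃ t < T + 1, ((T + 1 : ℕ) : ℝ) * (M / √n) * ‖a‖ *
        tnorm (x (orbit f x Z s t)) < |⟪a, act Z (x (orbit f x Z s t))⟫|} := by
      have : ∀ t : ℕ, MeasurableSet {Z | ((T + 1 : ℕ) : ℝ) * (M / √n) * ‖a‖ *
          tnorm (x (orbit f x Z s t)) < |⟪a, act Z (x (orbit f x Z s t))⟫|} := by
        intro t
        refine measurableSet_lt ?_ ?_
        · exact (measurable_tnorm.comp (hmeas t)).const_mul _
        · exact (measurable_const.inner
            (measurable_act.comp (measurable_id.prodMk (hmeas t)))).abs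
      convert! MeasurableSet.iUnion fun t => MeasurableSet.iUnion fun _ : t < T + 1 => this t using 1
      ext Z; simp
    have h1 := noise_le_of_forall_response hq hS (rowNoise_inner_tail a hM)
      (c := T * ENNReal.ofReal (1 / M ^ 2)) ?_
    · refine h1.trans (le_of_eq ?_)
      push_cast; ring
    intro g hg
    simp only [Set.mem_ofPred_eq, not_lt] at hg
    set G : Vec n := WithLp.toLp 2 g with hG
    have hf' : Measurable fun p : S × Vec n =>
        (fun s y => f s (tinner q (x s) • G + y)) p.1 p.2 := by
      refine hf.comp (measurable_fst.prodMk (Measurable.add ?_ measurable_snd))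
      exact (measurable_tinner.comp
        (measurable_const.prodMk (hx.comp measurable_fst))).smul_const G
    have hx' : Measurable fun s => residual q (x s) := (measurable_residual q).comp hx
    -- With `g` fixed the first response is the known vector `tnorm (x s) • g`, so the remaining `T`
    -- queries form an adaptive procedure with a deterministic start, to which the induction
    -- hypothesis applies.
    refine (measure_mono ?_).trans (ih (f := fun s y => f s (tinner q (x s) • G + y)) hf' hx' (f s (tnorm (x s) • G)) a hM)
    rintro Z ⟨t, ht, hlt⟩
    have hMn : 0 ≤ M / √n * ‖a‖ := by positivity
    rw [act_resample', inner_add_right, inner_smul_right] at hlt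
    cases t with
    | zero =>
      exfalso
      simp only [orbit] at hlt
      -- The first query is parallel to `q`, so its response involves `g` only.
      have h0 : act Z (residual q (x s)) = 0 := by
        have : residual q (x s) = 0 := by
          rw [residual, hqx, ← hxq, sub_self]
        rw [this]; ext i; simp [act_apply]
      rw [h0, inner_zero_right, add_zero, hqx, abs_mul, abs_of_nonneg (tnorm_nonneg _)] at hlt
      have : tnorm (x s) * |⟪a, G⟫| ≤ tnorm (x s) * (M / √n * ‖a‖) :=
        mul_le_mul_of_nonneg_left hg (tnorm_nonneg _)
      have h3 : 0 ≤ T * (M / √n * ‖a‖ * tnorm (x s)) := by have := tnorm_nonneg (x s); positivity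
      push_cast at hlt
      nlinarith
    | succ t =>
      refine ⟨t, by omega, ?_⟩
      have horb : orbit f x (resample q (g, Z)) s (t + 1) =
          orbit (fun s y => f s (tinner q (x s) • G + y)) (fun s => residual q (x s)) Z
            (f s (tnorm (x s) • G)) t := by
        rw [orbit_resample, orbit_succ']
        congr 1
        rw [hqx]
        have : residual q (x s) = 0 := by
          rw [residual, hqx, ← hxq, sub_self]
        rw [this]
        have h0 : act Z (0 : Tensor n m) = 0 := by ext i; simp [act_apply]
        rw [h0, add_zero]
      rw [horb] at hlt
      set s' := orbit (fun s y => f s (tinner q (x s) • G + y)) (fun s => residual q (x s)) Z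
            (f s (tnorm (x s) • G)) t
      -- A later response is its part along `q`, costing one unit of `M / √n`, plus a residual
      -- response costing `T` units by induction; this is the origin of the factor `T + 1`.
      have h1 : |tinner q (x s') * ⟪a, G⟫| ≤ tnorm (x s') * (M / √n * ‖a‖) := by
        rw [abs_mul]
        exact mul_le_mul (abs_tinner_le hq _) hg (abs_nonneg _) (tnorm_nonneg _)
      have h2 := abs_add_le (tinner q (x s') * ⟪a, G⟫) ⟪a, act Z (residual q (x s'))⟫
      have h3 : T * (M / √n * ‖a‖) * tnorm (residual q (x s')) ≤
          T * (M / √n * ‖a‖) * tnorm (x s') :=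
        mul_le_mul_of_nonneg_left (tnorm_residual_le hq _) (by positivity)
      push_cast at hlt
      nlinarith

/-- The responses to adaptive queries that follow a first query `q`, with the component along `q`
removed, behave in a direction that depends on the first response as if the queries were chosen in
advance. -/
theorem noise_residual_tail (T : ℕ) (hf : Measurable fun p : S × Vec n => f p.1 p.2)
    (hx : Measurable x) {s : Vec n → S} (hs : Measurable s) {a : Vec n → Vec n} (ha : Measurable a)
    {q : Tensor n m} (hq : tinner q q = 1) {M : ℝ} (hM : 0 < M) :
    noise n (m + 1) {Z | ∃ t < T, T * (M / √n) * ‖a (act Z q)‖ *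
        tnorm (residual q (x (orbit f x Z (s (act Z q)) t))) <
      |⟪a (act Z q), act Z (residual q (x (orbit f x Z (s (act Z q)) t)))⟫|} ≤
        T * ENNReal.ofReal (1 / M ^ 2) := by
  have hξ : Measurable fun Z : Tensor n (m + 1) => act Z q :=
    measurable_act.comp (measurable_id.prodMk measurable_const)
  have hmeas : ∀ t, Measurable fun Z : Tensor n (m + 1) =>
      residual q (x (orbit f x Z (s (act Z q)) t)) := fun t =>
    (measurable_residual q).comp
      (hx.comp ((measurable_orbit hf hx t).comp (measurable_id.prodMk (hs.comp hξ))))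
  have hS : MeasurableSet {Z | ∃ t < T, T * (M / √n) * ‖a (act Z q)‖ *
        tnorm (residual q (x (orbit f x Z (s (act Z q)) t))) <
      |⟪a (act Z q), act Z (residual q (x (orbit f x Z (s (act Z q)) t)))⟫|} := by
    have : ∀ t : ℕ, MeasurableSet {Z | T * (M / √n) * ‖a (act Z q)‖ *
        tnorm (residual q (x (orbit f x Z (s (act Z q)) t))) <
      |⟪a (act Z q), act Z (residual q (x (orbit f x Z (s (act Z q)) t)))⟫|} := by
      intro t
      refine measurableSet_lt ?_ ?_
      · exact ((ha.comp hξ).norm.const_mul _).mul (measurable_tnorm.comp (hmeas t))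
      · exact ((ha.comp hξ).inner (measurable_act.comp (measurable_id.prodMk (hmeas t)))).abs
    convert! MeasurableSet.iUnion fun t => MeasurableSet.iUnion fun _ : t < T => this t using 1
    ext Z; simp
  -- No response to `q` is exceptional: only the components orthogonal to `q` are measured, so the
  -- bound holds conditionally on every value of the response.
  refine (noise_le_of_forall_response (Or.inl hq) hS (B := ∅) (b := 0) (by simp)
    (c := T * ENNReal.ofReal (1 / M ^ 2)) ?_).trans (by simp)
  intro g _
  set G : Vec n := WithLp.toLp 2 g with hG
  have hf' : Measurable fun p : S × Vec n =>
      (fun s y => f s (tinner q (x s) • G + y)) p.1 p.2 := by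
    refine hf.comp (measurable_fst.prodMk (Measurable.add ?_ measurable_snd))
    exact (measurable_tinner.comp
      (measurable_const.prodMk (hx.comp measurable_fst))).smul_const G
  have hx' : Measurable fun s => residual q (x s) := (measurable_residual q).comp hx
  refine (measure_mono ?_).trans (noise_adaptive_tail T
    (f := fun s y => f s (tinner q (x s) • G + y)) hf' hx' (s G) (a G) hM)
  rintro Z ⟨t, ht, hlt⟩
  refine ⟨t, ht, ?_⟩
  -- The response to `q` is exactly the fixed `g`, so the start and the direction, both functions of
  -- it, become constants.
  have hG' : act (resample q (g, Z)) q = G := by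
    rw [act_resample', hq, one_smul]
    have : residual q q = 0 := by rw [residual, hq, one_smul, sub_self]
    rw [this]
    have h0 : act Z (0 : Tensor n m) = 0 := by ext i; simp [act_apply]
    rw [h0, add_zero]
  rw [hG', orbit_resample, act_resample', tinner_residual (Or.inl hq), zero_smul, zero_add] at hlt
  have hidem : ∀ η : Tensor n m, residual q (residual q η) = residual q η := fun η => by
    conv_lhs => rw [residual, tinner_residual (Or.inl hq), zero_smul, sub_zero]
  rw [hidem] at hlt
  exact hlt

end Orbit

/-! ### The injective norm of the noise tensor -/

/-- A maximal `1/2`-separated subset of the unit ball is a `1/2`-net. Doubling it gives a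
`1`-separated subset of the ball of radius `2`, whence the cardinality bound. -/
lemma exists_net (E : Type*) [NormedAddCommGroup E] [NormedSpace ℝ E] [FiniteDimensional ℝ E] :
    ∃ N : Finset E, N.card ≤ 5 ^ Module.finrank ℝ E ∧ (∀ c ∈ N, ‖c‖ ≤ 1) ∧
      ∀ x : E, ‖x‖ ≤ 1 → ∃ c ∈ N, ‖x - c‖ ≤ 1 / 2 := by
  classical
  set P : Finset E → Prop := fun s =>
    (∀ c ∈ s, ‖c‖ ≤ 1) ∧ ∀ c ∈ s, ∀ d ∈ s, c ≠ d → 1 / 2 ≤ ‖c - d‖ with hP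
  have hcard : ∀ s, P s → s.card ≤ 5 ^ Module.finrank ℝ E := by
    intro s hs
    have hinj : Function.Injective fun x : E => (2 : ℝ) • x :=
      smul_right_injective E (two_ne_zero)
    rw [← Finset.card_image_of_injective s hinj]
    refine Besicovitch.card_le_of_separated _ ?_ ?_
    · simp only [Finset.mem_image, forall_exists_index, and_imp, forall_apply_eq_imp_iff₂]
      intro c hc
      rw [norm_smul]; have := hs.1 c hc; norm_num; linarith
    · simp only [Finset.mem_image, forall_exists_index, and_imp, forall_apply_eq_imp_iff₂]
      intro c hc d hd hne
      rw [← smul_sub, norm_smul]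
      have := hs.2 c hc d hd (fun h => hne (by rw [h]))
      norm_num; linarith
  set A : Set ℕ := {k | ∃ s, P s ∧ s.card = k} with hA
  have hne : A.Nonempty := ⟨0, ∅, by simp [hP], rfl⟩
  have hbdd : BddAbove A := ⟨5 ^ Module.finrank ℝ E, by rintro k ⟨s, hs, rfl⟩; exact hcard s hs⟩
  obtain ⟨s, hs, hsmax⟩ := Nat.sSup_mem hne hbdd
  refine ⟨s, hcard s hs, hs.1, fun x hx => ?_⟩
  by_contra! hcon
  have hxs : x ∉ s := fun h => by have := hcon x h; simp at this; linarith
  have hP' : P (insert x s) := by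
    refine ⟨?_, ?_⟩
    · intro c hc
      rcases Finset.mem_insert.1 hc with rfl | hc
      exacts [hx, hs.1 c hc]
    · intro c hc d hd hne
      rcases Finset.mem_insert.1 hc with hc' | hc' <;>
        rcases Finset.mem_insert.1 hd with hd' | hd'
      · exact absurd (hc'.trans hd'.symm) hne
      · rw [hc']; exact (hcon d hd').le
      · rw [hd', norm_sub_rev]; exact (hcon c hc').le
      · exact hs.2 c hc' d hd' hne
  have : s.card + 1 ≤ sSup A := le_csSup hbdd ⟨_, hP', Finset.card_insert_of_notMem hxs⟩
  omega

/-- Approximating a unit vector by a net point gives `‖L‖ ≤ s + ‖L‖ / 2`. -/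
lemma linear_le_of_net {E : Type*} [NormedAddCommGroup E] [NormedSpace ℝ E]
    [FiniteDimensional ℝ E] {N : Finset E}
    (hN : ∀ x : E, ‖x‖ ≤ 1 → ∃ c ∈ N, ‖x - c‖ ≤ 1 / 2) (l : E →ₗ[ℝ] ℝ) {s : ℝ}
    (hs : ∀ c ∈ N, |l c| ≤ s) (x : E) : |l x| ≤ 2 * s * ‖x‖ := by
  set L := LinearMap.toContinuousLinearMap l
  obtain ⟨c₀, hc₀, _⟩ := hN 0 (by simp)
  have hs0 : 0 ≤ s := (abs_nonneg _).trans (hs c₀ hc₀)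
  have h : ‖L‖ ≤ s + ‖L‖ / 2 := by
    refine ContinuousLinearMap.opNorm_le_of_unit_norm (by positivity) fun y hy => ?_
    obtain ⟨c, hc, hyc⟩ := hN y hy.le
    have h1 : ‖L (y - c)‖ ≤ ‖L‖ * (1 / 2) :=
      (L.le_opNorm _).trans (mul_le_mul_of_nonneg_left hyc (norm_nonneg _))
    have h2 : ‖L c‖ ≤ s := hs c hc
    calc ‖L y‖ = ‖L c + L (y - c)‖ := by rw [← map_add]; simp
      _ ≤ _ := (norm_add_le _ _).trans (by linarith)
  calc |l x| = ‖L x‖ := rfl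
    _ ≤ ‖L‖ * ‖x‖ := L.le_opNorm x
    _ ≤ 2 * s * ‖x‖ := mul_le_mul_of_nonneg_right (by linarith) (norm_nonneg _)

/-- The slots are freed from the net one at a time, each at the price of a factor `2`. -/
lemma multilinear_le_of_net {E : Type*} [NormedAddCommGroup E] [NormedSpace ℝ E]
    [FiniteDimensional ℝ E] {N : Finset E}
    (hN : ∀ x : E, ‖x‖ ≤ 1 → ∃ c ∈ N, ‖x - c‖ ≤ 1 / 2) {k : ℕ}
    (f : MultilinearMap ℝ (fun _ : Fin k => E) ℝ) {s : ℝ}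
    (hs : ∀ c : Fin k → E, (∀ i, c i ∈ N) → |f c| ≤ s) (x : Fin k → E) :
    |f x| ≤ 2 ^ k * s * ∏ i, ‖x i‖ := by
  classical
  have key : ∀ A : Finset (Fin k), ∀ x : Fin k → E, (∀ i ∉ A, x i ∈ N) →
      |f x| ≤ 2 ^ A.card * s * ∏ i ∈ A, ‖x i‖ := by
    intro A
    induction A using Finset.induction_on with
    | empty => intro x hx; simpa using hs x fun i => hx i (by simp)
    | insert a A ha ih =>
      intro x hx
      have h := linear_le_of_net hN (f.toLinearMap x a)
        (s := 2 ^ A.card * s * ∏ i ∈ A, ‖x i‖) ?_ (x a)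
      · simp only [MultilinearMap.toLinearMap_apply, Function.update_eq_self] at h
        rw [Finset.card_insert_of_notMem ha, Finset.prod_insert ha, pow_succ]
        calc |f x| ≤ _ := h
          _ = _ := by ring
      · intro c hc
        have := ih (Function.update x a c) fun i hi => by
          by_cases hia : i = a
          · subst hia; simpa using hc
          · rw [Function.update_of_ne hia]
            exact hx i (by simp [hia, hi])
        refine this.trans (le_of_eq ?_)
        congr 1
        refine Finset.prod_congr rfl fun i hi => ?_
        rw [Function.update_of_ne (ne_of_mem_of_not_mem hi ha)]
  simpa using key Finset.univ x (by simp)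

/-- The multilinear form of a tensor. -/
def form {n k : ℕ} (τ : Tensor n k) : MultilinearMap ℝ (fun _ : Fin k => Vec n) ℝ :=
  ∑ I, τ I • (MultilinearMap.mkPiAlgebra ℝ (Fin k) ℝ).compLinearMap
    fun s => (EuclideanSpace.proj (I s) : Vec n →L[ℝ] ℝ).toLinearMap

lemma form_apply {n k : ℕ} (τ : Tensor n k) (x : Fin k → Vec n) :
    form τ x = tinner τ fun I => ∏ s, x s (I s) := by
  simp [form, tinner]

lemma form_cons {n m : ℕ} (Z : Tensor n (m + 1)) (y x : Vec n) :
    form Z (Fin.cons y fun _ => x) = ⟪y, act Z (tpow x m)⟫ := by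
  rw [form_apply, tinner, sum_tensor_index]
  simp only [PiLp.inner_apply, act_apply, RCLike.inner_apply, conj_trivial]
  refine Finset.sum_congr rfl fun i _ => ?_
  rw [Finset.sum_mul]
  refine Finset.sum_congr rfl fun J _ => ?_
  simp [tpow, Fin.prod_univ_succ]; ring

/-- The bound `K` for the injective norm of a tensor. -/
def InjBound {n k : ℕ} (Z : Tensor n k) (K : ℝ) : Prop :=
  ∀ x : Fin k → Vec n, |form Z x| ≤ K * ∏ i, ‖x i‖

lemma norm_le_of_forall_inner {E : Type*} [NormedAddCommGroup E] [InnerProductSpace ℝ E] {w : E}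
    {c : ℝ} (hc : 0 ≤ c) (h : ∀ y : E, ‖y‖ = 1 → |(⟪y, w⟫ : ℝ)| ≤ c) : ‖w‖ ≤ c := by
  by_cases hw : w = 0
  · simpa [hw] using hc
  · have hw' : ‖w‖ ≠ 0 := norm_ne_zero_iff.2 hw
    have := h ((‖w‖)⁻¹ • w) (by rw [norm_smul]; simp [hw'])
    rw [real_inner_smul_left, real_inner_self_eq_norm_sq] at this
    have e : (‖w‖)⁻¹ * ‖w‖ ^ 2 = ‖w‖ := by field_simp
    rw [e] at this
    exact (le_abs_self _).trans this

lemma InjBound.norm_act_le {n m : ℕ} {Z : Tensor n (m + 1)} {K : ℝ} (hK : 0 ≤ K)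
    (h : InjBound Z K) (x : Vec n) : ‖act Z (tpow x m)‖ ≤ K * ‖x‖ ^ m := by
  refine norm_le_of_forall_inner (by positivity) fun y hy => ?_
  rw [← form_cons]
  simpa [Fin.prod_univ_succ, hy] using h (Fin.cons y fun _ => x)

/-- The multilinear increment bound is applied to arguments that share the unit vector `y` in the
first slot; that slot is the reason for `1 ≤ R`. -/
lemma InjBound.norm_act_sub_le {n m : ℕ} {Z : Tensor n (m + 1)} {K R : ℝ} (hK : 0 ≤ K)
    (h : InjBound Z K) (hR : 1 ≤ R) {x x' : Vec n} (hx : ‖x‖ ≤ R) (hx' : ‖x'‖ ≤ R) :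
    ‖act Z (tpow x m) - act Z (tpow x' m)‖ ≤ K * (m + 1) * R ^ m * ‖x - x'‖ := by
  refine norm_le_of_forall_inner (by positivity) fun y hy => ?_
  rw [inner_sub_right, ← form_cons, ← form_cons]
  have hb := (form Z).norm_image_sub_le_of_bound hK h (Fin.cons y fun _ => x)
    (Fin.cons y fun _ => x')
  have h1 : ‖(Fin.cons y fun _ => x : Fin (m + 1) → Vec n) - Fin.cons y fun _ => x'‖ ≤ ‖x - x'‖ := by
    rw [pi_norm_le_iff_of_nonneg (norm_nonneg _)]
    intro i
    refine Fin.cases ?_ (fun j => ?_) i <;> simp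
  have h2 : ∀ z : Vec n, ‖z‖ ≤ R → ‖(Fin.cons y fun _ => z : Fin (m + 1) → Vec n)‖ ≤ R := by
    intro z hz
    rw [pi_norm_le_iff_of_nonneg (by linarith)]
    intro i
    refine Fin.cases ?_ (fun j => ?_) i
    · simpa [hy] using hR
    · simpa using hz
  refine hb.trans ?_
  have h3 : max ‖(Fin.cons y fun _ => x : Fin (m + 1) → Vec n)‖
      ‖(Fin.cons y fun _ => x' : Fin (m + 1) → Vec n)‖ ≤ R := max_le (h2 x hx) (h2 x' hx')
  simp only [Fintype.card_fin, Nat.add_sub_cancel, Nat.cast_add, Nat.cast_one]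
  gcongr

/-! ### Exponential tails -/

lemma noise_exp {n k : ℕ} (τ : Tensor n k) :
    Integrable (fun Z => Real.exp (tinner Z τ)) (noise n k) ∧
      ∫ Z, Real.exp (tinner Z τ) ∂noise n k = Real.exp (tinner τ τ / (2 * n)) := by
  have e : (fun Z : Tensor n k => Real.exp (tinner Z τ)) = fun Z => ∏ I, Real.exp (τ I * Z I) := by
    funext Z
    rw [tinner, Real.exp_sum]
    simp [mul_comm]
  have hint : ∀ I, Integrable (fun z : ℝ => Real.exp (τ I * z)) (gaussianReal 0 ((n : ℝ≥0)⁻¹)) :=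
    fun I => integrable_exp_mul_gaussianReal (τ I)
  refine ⟨?_, ?_⟩
  · rw [e]
    exact Integrable.fintype_prod hint
  · rw [e, noise, integral_fintype_prod_eq_prod (fun I z => Real.exp (τ I * z))]
    have : ∀ I, ∫ z, Real.exp (τ I * z) ∂gaussianReal 0 ((n : ℝ≥0)⁻¹) =
        Real.exp (τ I ^ 2 / (2 * n)) := by
      intro I
      have := congrFun (mgf_id_gaussianReal (μ := 0) (v := (n : ℝ≥0)⁻¹)) (τ I)
      simp only [mgf, id] at this
      rw [this]
      congr 1
      push_cast
      by_cases hn : (n : ℝ) = 0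
      · simp [hn]
      · field_simp; ring
    simp_rw [this]
    rw [← Real.exp_sum, tinner, Finset.sum_div]
    congr 1
    exact Finset.sum_congr rfl fun I _ => by ring

lemma noise_tinner_tail {n k : ℕ} {τ : Tensor n k} (hτ : tinner τ τ ≤ 1) {s : ℝ} (hs : 0 ≤ s) :
    noise n k {Z | s < |tinner Z τ|} ≤ ENNReal.ofReal (2 * Real.exp (-(n * s ^ 2 / 2))) := by
  rcases Nat.eq_zero_or_pos n with rfl | hn
  · refine prob_le_one.trans ?_
    simp
  have hn' : (0 : ℝ) < n := by exact_mod_cast hn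
  have one_side : ∀ τ : Tensor n k, tinner τ τ ≤ 1 →
      noise n k {Z | s ≤ tinner Z τ} ≤ ENNReal.ofReal (Real.exp (-(n * s ^ 2 / 2))) := by
    intro τ hτ
    have h := noise_exp ((n * s) • τ)
    have e : ∀ Z : Tensor n k, tinner Z ((n * s) • τ) = (n * s) * tinner Z τ := fun Z =>
      tinner_smul_right _ _ _
    simp only [e, tinner_smul_left] at h
    -- Chernoff's bound; `t = n s` maximizes the exponent `t s - t² / (2n)`.
    have hm := measure_ge_le_exp_mul_mgf (μ := noise n k) (X := fun Z => tinner Z τ) s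
      (t := n * s) (by positivity) h.1
    rw [mgf, h.2, ← Real.exp_add] at hm
    rw [← ofReal_measureReal]
    refine ENNReal.ofReal_le_ofReal (hm.trans (Real.exp_le_exp.2 ?_))
    have : n * s * (n * s * tinner τ τ) / (2 * n) = n * s ^ 2 / 2 * tinner τ τ := by
      field_simp
    rw [this]
    have : 0 ≤ n * s ^ 2 / 2 := by positivity
    nlinarith
  have hneg : tinner (-τ) (-τ) ≤ 1 := by simpa [tinner] using hτ
  have hsub : {Z : Tensor n k | s < |tinner Z τ|} ⊆ {Z | s ≤ tinner Z τ} ∪ {Z | s ≤ tinner Z (-τ)} := by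
    intro Z hZ
    have e : tinner Z (-τ) = -tinner Z τ := by simp [tinner]
    simp only [Set.mem_union, Set.mem_ofPred_eq, e] at hZ ⊢
    rcases lt_abs.1 hZ with h | h
    exacts [Or.inl h.le, Or.inr h.le]
  refine (measure_mono hsub).trans ((measure_union_le _ _).trans ?_)
  rw [two_mul, ENNReal.ofReal_add (by positivity) (by positivity)]
  exact add_le_add (one_side τ hτ) (one_side (-τ) hneg)

/-- A union bound over the `k`-tuples of a net of at most `5 ^ n` points, each value of the
multilinear form being Gaussian with variance at most `1 / n`. -/
theorem noise_injBound (k : ℕ) : ∃ K : ℝ, 1 ≤ K ∧ ∀ n,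
    noise n k {Z | ¬ InjBound Z K} ≤ ENNReal.ofReal (2 * Real.exp (-n)) := by
  -- Chosen so that `n s² / 2 = n k log 5 + n`: the first term cancels the number `5 ^ (n k)` of
  -- tuples, the second leaves `exp (-n)`.
  set s : ℝ := √(2 * (k * Real.log 5 + 1)) with hs
  have hlog : 0 ≤ Real.log 5 := Real.log_nonneg (by norm_num)
  have hs2 : s ^ 2 = 2 * (k * Real.log 5 + 1) := Real.sq_sqrt (by positivity)
  have hs1 : 1 ≤ s := by
    rw [hs]; apply Real.one_le_sqrt.2; nlinarith [mul_nonneg (Nat.cast_nonneg (α := ℝ) k) hlog]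
  refine ⟨2 ^ k * s, ?_, fun n => ?_⟩
  · have : (1 : ℝ) ≤ 2 ^ k := one_le_pow₀ (by norm_num)
    nlinarith
  obtain ⟨N, hcard, hN1, hN⟩ := exists_net (Vec n)
  rw [finrank_euclideanSpace_fin] at hcard
  have hsub : {Z : Tensor n k | ¬ InjBound Z (2 ^ k * s)} ⊆
      ⋃ c ∈ Fintype.piFinset fun _ : Fin k => N,
        {Z | s < |tinner Z fun I => ∏ j, c j (I j)|} := by
    intro Z hZ
    by_contra hcon
    simp only [Set.mem_iUnion, Set.mem_ofPred_eq, not_exists, not_lt] at hcon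
    refine hZ fun x => ?_
    refine multilinear_le_of_net hN (form Z) (fun c hc => ?_) x
    rw [form_apply]
    exact hcon c (Fintype.mem_piFinset.2 hc)
  refine (measure_mono hsub).trans ((measure_biUnion_finset_le _ _).trans ?_)
  have hterm : ∀ c ∈ Fintype.piFinset fun _ : Fin k => N,
      noise n k {Z | s < |tinner Z fun I => ∏ j, c j (I j)|} ≤
        ENNReal.ofReal (2 * Real.exp (-(n * s ^ 2 / 2))) := by
    intro c hc
    refine noise_tinner_tail ?_ (by linarith)
    have : tinner (fun I : Fin k → Fin n => ∏ j, c j (I j)) (fun I => ∏ j, c j (I j)) =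
        ∏ j, ‖c j‖ ^ 2 := by
      simp only [tinner, ← Finset.prod_mul_distrib, EuclideanSpace.norm_sq_eq, Real.norm_eq_abs,
        sq_abs]
      rw [Finset.prod_univ_sum]
      simp [sq]
    rw [this]
    refine Finset.prod_le_one (fun _ _ => by positivity) fun j _ => ?_
    exact pow_le_one₀ (norm_nonneg _) (hN1 _ (Fintype.mem_piFinset.1 hc j))
  refine (Finset.sum_le_sum hterm).trans ?_
  rw [Finset.sum_const, Fintype.card_piFinset_const, nsmul_eq_mul]
  have h5 : ((N.card ^ k : ℕ) : ENNReal) ≤ ENNReal.ofReal (Real.exp (n * (k * Real.log 5))) := by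
    rw [← ENNReal.ofReal_natCast]
    refine ENNReal.ofReal_le_ofReal ?_
    have : Real.exp (n * (k * Real.log 5)) = ((5 ^ n) ^ k : ℝ) := by
      rw [show (n : ℝ) * (k * Real.log 5) = ((n * k : ℕ) : ℝ) * Real.log 5 by push_cast; ring,
        Real.exp_nat_mul, Real.exp_log (by norm_num), pow_mul]
    rw [this]
    push_cast
    gcongr
    exact_mod_cast hcard
  refine (mul_le_mul_left h5 _).trans ?_
  rw [← ENNReal.ofReal_mul (by positivity)]
  refine ENNReal.ofReal_le_ofReal (le_of_eq ?_)
  rw [mul_left_comm, ← Real.exp_add, hs2]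
  congr 2; ring

/-! ### A scalar recursion -/

/-- The partial geometric sum `1 + m + ⋯ + m ^ (t - 1)`. -/
def geomExp (m t : ℕ) : ℕ := ∑ i ∈ Finset.range t, m ^ i

lemma geomExp_succ (m t : ℕ) : geomExp m (t + 1) = geomExp m t + m ^ t := Finset.sum_range_succ _ _

lemma le_geomExp {m : ℕ} (hm : 1 ≤ m) (t : ℕ) : t ≤ geomExp m t := by
  induction t with
  | zero => simp
  | succ t ih => rw [geomExp_succ]; have := Nat.one_le_pow t m hm; omega

/-- The ideal doubly exponential decay of a competing overlap ratio `h` at time `t`. -/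
def FastDecay (m : ℕ) (B κ σ θ : ℝ) (t : ℕ) (h : ℝ) : Prop :=
  h ≤ κ * θ ^ geomExp m t ∧ σ * B * h ^ (m - 1) ≤ θ ^ m ^ t

/-- With `y = σ B h^(m-1)` the hypothesis gives `h' ≤ y h` and `y' ≤ y^m`. The second relation
produces the exponent `m ^ t`, and the first adds it to the geometric sum. -/
lemma FastDecay.step {m t : ℕ} (hm : 1 ≤ m) {B κ σ θ h h' : ℝ} (hB : 0 ≤ B) (hσ : 0 ≤ σ)
    (hh : 0 ≤ h) (hh' : 0 ≤ h') (hθ : 0 ≤ θ) (hle : h' ≤ σ * (B * h ^ m))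
    (hd : FastDecay m B κ σ θ t h) : FastDecay m B κ σ θ (t + 1) h' := by
  obtain ⟨k, rfl⟩ : ∃ k, m = k + 1 := ⟨m - 1, by omega⟩
  obtain ⟨h1, h2⟩ := hd
  simp only [Nat.add_sub_cancel] at h2
  have h0 : 0 ≤ σ * B * h ^ k := by positivity
  refine ⟨?_, ?_⟩
  · calc h' ≤ (σ * B * h ^ k) * h := hle.trans (le_of_eq (by ring))
      _ ≤ θ ^ (k + 1) ^ t * (κ * θ ^ geomExp (k + 1) t) := mul_le_mul h2 h1 hh (by positivity)
      _ = _ := by rw [geomExp_succ, pow_add]; ring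
  · simp only [Nat.add_sub_cancel]
    calc σ * B * h' ^ k ≤ σ * B * (σ * (B * h ^ (k + 1))) ^ k := by gcongr
      _ = (σ * B * h ^ k) ^ (k + 1) := by
        rw [mul_pow, mul_pow, mul_pow, mul_pow, ← pow_mul, ← pow_mul, pow_succ σ, pow_succ B,
          mul_comm k (k + 1)]
        ring
      _ ≤ (θ ^ (k + 1) ^ t) ^ (k + 1) := by gcongr
      _ = _ := by rw [← pow_mul, ← pow_succ]

/-- Here `s²` is the relative size of the noise. While `B h^m ≥ s` the noise is at most the fraction
`s` of the main term, and its effect is the factor `1 / (1 - s) ≤ σ`. As soon as `B h^m < s` the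
ratio falls below `4 s`, and `hsmall` keeps it there. -/
lemma decay_step {m t : ℕ} (hm : 1 ≤ m) {B κ σ θ s h h' : ℝ} (hB : 0 ≤ B) (hσ : 1 / (1 - s) ≤ σ)
    (hσ2 : σ ≤ 2) (hs0 : 0 ≤ s) (hs1 : s < 1) (hh : 0 ≤ h) (hh' : 0 ≤ h') (hθ : 0 ≤ θ)
    (hsmall : B * (4 * s) ^ m + s ^ 2 ≤ 4 * s * (1 - s ^ 2))
    (hle : h' ≤ (B * h ^ m + s ^ 2) / (1 - s ^ 2)) (hd : FastDecay m B κ σ θ t h ∨ h ≤ 4 * s) :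
    FastDecay m B κ σ θ (t + 1) h' ∨ h' ≤ 4 * s := by
  have hs2 : 0 < 1 - s ^ 2 := by nlinarith
  have hs3 : 0 < 1 - s := by linarith
  rcases hd with hd | hd
  · by_cases hc : s ≤ B * h ^ m
    · left
      refine hd.step hm hB (le_trans (by positivity) hσ) hh hh' hθ (hle.trans ?_)
      have h0 : 0 ≤ B * h ^ m := by positivity
      calc (B * h ^ m + s ^ 2) / (1 - s ^ 2) ≤ (B * h ^ m + s * (B * h ^ m)) / (1 - s ^ 2) := by
            gcongr; nlinarith
        _ = 1 / (1 - s) * (B * h ^ m) := by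
            rw [show 1 - s ^ 2 = (1 - s) * (1 + s) by ring]; field_simp
        _ ≤ _ := by gcongr
    · right
      push Not at hc
      calc h' ≤ (s + s ^ 2) / (1 - s ^ 2) := hle.trans (by gcongr)
        _ = 1 / (1 - s) * s := by
            rw [show 1 - s ^ 2 = (1 - s) * (1 + s) by ring]; field_simp
        _ ≤ σ * s := by gcongr
        _ ≤ 4 * s := by nlinarith
  · right
    refine hle.trans ?_
    rw [div_le_iff₀ hs2]
    refine le_trans ?_ hsmall
    gcongr

lemma abs_pow_sub_pow_le_of_abs_le {a b R : ℝ} (ha : |a| ≤ R) (hb : |b| ≤ R) (m : ℕ) :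
    |a ^ m - b ^ m| ≤ m * R ^ (m - 1) * |a - b| := by
  have h0 : 0 ≤ max |a| |b| := (abs_nonneg a).trans (le_max_left _ _)
  calc |a ^ m - b ^ m| ≤ m * max |a| |b| ^ (m - 1) * |a - b| :=
        (abs_pow_sub_pow_le a b m).trans (le_of_eq (by ring))
    _ ≤ _ := by gcongr; exact max_le ha hb

lemma sign_mul_abs (x : ℝ) : Real.sign x * |x| = x := by
  rcases lt_trichotomy x 0 with h | h | h
  · rw [Real.sign_of_neg h, abs_of_neg h]; ring
  · simp [h]
  · rw [Real.sign_of_pos h, abs_of_pos h]; ring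

/-! ### The projective chart around a unit vector -/

section Chart

variable {E : Type*} [NormedAddCommGroup E] [InnerProductSpace ℝ E]

/-- The affine chart of the projective space around the unit vector `e`. -/
def chart (e x : E) : E := (⟪e, x⟫ : ℝ)⁻¹ • x - e

lemma inner_chart_self {e x : E} (he : ‖e‖ = 1) (hx : (⟪e, x⟫ : ℝ) ≠ 0) :
    (⟪e, chart e x⟫ : ℝ) = 0 := by
  rw [chart, inner_sub_right, real_inner_smul_right, real_inner_self_eq_norm_sq, he,
    inv_mul_cancel₀ hx]; norm_num

lemma inner_chart {e x y : E} (hy : (⟪y, e⟫ : ℝ) = 0) :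
    (⟪y, chart e x⟫ : ℝ) = ⟪y, x⟫ / ⟪e, x⟫ := by
  rw [chart, inner_sub_right, real_inner_smul_right, hy, sub_zero]; ring

lemma chart_smul {e x : E} {c : ℝ} (hc : c ≠ 0) : chart e (c • x) = chart e x := by
  rw [chart, chart, real_inner_smul_right, smul_smul, mul_inv, mul_right_comm, inv_mul_cancel₀ hc,
    one_mul]

lemma smul_add_chart {e x : E} (hx : (⟪e, x⟫ : ℝ) ≠ 0) :
    (⟪e, x⟫ : ℝ) • (e + chart e x) = x := by
  rw [chart, add_sub_cancel, smul_smul, mul_inv_cancel₀ hx, one_smul]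

lemma norm_sq_add_of_inner_eq_zero {e h : E} (he : ‖e‖ = 1) (hh : (⟪e, h⟫ : ℝ) = 0) :
    ‖e + h‖ ^ 2 = 1 + ‖h‖ ^ 2 := by
  rw [norm_add_sq_real, hh, he]; ring

/-- The left side is the distance of `x` to the line through `e`, and the orthogonal projection is
the nearest point of that line. -/
lemma norm_chart_mul_le {e x : E} (he : ‖e‖ = 1) (hx : (⟪e, x⟫ : ℝ) ≠ 0) (c : ℝ) :
    ‖chart e x‖ * |(⟪e, x⟫ : ℝ)| ≤ ‖x - c • e‖ := by
  have h1 : (⟪e, x⟫ : ℝ) • chart e x = x - (⟪e, x⟫ : ℝ) • e := by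
    rw [chart, smul_sub, smul_smul, mul_inv_cancel₀ hx, one_smul]
  have h2 : ‖chart e x‖ * |(⟪e, x⟫ : ℝ)| = ‖x - (⟪e, x⟫ : ℝ) • e‖ := by
    rw [← h1, norm_smul, Real.norm_eq_abs, mul_comm]
  rw [h2]
  refine le_of_sq_le_sq ?_ (norm_nonneg _)
  rw [norm_sub_sq_real, norm_sub_sq_real, norm_smul, norm_smul, he, real_inner_smul_right,
    real_inner_smul_right, real_inner_comm e x]
  simp only [Real.norm_eq_abs, mul_one, sq_abs]
  nlinarith [sq_nonneg ((⟪e, x⟫ : ℝ) - c)]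

/-- The unit vector with chart coordinate `h`. -/
def lift (e h : E) : E := ‖e + h‖⁻¹ • (e + h)

/-- The chart determines a unit vector up to sign. Hence the dynamics in the chart and the sign of
the overlap can be studied separately. -/
lemma eq_sign_smul_lift {e u : E} (hu : ‖u‖ = 1) (hx : (⟪e, u⟫ : ℝ) ≠ 0) :
    u = Real.sign (⟪e, u⟫ : ℝ) • lift e (chart e u) := by
  have h1 := smul_add_chart hx
  have h2 : |(⟪e, u⟫ : ℝ)| * ‖e + chart e u‖ = 1 := by
    rw [← Real.norm_eq_abs, ← norm_smul, h1, hu]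
  rw [lift, inv_eq_of_mul_eq_one_left h2, smul_smul, sign_mul_abs, h1]

lemma norm_add_pos {e h : E} (he : ‖e‖ = 1) (hh : (⟪e, h⟫ : ℝ) = 0) : 0 < ‖e + h‖ := by
  rw [norm_pos_iff]
  intro h0
  have := norm_sq_add_of_inner_eq_zero he hh
  rw [h0, norm_zero] at this
  nlinarith [sq_nonneg ‖h‖]

lemma norm_lift {e h : E} (he : ‖e‖ = 1) (hh : (⟪e, h⟫ : ℝ) = 0) : ‖lift e h‖ = 1 := by
  have := norm_add_pos he hh
  rw [lift, norm_smul, norm_inv, norm_norm, inv_mul_cancel₀ this.ne']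

lemma one_le_norm_add {e h : E} (he : ‖e‖ = 1) (hh : (⟪e, h⟫ : ℝ) = 0) : 1 ≤ ‖e + h‖ := by
  have := norm_sq_add_of_inner_eq_zero he hh
  nlinarith [sq_nonneg ‖h‖, norm_nonneg (e + h)]

lemma norm_add_le_one_add_sq {e h : E} (he : ‖e‖ = 1) (hh : (⟪e, h⟫ : ℝ) = 0) :
    ‖e + h‖ ≤ 1 + ‖h‖ ^ 2 := by
  have := norm_sq_add_of_inner_eq_zero he hh
  nlinarith [sq_nonneg ‖h‖, one_le_norm_add he hh]

lemma inner_lift_self {e h : E} (he : ‖e‖ = 1) (hh : (⟪e, h⟫ : ℝ) = 0) :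
    (⟪e, lift e h⟫ : ℝ) = ‖e + h‖⁻¹ := by
  rw [lift, real_inner_smul_right, inner_add_right, hh, real_inner_self_eq_norm_sq, he]; ring

lemma norm_lift_sub_le {e h : E} (he : ‖e‖ = 1) (hh : (⟪e, h⟫ : ℝ) = 0) :
    ‖lift e h - e‖ ≤ 2 * ‖h‖ := by
  have h1 := one_le_norm_add he hh
  have h2 : ‖e + h‖ ≤ 1 + ‖h‖ := (norm_add_le _ _).trans (by rw [he])
  have h3 : lift e h - e = (lift e h - (e + h)) + h := by abel
  have h4 : ‖lift e h - (e + h)‖ ≤ ‖h‖ := by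
    have : lift e h - (e + h) = (‖e + h‖⁻¹ - 1) • (e + h) := by rw [sub_smul, one_smul, lift]
    rw [this, norm_smul, Real.norm_eq_abs, abs_sub_comm, abs_of_nonneg (sub_nonneg.2
      (inv_le_one_of_one_le₀ h1)), sub_mul, inv_mul_cancel₀ (by linarith)]
    linarith
  rw [h3]
  exact (norm_add_le _ _).trans (by linarith)

lemma continuousAt_lift {e h : E} (he : ‖e‖ = 1) (hh : (⟪e, h⟫ : ℝ) = 0) :
    ContinuousAt (lift e) h := by
  have := norm_add_pos he hh
  unfold lift
  exact ((by fun_prop : ContinuousAt (fun x : E => ‖e + x‖) h).inv₀ this.ne').smul (by fun_prop)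

end Chart

/-! ### One step of the power iteration -/

lemma norm_add_le_two {E : Type*} [NormedAddCommGroup E] {e h : E} (he : ‖e‖ = 1)
    (hh : ‖h‖ ≤ 1) : ‖e + h‖ ≤ 2 :=
  (norm_add_le _ _).trans (by linarith)

section Step

variable {E : Type*} [NormedAddCommGroup E] [InnerProductSpace ℝ E] {r : ℕ}

/-- The unnormalized power iteration map with signals `(βⱼ, vⱼ)` and noise map `A`. -/
def drift (β : Fin r → ℝ) (v : Fin r → E) (m : ℕ) (A : E → E) (x : E) : E :=
  ∑ j, (β j * (⟪v j, x⟫ : ℝ) ^ m) • v j + A x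

/-- The contribution of the signals other than `p` in the chart around `v p`. -/
def rival (β : Fin r → ℝ) (v : Fin r → E) (p : Fin r) (m : ℕ) (h : E) : E :=
  ∑ j ∈ Finset.univ.erase p, (β j / β p * (⟪v j, h⟫ : ℝ) ^ m) • v j

/-- The sum of the norms of the contributions of the signals other than `p`. -/
def rivalSum (β : Fin r → ℝ) (v : Fin r → E) (p : Fin r) (m : ℕ) (h : E) : ℝ :=
  ∑ j ∈ Finset.univ.erase p, |β j / β p| * |(⟪v j, h⟫ : ℝ)| ^ m

/-- The power iteration in the chart around `v p`. -/
def chartMap (β : Fin r → ℝ) (v : Fin r → E) (p : Fin r) (m : ℕ) (A : E → E) (h : E) : E :=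
  chart (v p) (drift β v m A (v p + h))

variable {β : Fin r → ℝ} {v : Fin r → E} {m : ℕ} {A : E → E} {p : Fin r}

lemma inner_signal (hv : Orthonormal ℝ v) (c : Fin r → ℝ) (i : Fin r) :
    (⟪v i, ∑ j, c j • v j⟫ : ℝ) = c i := hv.inner_right_fintype c i

lemma inner_drift (hv : Orthonormal ℝ v) (i : Fin r) (x : E) :
    (⟪v i, drift β v m A x⟫ : ℝ) = β i * (⟪v i, x⟫ : ℝ) ^ m + ⟪v i, A x⟫ := by
  rw [drift, inner_add_right, inner_signal hv]

lemma inner_basis_of_ne (hv : Orthonormal ℝ v) {i j : Fin r} (h : i ≠ j) : (⟪v i, v j⟫ : ℝ) = 0 :=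
  hv.2 h

lemma rivalSum_nonneg (h : E) : 0 ≤ rivalSum β v p m h :=
  Finset.sum_nonneg fun _ _ => by positivity

/-- Noise that is a fraction `ν < 1` of the signal can neither cancel the component along `v p` nor
flip its sign. -/
lemma drift_pos (hv : Orthonormal ℝ v) {u : E} {ν : ℝ}
    (ha : β p * (⟪v p, u⟫ : ℝ) ^ m ≠ 0) (hν1 : ν < 1)
    (hν : |(⟪v p, A u⟫ : ℝ)| ≤ ν * |β p * (⟪v p, u⟫ : ℝ) ^ m|) :
    (1 - ν) * |β p * (⟪v p, u⟫ : ℝ) ^ m| ≤ |(⟪v p, drift β v m A u⟫ : ℝ)| ∧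
      0 < (⟪v p, drift β v m A u⟫ : ℝ) * (β p * (⟪v p, u⟫ : ℝ) ^ m) := by
  rw [inner_drift hv]
  set a := β p * (⟪v p, u⟫ : ℝ) ^ m
  set z : ℝ := ⟪v p, A u⟫
  have h1 : |a| - |z| ≤ |a + z| := by
    have := abs_sub_abs_le_abs_sub a (-z)
    rwa [abs_neg, sub_neg_eq_add] at this
  have h2 : 0 < |a| := abs_pos.2 ha
  refine ⟨by linarith, ?_⟩
  have h3 : -(|z| * |a|) ≤ z * a := by rw [← abs_mul]; exact neg_abs_le _
  have h4 : a * a = |a| * |a| := (abs_mul_abs_self a).symm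
  have h5 : |z| < |a| := by nlinarith
  nlinarith [mul_pos h2 (sub_pos.2 h5)]

/-- The recursion of the overlap ratios: numerator and denominator each receive noise of relative
size at most `ν`. -/
lemma abs_inner_chart_drift_le (hv : Orthonormal ℝ v) {u : E} {ν : ℝ}
    (hβ : β p ≠ 0) (hx : (⟪v p, u⟫ : ℝ) ≠ 0) (hν1 : ν < 1)
    (hν : ∀ j, |(⟪v j, A u⟫ : ℝ)| ≤ ν * |β p * (⟪v p, u⟫ : ℝ) ^ m|) {j : Fin r} (hj : j ≠ p) :
    |(⟪v j, chart (v p) (drift β v m A u)⟫ : ℝ)| ≤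
      (|β j / β p| * |(⟪v j, chart (v p) u⟫ : ℝ)| ^ m + ν) / (1 - ν) := by
  have ha : β p * (⟪v p, u⟫ : ℝ) ^ m ≠ 0 := mul_ne_zero hβ (pow_ne_zero _ hx)
  obtain ⟨h1, -⟩ := drift_pos (A := A) hv ha hν1 (hν p)
  rw [inner_chart (inner_basis_of_ne hv hj), inner_chart (inner_basis_of_ne hv hj), abs_div]
  set y := drift β v m A u
  have hpos : 0 < |β p * (⟪v p, u⟫ : ℝ) ^ m| := abs_pos.2 ha
  have h1ν : 0 < 1 - ν := by linarith
  rw [div_le_div_iff₀ (lt_of_lt_of_le (by positivity) h1) h1ν]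
  have h2 : |(⟪v j, y⟫ : ℝ)| ≤ (|β j / β p| * |(⟪v j, u⟫ / ⟪v p, u⟫ : ℝ)| ^ m + ν) *
      |β p * (⟪v p, u⟫ : ℝ) ^ m| := by
    have e : (|β j / β p| * |(⟪v j, u⟫ / ⟪v p, u⟫ : ℝ)| ^ m) * |β p * (⟪v p, u⟫ : ℝ) ^ m| =
        |β j * (⟪v j, u⟫ : ℝ) ^ m| := by
      rw [← abs_pow, ← abs_mul, ← abs_mul]
      congr 1; rw [div_pow]; field_simp
    rw [add_mul, e, inner_drift hv]
    exact (abs_add_le _ _).trans (by linarith [hν j])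
  have h0 : 0 ≤ |β j / β p| * |(⟪v j, u⟫ / ⟪v p, u⟫ : ℝ)| ^ m + ν := by
    have := (abs_nonneg _).trans (hν p)
    have : 0 ≤ ν := nonneg_of_mul_nonneg_left this hpos
    positivity
  calc _ ≤ (|β j / β p| * |(⟪v j, u⟫ / ⟪v p, u⟫ : ℝ)| ^ m + ν) *
      |β p * (⟪v p, u⟫ : ℝ) ^ m| * (1 - ν) := by gcongr
    _ = (|β j / β p| * |(⟪v j, u⟫ / ⟪v p, u⟫ : ℝ)| ^ m + ν) *
      ((1 - ν) * |β p * (⟪v p, u⟫ : ℝ) ^ m|) := by ring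
    _ ≤ _ := by gcongr

lemma norm_drift_sub_le (hv : Orthonormal ℝ v) {u : E} (hβ : β p ≠ 0)
    (hx : (⟪v p, u⟫ : ℝ) ≠ 0) :
    ‖drift β v m A u - (β p * (⟪v p, u⟫ : ℝ) ^ m) • v p‖ ≤
      |β p * (⟪v p, u⟫ : ℝ) ^ m| * rivalSum β v p m (chart (v p) u) + ‖A u‖ := by
  have e : drift β v m A u - (β p * (⟪v p, u⟫ : ℝ) ^ m) • v p =
      ∑ j ∈ Finset.univ.erase p, (β j * (⟪v j, u⟫ : ℝ) ^ m) • v j + A u := by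
    rw [drift, ← Finset.add_sum_erase _ _ (Finset.mem_univ p)]; abel
  rw [e]
  refine (norm_add_le _ _).trans (add_le_add_left ((norm_sum_le _ _).trans (le_of_eq ?_)) _)
  rw [rivalSum, Finset.mul_sum]
  refine Finset.sum_congr rfl fun j hj => ?_
  rw [inner_chart (inner_basis_of_ne hv (Finset.ne_of_mem_erase hj)), norm_smul, hv.1 j, mul_one,
    Real.norm_eq_abs, ← abs_pow, ← abs_mul, ← abs_mul]
  congr 1; rw [div_pow]; field_simp

lemma norm_chart_drift_le (hv : Orthonormal ℝ v) {u : E} {ν : ℝ}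
    (hβ : β p ≠ 0) (hx : (⟪v p, u⟫ : ℝ) ≠ 0) (hν1 : ν < 1)
    (hν : |(⟪v p, A u⟫ : ℝ)| ≤ ν * |β p * (⟪v p, u⟫ : ℝ) ^ m|) :
    ‖chart (v p) (drift β v m A u)‖ ≤ (rivalSum β v p m (chart (v p) u) +
      ‖A u‖ / |β p * (⟪v p, u⟫ : ℝ) ^ m|) / (1 - ν) := by
  have ha : β p * (⟪v p, u⟫ : ℝ) ^ m ≠ 0 := mul_ne_zero hβ (pow_ne_zero _ hx)
  obtain ⟨h1, h2⟩ := drift_pos (A := A) hv ha hν1 hν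
  have hpos : 0 < |β p * (⟪v p, u⟫ : ℝ) ^ m| := abs_pos.2 ha
  have h3 := norm_chart_mul_le (hv.1 p) (left_ne_zero_of_mul h2.ne')
    (β p * (⟪v p, u⟫ : ℝ) ^ m)
  have h4 := norm_drift_sub_le (A := A) (m := m) hv hβ hx
  rw [le_div_iff₀ (by linarith)]
  refine le_of_mul_le_mul_right ?_ hpos
  rw [add_mul, div_mul_cancel₀ _ hpos.ne']
  calc _ = ‖chart (v p) (drift β v m A u)‖ * ((1 - ν) * |β p * (⟪v p, u⟫ : ℝ) ^ m|) := by ring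
    _ ≤ _ := mul_le_mul_of_nonneg_left h1 (norm_nonneg _)
    _ ≤ _ := by linarith

lemma norm_drift_le (hv : Orthonormal ℝ v) {u : E} (hβ : β p ≠ 0) (hx : (⟪v p, u⟫ : ℝ) ≠ 0) :
    ‖drift β v m A u‖ ≤ |β p * (⟪v p, u⟫ : ℝ) ^ m| *
      (1 + rivalSum β v p m (chart (v p) u)) + ‖A u‖ := by
  have h1 := norm_drift_sub_le (A := A) (m := m) hv hβ hx
  have h2 := norm_add_le (drift β v m A u - (β p * (⟪v p, u⟫ : ℝ) ^ m) • v p)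
    ((β p * (⟪v p, u⟫ : ℝ) ^ m) • v p)
  rw [sub_add_cancel, norm_smul, hv.1 p, Real.norm_eq_abs, mul_one] at h2
  linarith

/-! ### The power iteration in the chart -/

lemma drift_smul (hA : ∀ (c : ℝ) (x : E), A (c • x) = c ^ m • A x) (c : ℝ) (x : E) :
    drift β v m A (c • x) = c ^ m • drift β v m A x := by
  simp only [drift, hA, smul_add, Finset.smul_sum, smul_smul, real_inner_smul_right, mul_pow]
  congr 1
  exact Finset.sum_congr rfl fun j _ => by ring_nf

/-- Homogeneity of the drift makes the iteration autonomous in the chart: the scale `⟪v p, u⟫` only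
contributes a factor that the chart forgets. -/
lemma chart_drift (hA : ∀ (c : ℝ) (x : E), A (c • x) = c ^ m • A x) {u : E}
    (hx : (⟪v p, u⟫ : ℝ) ≠ 0) :
    chart (v p) (drift β v m A u) = chartMap β v p m A (chart (v p) u) := by
  conv_lhs => rw [← smul_add_chart hx, drift_smul hA, chart_smul (pow_ne_zero _ hx)]
  rfl

lemma chartMap_eq (hv : Orthonormal ℝ v) (hβ : β p ≠ 0) {h : E} (hh : (⟪v p, h⟫ : ℝ) = 0)
    (hD : 1 + (⟪v p, A (v p + h)⟫ : ℝ) / β p ≠ 0) :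
    chartMap β v p m A h = (1 + (⟪v p, A (v p + h)⟫ : ℝ) / β p)⁻¹ •
      (rival β v p m h +
        (β p)⁻¹ • (A (v p + h) - (⟪v p, A (v p + h)⟫ : ℝ) • v p)) := by
  set y := A (v p + h) with hy
  have h1 : (⟪v p, v p + h⟫ : ℝ) = 1 := by
    rw [inner_add_right, hh, real_inner_self_eq_norm_sq, hv.1 p]; norm_num
  have h2 : (⟪v p, drift β v m A (v p + h)⟫ : ℝ) = β p * (1 + (⟪v p, y⟫ : ℝ) / β p) := by
    rw [inner_drift hv, h1]; field_simp; ring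
  have h3 : drift β v m A (v p + h) = β p • v p + β p • rival β v p m h + y := by
    rw [drift, ← Finset.add_sum_erase _ _ (Finset.mem_univ p), h1, rival, Finset.smul_sum]
    congr 2
    · ring_nf
    · refine Finset.sum_congr rfl fun j hj => ?_
      rw [inner_add_right, inner_basis_of_ne hv (Finset.ne_of_mem_erase hj), zero_add, smul_smul]
      congr 1; field_simp
  set D := 1 + (⟪v p, y⟫ : ℝ) / β p with hDdef
  have hyD : (⟪v p, y⟫ : ℝ) = β p * (D - 1) := by rw [hDdef]; field_simp; ring
  have h4 : (β p * D) • (chartMap β v p m A h) = (β p * D) • (D⁻¹ • (rival β v p m h +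
        (β p)⁻¹ • (y - (⟪v p, y⟫ : ℝ) • v p))) := by
    rw [chartMap, chart, h2, h3, smul_sub, smul_smul, mul_inv_cancel₀ (mul_ne_zero hβ hD),
      one_smul, smul_smul, mul_assoc, mul_inv_cancel₀ hD, mul_one, smul_add, smul_smul,
      mul_inv_cancel₀ hβ, one_smul, hyD]
    module
  exact smul_right_injective E (mul_ne_zero hβ hD) h4

lemma inner_rival (hv : Orthonormal ℝ v) (h : E) : (⟪v p, rival β v p m h⟫ : ℝ) = 0 := by
  rw [rival, inner_sum]
  refine Finset.sum_eq_zero fun j hj => ?_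
  rw [real_inner_smul_right, inner_basis_of_ne hv (Finset.ne_of_mem_erase hj).symm, mul_zero]

/-- Bessel's inequality avoids the factor `r` of the triangle inequality. For `m = 1` this matters,
since the contraction constant is then only `1 - 1/κ` before the noise is added. -/
lemma norm_sum_erase_le (hv : Orthonormal ℝ v) (c : Fin r → ℝ) {ℓ : ℝ} (hℓ : 0 ≤ ℓ) (h : E)
    (hc : ∀ j, j ≠ p → |c j| ≤ ℓ * |(⟪v j, h⟫ : ℝ)|) :
    ‖∑ j ∈ Finset.univ.erase p, c j • v j‖ ≤ ℓ * ‖h‖ := by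
  refine le_of_sq_le_sq ?_ (by positivity)
  rw [← real_inner_self_eq_norm_sq, hv.inner_sum]
  calc ∑ j ∈ Finset.univ.erase p, (starRingEnd ℝ) (c j) * c j
      ≤ ∑ j ∈ Finset.univ.erase p, ℓ ^ 2 * ‖(⟪v j, h⟫ : ℝ)‖ ^ 2 := by
        refine Finset.sum_le_sum fun j hj => ?_
        have := hc j (Finset.ne_of_mem_erase hj)
        rw [conj_trivial, ← abs_mul_abs_self, ← mul_pow, ← sq, Real.norm_eq_abs]
        gcongr
    _ ≤ (ℓ * ‖h‖) ^ 2 := by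
        rw [← Finset.mul_sum, mul_pow]
        gcongr
        exact hv.sum_inner_products_le h

lemma norm_rival_sub_le (hv : Orthonormal ℝ v) {ℓ R : ℝ} (hℓ : 0 ≤ ℓ)
    (hB : ∀ j, j ≠ p → |β j / β p| * (m * R ^ (m - 1)) ≤ ℓ) {h h' : E} (hh : ‖h‖ ≤ R)
    (hh' : ‖h'‖ ≤ R) : ‖rival β v p m h - rival β v p m h'‖ ≤ ℓ * ‖h - h'‖ := by
  have hR : ∀ (j : Fin r) (x : E), ‖x‖ ≤ R → |(⟪v j, x⟫ : ℝ)| ≤ R := fun j x hx =>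
    (abs_real_inner_le_norm _ _).trans (by rw [hv.1 j, one_mul]; exact hx)
  rw [rival, rival, ← Finset.sum_sub_distrib]
  simp_rw [← sub_smul]
  refine norm_sum_erase_le hv _ hℓ _ fun j hj => ?_
  rw [← mul_sub, abs_mul, inner_sub_right]
  calc _ ≤ |β j / β p| * (m * R ^ (m - 1) * |(⟪v j, h⟫ : ℝ) - ⟪v j, h'⟫|) :=
        mul_le_mul_of_nonneg_left
          (abs_pow_sub_pow_le_of_abs_le (hR j h hh) (hR j h' hh') m) (abs_nonneg _)
    _ = |β j / β p| * (m * R ^ (m - 1)) * |(⟪v j, h⟫ : ℝ) - ⟪v j, h'⟫| := by ring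
    _ ≤ _ := mul_le_mul_of_nonneg_right (hB j hj) (abs_nonneg _)

lemma rival_zero (hm : 1 ≤ m) : rival β v p m (0 : E) = 0 := by
  rw [rival]
  refine Finset.sum_eq_zero fun j _ => ?_
  rw [inner_zero_right, zero_pow (by omega), mul_zero, zero_smul]

lemma norm_sub_inner_smul_le {e y : E} (he : ‖e‖ = 1) : ‖y - (⟪e, y⟫ : ℝ) • e‖ ≤ ‖y‖ := by
  refine le_of_sq_le_sq ?_ (norm_nonneg _)
  rw [norm_sub_sq_real, norm_smul, he, real_inner_smul_right, real_inner_comm, Real.norm_eq_abs,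
    mul_one, sq_abs]
  nlinarith [sq_nonneg (⟪e, y⟫ : ℝ)]

lemma abs_inner_unit_le {e y : E} (he : ‖e‖ = 1) : |(⟪e, y⟫ : ℝ)| ≤ ‖y‖ :=
  (abs_real_inner_le_norm _ _).trans (by rw [he, one_mul])

/-- Bounds for the noise map near the unit sphere. -/
structure NoiseBound (A : E → E) (K : ℝ) : Prop where
  nonneg : 0 ≤ K
  norm_le : ∀ x, ‖x‖ ≤ 2 → ‖A x‖ ≤ K
  norm_sub_le : ∀ x y, ‖x‖ ≤ 2 → ‖y‖ ≤ 2 → ‖A x - A y‖ ≤ K * ‖x - y‖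

variable {K : ℝ}

lemma abs_noise_div_le (hv : Orthonormal ℝ v) (hA : NoiseBound A K) {h : E} (hh : ‖h‖ ≤ 1) :
    |(⟪v p, A (v p + h)⟫ : ℝ) / β p| ≤ K / |β p| := by
  rw [abs_div]
  gcongr
  exact (abs_inner_unit_le (hv.1 p)).trans (hA.norm_le _ (norm_add_le_two (hv.1 p) hh))

lemma one_add_noise_ge (hv : Orthonormal ℝ v) (hA : NoiseBound A K) {h : E} (hh : ‖h‖ ≤ 1) :
    1 - K / |β p| ≤ 1 + (⟪v p, A (v p + h)⟫ : ℝ) / β p := by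
  have := abs_noise_div_le (p := p) (β := β) hv hA hh
  linarith [neg_abs_le ((⟪v p, A (v p + h)⟫ : ℝ) / β p)]

lemma inner_chartMap (hv : Orthonormal ℝ v) (hβ : β p ≠ 0) (hA : NoiseBound A K)
    (hν : K / |β p| < 1) {h : E} (hh : (⟪v p, h⟫ : ℝ) = 0) (hh1 : ‖h‖ ≤ 1) :
    (⟪v p, chartMap β v p m A h⟫ : ℝ) = 0 := by
  have hD := one_add_noise_ge (p := p) (β := β) hv hA hh1
  rw [chartMap_eq hv hβ hh (by linarith), real_inner_smul_right, inner_add_right, inner_rival hv,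
    real_inner_smul_right, inner_sub_right, real_inner_smul_right, real_inner_self_eq_norm_sq,
    hv.1 p]
  ring

/-- The map is a quotient `D⁻¹ • N`. With `ν = K / |β p|`, the numerator is bounded by `ℓ + ν` and
Lipschitz with the same constant, while `D ≥ 1 - ν` has Lipschitz constant `ν`; the two
contributions add up to `(ℓ + ν) / (1 - ν)²`. -/
lemma norm_chartMap_sub_le (hv : Orthonormal ℝ v) (hm : 1 ≤ m) (hβ : β p ≠ 0)
    (hA : NoiseBound A K) (hν : K / |β p| < 1) {ℓ R : ℝ} (hℓ : 0 ≤ ℓ) (hR : R ≤ 1)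
    (hB : ∀ j, j ≠ p → |β j / β p| * (m * R ^ (m - 1)) ≤ ℓ) {h h' : E}
    (hh : (⟪v p, h⟫ : ℝ) = 0) (hh' : (⟪v p, h'⟫ : ℝ) = 0) (hhR : ‖h‖ ≤ R) (hhR' : ‖h'‖ ≤ R) :
    ‖chartMap β v p m A h - chartMap β v p m A h'‖ ≤
      (ℓ + K / |β p|) / (1 - K / |β p|) ^ 2 * ‖h - h'‖ := by
  set ν := K / |β p| with hνdef
  have hβ' : 0 < |β p| := abs_pos.2 hβ
  have hν0 : 0 ≤ ν := by have := hA.nonneg; positivity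
  have hD := one_add_noise_ge (p := p) (β := β) hv hA (hhR.trans hR)
  have hD' := one_add_noise_ge (p := p) (β := β) hv hA (hhR'.trans hR)
  rw [← hνdef] at hD hD'
  rw [chartMap_eq hv hβ hh (by linarith), chartMap_eq hv hβ hh' (by linarith)]
  set y := A (v p + h) with hy
  set y' := A (v p + h') with hy'
  have hyy : ‖y - y'‖ ≤ K * ‖h - h'‖ := by
    have := hA.norm_sub_le _ _ (norm_add_le_two (hv.1 p) (hhR.trans hR))
      (norm_add_le_two (hv.1 p) (hhR'.trans hR))
    rwa [add_sub_add_left_eq_sub] at this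
  set D := 1 + (⟪v p, y⟫ : ℝ) / β p with hDdef
  set D' := 1 + (⟪v p, y'⟫ : ℝ) / β p with hDdef'
  set N := rival β v p m h + (β p)⁻¹ • (y - (⟪v p, y⟫ : ℝ) • v p) with hN
  set N' := rival β v p m h' + (β p)⁻¹ • (y' - (⟪v p, y'⟫ : ℝ) • v p) with hN'
  have hR0 : 0 ≤ R := (norm_nonneg _).trans hhR
  have hDpos : 0 < D := by linarith
  have hDpos' : 0 < D' := by linarith
  have h1ν : 0 < 1 - ν := by linarith
  have hNN : ‖N - N'‖ ≤ (ℓ + ν) * ‖h - h'‖ := by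
    have e : N - N' = (rival β v p m h - rival β v p m h') +
        (β p)⁻¹ • ((y - y') - (⟪v p, y - y'⟫ : ℝ) • v p) := by
      rw [hN, hN', inner_sub_right]; module
    rw [e, add_mul]
    refine (norm_add_le _ _).trans (add_le_add (norm_rival_sub_le hv hℓ hB hhR hhR') ?_)
    rw [norm_smul, norm_inv, Real.norm_eq_abs]
    calc |β p|⁻¹ * ‖y - y' - (⟪v p, y - y'⟫ : ℝ) • v p‖ ≤ |β p|⁻¹ * (K * ‖h - h'‖) := by
          gcongr
          exact (norm_sub_inner_smul_le (hv.1 p)).trans hyy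
      _ = ν * ‖h - h'‖ := by rw [hνdef]; ring
  have hN'b : ‖N'‖ ≤ ℓ + ν := by
    refine (norm_add_le _ _).trans (add_le_add ?_ ?_)
    · have := norm_rival_sub_le (β := β) hv hℓ hB hhR' (h' := 0) (by simpa using hR0)
      rw [rival_zero hm, sub_zero, sub_zero] at this
      nlinarith
    · rw [norm_smul, norm_inv, Real.norm_eq_abs]
      calc |β p|⁻¹ * ‖y' - (⟪v p, y'⟫ : ℝ) • v p‖ ≤ |β p|⁻¹ * K := by
            gcongr
            exact (norm_sub_inner_smul_le (hv.1 p)).trans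
              (hA.norm_le _ (norm_add_le_two (hv.1 p) (hhR'.trans hR)))
        _ = ν := by rw [hνdef]; ring
  have hDD : |D' - D| ≤ ν * ‖h - h'‖ := by
    have e : D' - D = (⟪v p, y' - y⟫ : ℝ) / β p := by
      rw [hDdef, hDdef', inner_sub_right]; ring
    rw [e, abs_div, hνdef, div_mul_eq_mul_div]
    gcongr
    exact (abs_inner_unit_le (hv.1 p)).trans (by rw [norm_sub_rev]; exact hyy)
  have e : D⁻¹ • N - D'⁻¹ • N' = D⁻¹ • (N - N') + (D⁻¹ * D'⁻¹ * (D' - D)) • N' := by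
    have : D⁻¹ * D'⁻¹ * (D' - D) = D⁻¹ - D'⁻¹ := by field_simp
    rw [this]; module
  rw [e]
  have hDi : |D⁻¹| ≤ (1 - ν)⁻¹ := by
    rw [abs_of_pos (inv_pos.2 hDpos)]; exact inv_anti₀ h1ν hD
  have hDi' : |D'⁻¹| ≤ (1 - ν)⁻¹ := by
    rw [abs_of_pos (inv_pos.2 hDpos')]; exact inv_anti₀ h1ν hD'
  refine (norm_add_le _ _).trans ?_
  rw [norm_smul, norm_smul, Real.norm_eq_abs, Real.norm_eq_abs, abs_mul, abs_mul]
  have hinv : 0 < (1 - ν)⁻¹ := inv_pos.2 h1ν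
  calc |D⁻¹| * ‖N - N'‖ + |D⁻¹| * |D'⁻¹| * |D' - D| * ‖N'‖
      ≤ (1 - ν)⁻¹ * ((ℓ + ν) * ‖h - h'‖) +
        (1 - ν)⁻¹ * (1 - ν)⁻¹ * (ν * ‖h - h'‖) * (ℓ + ν) := by gcongr
    _ = _ := by field_simp; ring

lemma norm_chartMap_zero_le (hv : Orthonormal ℝ v) (hm : 1 ≤ m) (hβ : β p ≠ 0)
    (hA : NoiseBound A K) (hν : K / |β p| ≤ 1 / 2) :
    ‖chartMap β v p m A 0‖ ≤ 2 * (K / |β p|) := by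
  have hβ' : 0 < |β p| := abs_pos.2 hβ
  have hK := hA.nonneg
  have hν0 : 0 ≤ K / |β p| := by positivity
  have hD := one_add_noise_ge (p := p) (β := β) hv hA (h := 0) (by simp)
  rw [chartMap_eq hv hβ (by simp) (by linarith), rival_zero hm, zero_add, norm_smul, norm_smul,
    norm_inv, norm_inv, Real.norm_eq_abs, Real.norm_eq_abs]
  have hD2 : |1 + (⟪v p, A (v p + 0)⟫ : ℝ) / β p|⁻¹ ≤ 2 := by
    rw [abs_of_pos (by linarith)]
    exact inv_le_of_inv_le₀ (by norm_num) (by linarith)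
  calc _ ≤ 2 * (|β p|⁻¹ * K) := by
        gcongr
        exact (norm_sub_inner_smul_le (hv.1 p)).trans
          (hA.norm_le _ (norm_add_le_two (hv.1 p) (by simp)))
    _ = _ := by ring

end Step

/-! ### The trajectory of the power iteration -/

/-- Supplies the smallness of `s` used in `decay_step`. The set where the ratio is at most `4 s` is
invariant for `m ≥ 2` because `(4 s)^m` is of second order, and for `m = 1` only because `B ≤ 1 -
1/κ`. -/
lemma exists_threshold {m : ℕ} (hm : 1 ≤ m) {κ σ : ℝ} (hκ : 1 ≤ κ) (hσ : 1 < σ) :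
    ∃ s₀ : ℝ, 0 < s₀ ∧ ∀ s, 0 ≤ s → s ≤ s₀ → s < 1 ∧ 1 / (1 - s) ≤ σ ∧ s ^ 2 ≤ 1 / 2 ∧ 4 * s ≤ κ ∧
      ∀ B, 0 ≤ B → B ≤ κ ^ (m - 1) → (m = 1 → B ≤ 1 - 1 / κ) →
        B * (4 * s) ^ m + s ^ 2 ≤ 4 * s * (1 - s ^ 2) := by
  have hκ0 : 0 < κ := by linarith
  have hσ0 : 0 < σ := by linarith
  have hσ1 : 1 / σ < 1 := by rw [div_lt_one hσ0]; exact hσ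
  refine ⟨min (min (1 / 4) (1 / κ)) (min (1 / (κ ^ (m - 1) * 4 ^ m)) (1 - 1 / σ)), ?_, ?_⟩
  · refine lt_min (lt_min (by norm_num) (by positivity)) (lt_min (by positivity) (by linarith))
  · intro s hs0 hs
    have h1 : s ≤ 1 / 4 := hs.trans ((min_le_left _ _).trans (min_le_left _ _))
    have h2 : s ≤ 1 / κ := hs.trans ((min_le_left _ _).trans (min_le_right _ _))
    have h3 : s ≤ 1 / (κ ^ (m - 1) * 4 ^ m) := hs.trans ((min_le_right _ _).trans (min_le_left _ _))
    have h4 : s ≤ 1 - 1 / σ := hs.trans ((min_le_right _ _).trans (min_le_right _ _))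
    refine ⟨by linarith, ?_, by nlinarith, by linarith, ?_⟩
    · rw [div_le_iff₀ (by linarith)]
      have : σ * (1 / σ) = 1 := by field_simp
      nlinarith
    · intro B hB0 hB hB1
      -- For `m = 1` the choice `s ≤ 1/κ` gives `B ≤ 1 - s`. For `m ≥ 2` the third entry of the
      -- minimum gives `B (4 s)^m ≤ s`.
      by_cases hm1 : m = 1
      · have hB' := hB1 hm1
        subst hm1
        have : B * (4 * s) ≤ (1 - s) * (4 * s) := by gcongr; linarith
        have hs3 : 4 * s ^ 3 ≤ s ^ 2 := by nlinarith [sq_nonneg s]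
        nlinarith [sq_nonneg s]
      · have hm2 : 2 ≤ m := by omega
        rw [le_div_iff₀ (by positivity)] at h3
        have e1 : s ^ m ≤ s ^ 2 := pow_le_pow_of_le_one hs0 (by linarith) hm2
        have e2 : B * (4 * s) ^ m ≤ s := by
          calc B * (4 * s) ^ m = B * 4 ^ m * s ^ m := by rw [mul_pow]; ring
            _ ≤ κ ^ (m - 1) * 4 ^ m * s ^ 2 := by gcongr
            _ = s * (κ ^ (m - 1) * 4 ^ m) * s := by ring
            _ ≤ 1 * s := by gcongr
            _ = s := one_mul s
        nlinarith [mul_nonneg hs0 (sq_nonneg s), sq_nonneg s]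

section Trajectory

variable {E : Type*} [NormedAddCommGroup E] [InnerProductSpace ℝ E] {r : ℕ}

/-- The conditions on the signals and on the initialization `u` that the trajectory depends on. -/
structure SignalBound (m : ℕ) (κ : ℝ) (β : Fin r → ℝ) (v : Fin r → E) (p : Fin r) (u : E) :
    Prop where
  orthonormal : Orthonormal ℝ v
  one_le : 1 ≤ κ
  ne_zero : β p ≠ 0
  unit : ‖u‖ = 1
  inner_ne_zero : (⟪v p, u⟫ : ℝ) ≠ 0
  ratio : ∀ j, j ≠ p → |β j / β p| ≤ κ ^ (m - 1)
  overlap : ∀ j, j ≠ p → |(⟪v j, chart (v p) u⟫ : ℝ)| ≤ κ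
  dominant : ∀ j, j ≠ p → |β j / β p| * |(⟪v j, chart (v p) u⟫ : ℝ)| ^ (m - 1) ≤ 1 - 1 / κ

/-- The overlap that is reached when the signal exceeds the noise. -/
def reach (r : ℕ) (κ : ℝ) : ℝ := 1 / (2 * (2 + r * κ))

lemma reach_pos {r : ℕ} {κ : ℝ} (hκ : 1 ≤ κ) : 0 < reach r κ := by unfold reach; positivity

lemma reach_le_one {r : ℕ} {κ : ℝ} (hκ : 1 ≤ κ) : reach r κ ≤ 1 := by
  unfold reach
  rw [div_le_one (by positivity)]
  have : 0 ≤ r * κ := by positivity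
  linarith

/-- Normalized iteration of a map. -/
def normIter (F : E → E) (u : E) : ℕ → E
  | 0 => u
  | t + 1 => ‖F (normIter F u t)‖⁻¹ • F (normIter F u t)

variable {β : Fin r → ℝ} {v : Fin r → E} {m : ℕ} {A : E → E} {p : Fin r} {u : E}
  {κ σ θ s K Λ G η : ℝ} {T₁ : ℕ}

/-- Invariants of the trajectory: the overlap with `v p` grows geometrically until it is of order
one, and all other overlaps are much smaller. -/
structure TrajInv (m : ℕ) (κ σ θ s G : ℝ) (β : Fin r → ℝ) (v : Fin r → E) (p : Fin r) (u : E)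
    (t : ℕ) (x : E) : Prop where
  unit : ‖x‖ = 1
  inner_ne_zero : (⟪v p, x⟫ : ℝ) ≠ 0
  growth : reach r κ ≤ |(⟪v p, x⟫ : ℝ)| ∨ |(⟪v p, u⟫ : ℝ)| * G ^ t ≤ |(⟪v p, x⟫ : ℝ)|
  decay : ∀ j, j ≠ p → FastDecay m |β j / β p| κ σ θ t |(⟪v j, chart (v p) x⟫ : ℝ)| ∨
    |(⟪v j, chart (v p) x⟫ : ℝ)| ≤ 4 * s

/-- The constants `σ, θ, s` are admissible for the recursion of the overlap ratios. -/
structure RecursionBound (m : ℕ) (κ σ θ s : ℝ) : Prop where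
  one_lt : 1 < σ
  le_two : σ ≤ 2
  mul_le : σ * (1 - 1 / κ) ≤ θ
  pos : 0 < θ
  lt_one : θ < 1
  nonneg : 0 ≤ s
  s_lt : s < 1
  inv_le : 1 / (1 - s) ≤ σ
  sq_le : s ^ 2 ≤ 1 / 2
  four_le : 4 * s ≤ κ
  small : ∀ B, 0 ≤ B → B ≤ κ ^ (m - 1) → (m = 1 → B ≤ 1 - 1 / κ) →
        B * (4 * s) ^ m + s ^ 2 ≤ 4 * s * (1 - s ^ 2)

lemma SignalBound.ratio_one (h : SignalBound m κ β v p u) (hm : m = 1) (j : Fin r) (hj : j ≠ p) :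
    |β j / β p| ≤ 1 - 1 / κ := by
  have := h.dominant j hj
  simpa [hm] using this

lemma FastDecay.mul_le {B h : ℝ} {t : ℕ} (hm : 1 ≤ m) (hR : RecursionBound m κ σ θ s)
    (hB : 0 ≤ B) (hh : 0 ≤ h) (hd : FastDecay m B κ σ θ t h) :
    B * h ^ m ≤ θ ^ m ^ t * h := by
  have h1 : B * h ^ (m - 1) ≤ θ ^ m ^ t := by
    refine le_trans ?_ hd.2
    have : 0 ≤ B * h ^ (m - 1) := by positivity
    nlinarith [hR.one_lt]
  calc B * h ^ m = B * h ^ (m - 1) * h := by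
        conv_lhs => rw [show m = m - 1 + 1 by omega, pow_succ]
        ring
    _ ≤ _ := mul_le_mul_of_nonneg_right h1 hh

lemma FastDecay.le {B h : ℝ} {t : ℕ} (hR : RecursionBound m κ σ θ s)
    (hκ : 0 ≤ κ) (hd : FastDecay m B κ σ θ t h) : h ≤ κ := by
  refine hd.1.trans ?_
  have := pow_le_one₀ hR.pos.le hR.lt_one.le (n := geomExp m t)
  nlinarith

lemma rival_term_le (hm : 1 ≤ m) (hS : SignalBound m κ β v p u) (hR : RecursionBound m κ σ θ s)
    {t : ℕ} {h : ℝ} (hh : 0 ≤ h) {j : Fin r} (hj : j ≠ p)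
    (hd : FastDecay m |β j / β p| κ σ θ t h ∨ h ≤ 4 * s) : |β j / β p| * h ^ m ≤ κ := by
  have hκ : 0 ≤ κ := by linarith [hS.one_le]
  rcases hd with hd | hd
  · refine (hd.mul_le hm hR (abs_nonneg _) hh).trans ?_
    have h1 := pow_le_one₀ hR.pos.le hR.lt_one.le (n := m ^ t)
    have h2 := hd.le hR hκ
    have h3 := pow_nonneg hR.pos.le (m ^ t)
    nlinarith
  · have h1 := hR.small _ (abs_nonneg (β j / β p)) (hS.ratio j hj) fun h => hS.ratio_one h j hj
    have h2 : |β j / β p| * h ^ m ≤ |β j / β p| * (4 * s) ^ m := by gcongr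
    have h3 := hR.four_le
    have h4 := hR.nonneg
    nlinarith [sq_nonneg s, mul_nonneg h4 (sq_nonneg s)]

lemma rivalSum_le (hm : 1 ≤ m) (hS : SignalBound m κ β v p u) (hR : RecursionBound m κ σ θ s)
    {t : ℕ} {h : E} (hd : ∀ j, j ≠ p → FastDecay m |β j / β p| κ σ θ t |(⟪v j, h⟫ : ℝ)| ∨
      |(⟪v j, h⟫ : ℝ)| ≤ 4 * s) : rivalSum β v p m h ≤ r * κ := by
  have hκ : 0 ≤ κ := by linarith [hS.one_le]
  calc rivalSum β v p m h ≤ ∑ j ∈ Finset.univ.erase p, κ :=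
        Finset.sum_le_sum fun j hj =>
          rival_term_le hm hS hR (abs_nonneg _) (Finset.ne_of_mem_erase hj)
            (hd j (Finset.ne_of_mem_erase hj))
    _ ≤ ∑ _j : Fin r, κ := Finset.sum_le_sum_of_subset_of_nonneg (Finset.erase_subset _ _)
        fun _ _ _ => hκ
    _ = r * κ := by simp

/-- The conditions under which the invariants persist. -/
structure TrajHyp (m : ℕ) (κ s K Λ G η : ℝ) (T₁ : ℕ) (β : Fin r → ℝ) (v : Fin r → E) (p : Fin r)
    (A : E → E) (u : E) : Prop where
  K_pos : 0 < K
  norm_le : ∀ x, ‖x‖ = 1 → ‖A x‖ ≤ K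
  Λ_pos : 0 < Λ
  le_beta : Λ ≤ |β p|
  le_strength : Λ ≤ |β p| * |(⟪v p, u⟫ : ℝ)| ^ (m - 1)
  early : ∀ t < T₁, ∀ j, |(⟪v j, A (normIter (drift β v m A) u t)⟫ : ℝ)| ≤ η
  early_le : η ≤ s ^ 2 * (reach r κ ^ (m - 1) * Λ * min (reach r κ) |(⟪v p, u⟫ : ℝ)|)
  late_le : K ≤ s ^ 2 * (reach r κ ^ m * |β p|)
  one_le_G : 1 ≤ G
  G_le : G * K ≤ reach r κ ^ m * Λ
  one_lt : 1 < |(⟪v p, u⟫ : ℝ)| * G ^ T₁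

/-- Geometric growth cannot have lasted `T₁` steps, because it would push the overlap of two unit
vectors above one. -/
lemma TrajInv.reach_le {t : ℕ} {x : E} (hv : Orthonormal ℝ v)
    (hH : TrajHyp m κ s K Λ G η T₁ β v p A u) (hI : TrajInv m κ σ θ s G β v p u t x)
    (ht : T₁ ≤ t) : reach r κ ≤ |(⟪v p, x⟫ : ℝ)| := by
  rcases hI.growth with h | h
  · exact h
  · exfalso
    have h1 : |(⟪v p, x⟫ : ℝ)| ≤ 1 := (abs_inner_unit_le (hv.1 p)).trans hI.unit.le
    have h2 : G ^ T₁ ≤ G ^ t := pow_le_pow_right₀ hH.one_le_G ht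
    have h3 := mul_le_mul_of_nonneg_left h2 (abs_nonneg (⟪v p, u⟫ : ℝ))
    linarith [hH.one_lt]

/-- The signal-to-noise bound at every time. Up to `T₁` it uses the conditional estimate in the
directions `v j`, afterwards the overlap is of order one and the crude bound `K` suffices. -/
lemma TrajInv.noise_le {t : ℕ} (hm : 1 ≤ m) (hS : SignalBound m κ β v p u)
    (hH : TrajHyp m κ s K Λ G η T₁ β v p A u)
    (hI : TrajInv m κ σ θ s G β v p u t (normIter (drift β v m A) u t)) (j : Fin r) :
    |(⟪v j, A (normIter (drift β v m A) u t)⟫ : ℝ)| ≤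
      s ^ 2 * |β p * (⟪v p, normIter (drift β v m A) u t⟫ : ℝ) ^ m| := by
  set x := normIter (drift β v m A) u t with hx
  have hc := reach_pos (r := r) hS.one_le
  rw [abs_mul, abs_pow]
  by_cases ht : t < T₁
  · refine (hH.early t ht j).trans (hH.early_le.trans ?_)
    have e : |β p| * |(⟪v p, x⟫ : ℝ)| ^ m = |β p| * |(⟪v p, x⟫ : ℝ)| ^ (m - 1) * |(⟪v p, x⟫ : ℝ)| := by
      conv_lhs => rw [show m = m - 1 + 1 by omega, pow_succ]
      ring
    rw [e]
    have hΛ := hH.Λ_pos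
    rcases hI.growth with h | h
    · have h1 : reach r κ ^ (m - 1) * Λ ≤ |β p| * |(⟪v p, x⟫ : ℝ)| ^ (m - 1) := by
        rw [mul_comm]
        have := hH.le_beta
        gcongr
      have h2 : min (reach r κ) |(⟪v p, u⟫ : ℝ)| ≤ |(⟪v p, x⟫ : ℝ)| := (min_le_left _ _).trans h
      have h3 : 0 ≤ min (reach r κ) |(⟪v p, u⟫ : ℝ)| := le_min hc.le (abs_nonneg _)
      gcongr
    · have h0 : |(⟪v p, u⟫ : ℝ)| ≤ |(⟪v p, x⟫ : ℝ)| := by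
        refine le_trans ?_ h
        have := one_le_pow₀ hH.one_le_G (n := t)
        nlinarith [abs_nonneg (⟪v p, u⟫ : ℝ)]
      have h1 : reach r κ ^ (m - 1) * Λ ≤ |β p| * |(⟪v p, x⟫ : ℝ)| ^ (m - 1) := by
        calc reach r κ ^ (m - 1) * Λ ≤ 1 * Λ := by
              gcongr; exact pow_le_one₀ hc.le (reach_le_one hS.one_le)
          _ ≤ |β p| * |(⟪v p, u⟫ : ℝ)| ^ (m - 1) := by rw [one_mul]; exact hH.le_strength
          _ ≤ _ := by gcongr
      have h2 : min (reach r κ) |(⟪v p, u⟫ : ℝ)| ≤ |(⟪v p, x⟫ : ℝ)| := (min_le_right _ _).trans h0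
      have h3 : 0 ≤ min (reach r κ) |(⟪v p, u⟫ : ℝ)| := le_min hc.le (abs_nonneg _)
      gcongr
  · have h1 := hI.reach_le hS.orthonormal hH (not_lt.1 ht)
    calc |(⟪v j, A x⟫ : ℝ)| ≤ ‖A x‖ := abs_inner_unit_le (hS.orthonormal.1 j)
      _ ≤ K := hH.norm_le x hI.unit
      _ ≤ s ^ 2 * (reach r κ ^ m * |β p|) := hH.late_le
      _ ≤ _ := by rw [mul_comm (reach r κ ^ m)]; gcongr

/-- Kept apart from the invariants because `decay_late` reruns the same recursion with a smaller
noise level. -/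
lemma decay_of_noise_le {t : ℕ} {x : E} (hm : 1 ≤ m)
    (hS : SignalBound m κ β v p u) (hR : RecursionBound m κ σ θ s)
    (hx : (⟪v p, x⟫ : ℝ) ≠ 0)
    (hd : ∀ j, j ≠ p → FastDecay m |β j / β p| κ σ θ t |(⟪v j, chart (v p) x⟫ : ℝ)| ∨
      |(⟪v j, chart (v p) x⟫ : ℝ)| ≤ 4 * s)
    (hν : ∀ j, |(⟪v j, A x⟫ : ℝ)| ≤ s ^ 2 * |β p * (⟪v p, x⟫ : ℝ) ^ m|) (j : Fin r) (hj : j ≠ p) :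
    FastDecay m |β j / β p| κ σ θ (t + 1) |(⟪v j, chart (v p) (drift β v m A x)⟫ : ℝ)| ∨
      |(⟪v j, chart (v p) (drift β v m A x)⟫ : ℝ)| ≤ 4 * s :=
  decay_step hm (abs_nonneg _) hR.inv_le hR.le_two hR.nonneg hR.s_lt (abs_nonneg _) (abs_nonneg _)
    hR.pos.le (hR.small _ (abs_nonneg _) (hS.ratio j hj) fun h => hS.ratio_one h j hj)
    (abs_inner_chart_drift_le hS.orthonormal hS.ne_zero hx
      (by linarith [hR.sq_le]) hν hj) (hd j hj)

lemma TrajInv.step {t : ℕ} (hm : 1 ≤ m) (hS : SignalBound m κ β v p u)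
    (hR : RecursionBound m κ σ θ s) (hH : TrajHyp m κ s K Λ G η T₁ β v p A u)
    (hI : TrajInv m κ σ θ s G β v p u t (normIter (drift β v m A) u t)) :
    TrajInv m κ σ θ s G β v p u (t + 1) (normIter (drift β v m A) u (t + 1)) := by
  have hν := hI.noise_le hm hS hH
  rw [normIter]
  set x := normIter (drift β v m A) u t with hx
  have hv := hS.orthonormal
  have hs2 : s ^ 2 < 1 := by linarith [hR.sq_le]
  have ha : β p * (⟪v p, x⟫ : ℝ) ^ m ≠ 0 := mul_ne_zero hS.ne_zero (pow_ne_zero _ hI.inner_ne_zero)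
  obtain ⟨hlow, hsign⟩ := drift_pos (A := A) hv ha hs2 (hν p)
  have hyp : (⟪v p, drift β v m A x⟫ : ℝ) ≠ 0 := left_ne_zero_of_mul hsign.ne'
  have hy0 : drift β v m A x ≠ 0 := fun h => hyp (by rw [h, inner_zero_right])
  have hnorm : 0 < ‖drift β v m A x‖ := norm_pos_iff.2 hy0
  have hc := reach_pos (r := r) hS.one_le
  have hin : (⟪v p, ‖drift β v m A x‖⁻¹ • drift β v m A x⟫ : ℝ) =
      ‖drift β v m A x‖⁻¹ * ⟪v p, drift β v m A x⟫ := real_inner_smul_right _ _ _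
  refine ⟨?_, ?_, ?_, ?_⟩
  · rw [norm_smul, norm_inv, norm_norm, inv_mul_cancel₀ hnorm.ne']
  · rw [hin]; exact mul_ne_zero (inv_ne_zero hnorm.ne') hyp
  · rw [hin, abs_mul, abs_inv, abs_norm]
    set a := |β p * (⟪v p, x⟫ : ℝ) ^ m| with hadef
    have hapos : 0 < a := abs_pos.2 ha
    have hup : ‖drift β v m A x‖ ≤ a * (1 + r * κ) + K := by
      refine (norm_drift_le hv hS.ne_zero hI.inner_ne_zero).trans ?_
      have := rivalSum_le hm hS hR hI.decay
      have := hH.norm_le x hI.unit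
      gcongr
    have hlow2 : a / 2 ≤ |(⟪v p, drift β v m A x⟫ : ℝ)| := by
      refine le_trans ?_ hlow
      nlinarith [hR.sq_le]
    have hrk : 0 ≤ r * κ := by have := hS.one_le; positivity
    have hreach : reach r κ * (2 * (2 + r * κ)) = 1 := by
      unfold reach; field_simp
    -- If the signal `a` exceeds the noise norm, then `‖y‖ ≤ a (2 + r κ)` while the component of `y`
    -- along `v p` is at least `a / 2`; the quotient is exactly `reach r κ`.
    by_cases hcase : K ≤ a
    · left
      rw [inv_mul_eq_div, le_div_iff₀ hnorm]
      have h1 : ‖drift β v m A x‖ ≤ a * (2 + r * κ) := by linarith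
      calc reach r κ * ‖drift β v m A x‖ ≤ reach r κ * (a * (2 + r * κ)) := by gcongr
        _ = a / 2 := by linear_combination (a / 2) * hreach
        _ ≤ _ := hlow2
    · right
      push Not at hcase
      -- If the noise dominates, the overlap cannot have reached order one: in that case `a ≥
      -- reach^m Λ ≥ G K ≥ K`. So the growth alternative holds, and normalizing by a vector of norm
      -- at most `K (2 + r κ)` still gains the factor `G`.
      have hgx : |(⟪v p, u⟫ : ℝ)| * G ^ t ≤ |(⟪v p, x⟫ : ℝ)| ∧
          reach r κ ^ (m - 1) * Λ * |(⟪v p, x⟫ : ℝ)| ≤ a := by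
        have e : a = |β p| * |(⟪v p, x⟫ : ℝ)| ^ (m - 1) * |(⟪v p, x⟫ : ℝ)| := by
          rw [hadef, abs_mul, abs_pow]
          conv_lhs => rw [show m = m - 1 + 1 by omega, pow_succ]
          ring
        have hΛ := hH.Λ_pos
        rcases hI.growth with h | h
        · exfalso
          have h1 : Λ * reach r κ ^ m ≤ a := by
            rw [hadef, abs_mul, abs_pow]
            have := hH.le_beta
            gcongr
          have h2 := hH.G_le
          have h3 := hH.one_le_G
          have h4 := hH.K_pos
          nlinarith
        · refine ⟨h, ?_⟩
          rw [e]
          have h0 : |(⟪v p, u⟫ : ℝ)| ≤ |(⟪v p, x⟫ : ℝ)| := by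
            refine le_trans ?_ h
            have := one_le_pow₀ hH.one_le_G (n := t)
            nlinarith [abs_nonneg (⟪v p, u⟫ : ℝ)]
          refine mul_le_mul_of_nonneg_right ?_ (abs_nonneg _)
          calc reach r κ ^ (m - 1) * Λ ≤ 1 * Λ := by
                gcongr; exact pow_le_one₀ hc.le (reach_le_one hS.one_le)
            _ ≤ |β p| * |(⟪v p, u⟫ : ℝ)| ^ (m - 1) := by rw [one_mul]; exact hH.le_strength
            _ ≤ _ := by gcongr
      obtain ⟨hg1, hg2⟩ := hgx
      have hK := hH.K_pos
      rw [inv_mul_eq_div, le_div_iff₀ hnorm]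
      have h1 : ‖drift β v m A x‖ ≤ K * (2 + r * κ) := by nlinarith
      have h2 : G * K * |(⟪v p, x⟫ : ℝ)| ≤ reach r κ * a := by
        calc G * K * |(⟪v p, x⟫ : ℝ)| ≤ reach r κ ^ m * Λ * |(⟪v p, x⟫ : ℝ)| := by
              exact mul_le_mul_of_nonneg_right hH.G_le (abs_nonneg _)
          _ = reach r κ * (reach r κ ^ (m - 1) * Λ * |(⟪v p, x⟫ : ℝ)|) := by
              conv_lhs => rw [show m = m - 1 + 1 by omega, pow_succ]
              ring
          _ ≤ _ := by gcongr
      have hG0 : 0 ≤ G := by linarith [hH.one_le_G]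
      calc |(⟪v p, u⟫ : ℝ)| * G ^ (t + 1) * ‖drift β v m A x‖
          ≤ (|(⟪v p, u⟫ : ℝ)| * G ^ t) * G * (K * (2 + r * κ)) := by
            rw [pow_succ, ← mul_assoc]; gcongr
        _ ≤ |(⟪v p, x⟫ : ℝ)| * G * (K * (2 + r * κ)) := by gcongr
        _ = (G * K * |(⟪v p, x⟫ : ℝ)|) * (2 + r * κ) := by ring
        _ ≤ (reach r κ * a) * (2 + r * κ) := by gcongr
        _ = a / 2 := by linear_combination (a / 2) * hreach
        _ ≤ _ := hlow2
  · intro j hj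
    rw [chart_smul (inv_ne_zero hnorm.ne')]
    exact decay_of_noise_le hm hS hR hI.inner_ne_zero hI.decay hν j hj

lemma trajInv_zero (hS : SignalBound m κ β v p u) (hR : RecursionBound m κ σ θ s) :
    TrajInv m κ σ θ s G β v p u 0 u := by
  refine ⟨hS.unit, hS.inner_ne_zero, Or.inr (by simp), fun j hj => Or.inl ⟨?_, ?_⟩⟩
  · simpa [geomExp] using hS.overlap j hj
  · rw [pow_zero, pow_one, mul_assoc]
    refine le_trans ?_ hR.mul_le
    have := hR.one_lt
    exact mul_le_mul_of_nonneg_left (hS.dominant j hj) (by linarith)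

theorem trajInv (hm : 1 ≤ m) (hS : SignalBound m κ β v p u)
    (hR : RecursionBound m κ σ θ s) (hH : TrajHyp m κ s K Λ G η T₁ β v p A u) (t : ℕ) :
    TrajInv m κ σ θ s G β v p u t (normIter (drift β v m A) u t) := by
  induction t with
  | zero => exact trajInv_zero hS hR
  | succ t ih => exact ih.step hm hS hR hH

/-- The sign of the overlap with `v p` follows that of the signal. -/
lemma TrajInv.sign_step {t : ℕ} (hm : 1 ≤ m) (hS : SignalBound m κ β v p u)
    (hR : RecursionBound m κ σ θ s) (hH : TrajHyp m κ s K Λ G η T₁ β v p A u)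
    (hI : TrajInv m κ σ θ s G β v p u t (normIter (drift β v m A) u t)) :
    0 < (⟪v p, normIter (drift β v m A) u (t + 1)⟫ : ℝ) *
      (β p * (⟪v p, normIter (drift β v m A) u t⟫ : ℝ) ^ m) := by
  have hν := hI.noise_le hm hS hH
  rw [normIter]
  set x := normIter (drift β v m A) u t with hx
  have ha : β p * (⟪v p, x⟫ : ℝ) ^ m ≠ 0 := mul_ne_zero hS.ne_zero (pow_ne_zero _ hI.inner_ne_zero)
  obtain ⟨-, hsign⟩ := drift_pos (A := A) hS.orthonormal ha (by linarith [hR.sq_le]) (hν p)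
  have hyp : (⟪v p, drift β v m A x⟫ : ℝ) ≠ 0 := left_ne_zero_of_mul hsign.ne'
  have hy0 : drift β v m A x ≠ 0 := fun h => hyp (by rw [h, inner_zero_right])
  have hnorm : 0 < ‖drift β v m A x‖ := norm_pos_iff.2 hy0
  rw [real_inner_smul_right, mul_assoc]
  positivity

lemma TrajInv.chart_step {t : ℕ} (hm : 1 ≤ m) (hS : SignalBound m κ β v p u)
    (hR : RecursionBound m κ σ θ s) (hH : TrajHyp m κ s K Λ G η T₁ β v p A u)
    (hI : TrajInv m κ σ θ s G β v p u t (normIter (drift β v m A) u t)) :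
    chart (v p) (normIter (drift β v m A) u (t + 1)) =
      chart (v p) (drift β v m A (normIter (drift β v m A) u t)) := by
  have h1 := hI.sign_step hm hS hR hH
  rw [normIter] at h1 ⊢
  refine chart_smul fun h0 => ?_
  rw [h0, zero_smul, inner_zero_right, zero_mul] at h1
  exact lt_irrefl _ h1

/-- Once the overlap with `v p` is of order one, the distance to `v p` is controlled by the other
overlaps and by the signal strength. -/
lemma TrajInv.norm_chart_succ_le {t : ℕ} (hm : 1 ≤ m) (hS : SignalBound m κ β v p u)
    (hR : RecursionBound m κ σ θ s) (hH : TrajHyp m κ s K Λ G η T₁ β v p A u)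
    (hI : TrajInv m κ σ θ s G β v p u t (normIter (drift β v m A) u t)) (ht : T₁ ≤ t) :
    ‖chart (v p) (normIter (drift β v m A) u (t + 1))‖ ≤
      2 * (rivalSum β v p m (chart (v p) (normIter (drift β v m A) u t)) +
        K / (reach r κ ^ m * |β p|)) := by
  rw [hI.chart_step hm hS hR hH]
  have hν := hI.noise_le hm hS hH
  have hre := hI.reach_le hS.orthonormal hH ht
  set x := normIter (drift β v m A) u t with hx
  refine (norm_chart_drift_le hS.orthonormal hS.ne_zero hI.inner_ne_zero
    (by linarith [hR.sq_le]) (hν p)).trans ?_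
  have hc := reach_pos (r := r) hS.one_le
  have hβ : 0 < |β p| := abs_pos.2 hS.ne_zero
  have h1 : reach r κ ^ m * |β p| ≤ |β p * (⟪v p, x⟫ : ℝ) ^ m| := by
    rw [abs_mul, abs_pow, mul_comm]; gcongr
  have h2 : ‖A x‖ / |β p * (⟪v p, x⟫ : ℝ) ^ m| ≤ K / (reach r κ ^ m * |β p|) :=
    div_le_div₀ hH.K_pos.le (hH.norm_le x hI.unit) (by positivity) h1
  have h3 := rivalSum_nonneg (β := β) (v := v) (p := p) (m := m) (chart (v p) x)
  have h4 : 0 ≤ ‖A x‖ / |β p * (⟪v p, x⟫ : ℝ) ^ m| := by positivity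
  rw [div_le_iff₀ (by linarith [hR.sq_le])]
  nlinarith [hR.sq_le]

/-- The decay of the other overlaps continues down to a level given by the noise alone. -/
theorem decay_late {s' : ℝ} {a : ℕ} (hm : 1 ≤ m) (hS : SignalBound m κ β v p u)
    (hR : RecursionBound m κ σ θ s) (hR' : RecursionBound m κ σ θ s')
    (hH : TrajHyp m κ s K Λ G η T₁ β v p A u) (ha : T₁ ≤ a)
    (hK : K ≤ s' ^ 2 * (reach r κ ^ m * |β p|))
    (h0 : ∀ j, j ≠ p → FastDecay m |β j / β p| κ σ θ a
      |(⟪v j, chart (v p) (normIter (drift β v m A) u a)⟫ : ℝ)|) (t : ℕ) (ht : a ≤ t) (j : Fin r)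
    (hj : j ≠ p) :
    FastDecay m |β j / β p| κ σ θ t
      |(⟪v j, chart (v p) (normIter (drift β v m A) u t)⟫ : ℝ)| ∨
      |(⟪v j, chart (v p) (normIter (drift β v m A) u t)⟫ : ℝ)| ≤ 4 * s' := by
  induction t, ht using Nat.le_induction generalizing j with
  | base => exact Or.inl (h0 j hj)
  | succ t ht ih =>
    have hI := trajInv hm hS hR hH t
    rw [hI.chart_step hm hS hR hH]
    have hre := hI.reach_le hS.orthonormal hH (ha.trans ht)
    have hc := reach_pos (r := r) hS.one_le
    -- After `T₁` the operator bound `K` alone gives relative noise `s'²`, so the sharper level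
    -- replaces `s`.
    refine decay_of_noise_le hm hS hR' hI.inner_ne_zero ih (fun i => ?_) j hj
    calc _ ≤ _ := abs_inner_unit_le (hS.orthonormal.1 i)
      _ ≤ K := hH.norm_le _ hI.unit
      _ ≤ s' ^ 2 * (reach r κ ^ m * |β p|) := hK
      _ ≤ _ := by rw [abs_mul, abs_pow, mul_comm (reach r κ ^ m)]; gcongr

end Trajectory

/-! ### Convergence in the chart -/

section Limit

variable {E : Type*} [NormedAddCommGroup E] [InnerProductSpace ℝ E] {r : ℕ}
  {β : Fin r → ℝ} {v : Fin r → E} {m : ℕ} {A : E → E} {p : Fin r} {u : E} {K ℓ R lam : ℝ}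

/-- The conditions under which the power iteration contracts the ball of radius `R` of the chart
around `v p`. -/
structure ContractionHyp (m : ℕ) (K ℓ R lam : ℝ) (β : Fin r → ℝ) (v : Fin r → E) (p : Fin r)
    (A : E → E) : Prop where
  orthonormal : Orthonormal ℝ v
  one_le : 1 ≤ m
  ne_zero : β p ≠ 0
  bound : NoiseBound A K
  ratio_le : K / |β p| ≤ 1 / 2
  nonneg : 0 ≤ ℓ
  R_nonneg : 0 ≤ R
  R_le : R ≤ 1
  rival_le : ∀ j, j ≠ p → |β j / β p| * (m * R ^ (m - 1)) ≤ ℓ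
  lip_le : (ℓ + K / |β p|) / (1 - K / |β p|) ^ 2 ≤ lam
  lam_lt : lam < 1
  ball_le : 2 * (K / |β p|) ≤ (1 - lam) * R

/-- The ball of radius `R` in the chart around `e`. -/
def chartBall (e : E) (R : ℝ) : Set E := {h | (⟪e, h⟫ : ℝ) = 0 ∧ ‖h‖ ≤ R}

lemma zero_mem_chartBall (e : E) {R : ℝ} (hR : 0 ≤ R) : (0 : E) ∈ chartBall e R :=
  ⟨inner_zero_right _, by simpa using hR⟩

namespace ContractionHyp

variable (hC : ContractionHyp m K ℓ R lam β v p A)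
include hC

lemma ratio_nonneg : 0 ≤ K / |β p| := by have := hC.bound.nonneg; positivity

lemma lam_nonneg : 0 ≤ lam := by
  refine le_trans ?_ hC.lip_le
  have := hC.nonneg
  have := hC.ratio_nonneg
  positivity

lemma norm_sub_le {h h' : E} (hh : h ∈ chartBall (v p) R) (hh' : h' ∈ chartBall (v p) R) :
    ‖chartMap β v p m A h - chartMap β v p m A h'‖ ≤ lam * ‖h - h'‖ :=
  (norm_chartMap_sub_le hC.orthonormal hC.one_le hC.ne_zero hC.bound
    (by linarith [hC.ratio_le]) hC.nonneg hC.R_le hC.rival_le hh.1 hh'.1 hh.2 hh'.2).trans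
    (mul_le_mul_of_nonneg_right hC.lip_le (norm_nonneg _))

lemma norm_le {h : E} (hh : h ∈ chartBall (v p) R) :
    ‖chartMap β v p m A h‖ ≤ 2 * (K / |β p|) + lam * ‖h‖ := by
  have h1 := norm_chartMap_zero_le hC.orthonormal hC.one_le hC.ne_zero hC.bound hC.ratio_le
  have h2 := hC.norm_sub_le hh (zero_mem_chartBall _ hC.R_nonneg)
  rw [sub_zero] at h2
  have h3 := norm_add_le (chartMap β v p m A h - chartMap β v p m A 0) (chartMap β v p m A 0)
  rw [sub_add_cancel] at h3
  linarith

lemma mapsTo {h : E} (hh : h ∈ chartBall (v p) R) :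
    chartMap β v p m A h ∈ chartBall (v p) R := by
  refine ⟨inner_chartMap hC.orthonormal hC.ne_zero hC.bound (by linarith [hC.ratio_le]) hh.1
    (hh.2.trans hC.R_le), (hC.norm_le hh).trans ?_⟩
  have := mul_le_mul_of_nonneg_left hh.2 hC.lam_nonneg
  linarith [hC.ball_le]

lemma iter_mem {f : ℕ → E} (h0 : f 0 ∈ chartBall (v p) R)
    (hf : ∀ t, f (t + 1) = chartMap β v p m A (f t)) (t : ℕ) : f t ∈ chartBall (v p) R := by
  induction t with
  | zero => exact h0
  | succ t ih => rw [hf]; exact hC.mapsTo ih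

lemma iter_sub_le {f g : ℕ → E} (hf0 : f 0 ∈ chartBall (v p) R) (hg0 : g 0 ∈ chartBall (v p) R)
    (hf : ∀ t, f (t + 1) = chartMap β v p m A (f t))
    (hg : ∀ t, g (t + 1) = chartMap β v p m A (g t)) (t : ℕ) :
    ‖f t - g t‖ ≤ lam ^ t * ‖f 0 - g 0‖ := by
  induction t with
  | zero => simp
  | succ t ih =>
    rw [hf, hg, pow_succ']
    refine (hC.norm_sub_le (hC.iter_mem hf0 hf t) (hC.iter_mem hg0 hg t)).trans ?_
    rw [mul_assoc]
    exact mul_le_mul_of_nonneg_left ih hC.lam_nonneg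

/-- The contraction argument is run on the orbit itself, compared with its own shift; the bound for
the limit follows by passing to the limit in `norm_le`. -/
lemma exists_limit [CompleteSpace E] {f : ℕ → E} (h0 : f 0 ∈ chartBall (v p) R)
    (hf : ∀ t, f (t + 1) = chartMap β v p m A (f t)) :
    ∃ h : E, h ∈ chartBall (v p) R ∧ ‖h‖ ≤ 2 * (K / |β p|) / (1 - lam) ∧
      Tendsto f atTop (𝓝 h) := by
  have hlam := hC.lam_nonneg
  have hmem := hC.iter_mem h0 hf
  have hcau : CauchySeq f := by
    refine cauchySeq_of_le_geometric lam ‖f 0 - f 1‖ hC.lam_lt fun t => ?_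
    rw [dist_eq_norm, mul_comm]
    exact hC.iter_sub_le (g := fun t => f (t + 1)) h0 (hmem 1) hf (fun t => hf (t + 1)) t
  obtain ⟨h, hh⟩ := cauchySeq_tendsto_of_complete hcau
  have hin : (⟪v p, h⟫ : ℝ) = 0 := by
    have h1 : Tendsto (fun t => (⟪v p, f t⟫ : ℝ)) atTop (𝓝 ⟪v p, h⟫) :=
      Tendsto.inner tendsto_const_nhds hh
    have h2 : (fun t => (⟪v p, f t⟫ : ℝ)) = fun _ => 0 := funext fun t => (hmem t).1
    rw [h2] at h1
    exact (tendsto_nhds_unique h1 tendsto_const_nhds)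
  refine ⟨h, ⟨hin, le_of_tendsto hh.norm (Eventually.of_forall fun t => (hmem t).2)⟩, ?_, hh⟩
  have hs : Tendsto (fun t => f (t + 1)) atTop (𝓝 h) := hh.comp (tendsto_add_atTop_nat 1)
  have hle : ‖h‖ ≤ 2 * (K / |β p|) + lam * ‖h‖ :=
    le_of_tendsto_of_tendsto hs.norm ((hh.norm.const_mul lam).const_add _)
      (Eventually.of_forall fun t => by simpa only [hf] using hC.norm_le (hmem t))
  rw [le_div_iff₀ (by linarith [hC.lam_lt])]
  linarith

end ContractionHyp

/-! ### The signs of the overlaps and the energy -/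

lemma sign_of_mul_pos {a b : ℝ} (h : 0 < a * b) : Real.sign a = Real.sign b := by
  rcases pos_and_pos_or_neg_and_neg_of_mul_pos h with ⟨ha, hb⟩ | ⟨ha, hb⟩
  · rw [Real.sign_of_pos ha, Real.sign_of_pos hb]
  · rw [Real.sign_of_neg ha, Real.sign_of_neg hb]

/-- An even power erases the sign, so from the first step on only the sign of `b` remains; `t = 0`
is excluded. -/
lemma sign_eq_of_even {b : ℝ} {x : ℕ → ℝ} (hm : Even m)
    (hx : ∀ t, 0 < x (t + 1) * (b * x t ^ m)) {t : ℕ} (ht : 1 ≤ t) :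
    Real.sign (x t) = Real.sign b := by
  obtain ⟨t, rfl⟩ : ∃ s, t = s + 1 := ⟨t - 1, by omega⟩
  have h0 := hx t
  have h1 : 0 < x t ^ m := by
    refine lt_of_le_of_ne (hm.pow_nonneg _) fun h => ?_
    rw [← h, mul_zero, mul_zero] at h0; exact lt_irrefl _ h0
  refine sign_of_mul_pos ?_
  rw [← mul_assoc] at h0
  exact pos_of_mul_pos_left h0 h1.le

/-- An odd power keeps the sign, so every step multiplies it by the sign of `b`. -/
lemma sign_eq_of_odd {b : ℝ} {x : ℕ → ℝ} (hm : Odd m)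
    (hx : ∀ t, 0 < x (t + 1) * (b * x t ^ m)) (t : ℕ) :
    Real.sign (x t) = Real.sign b ^ t * Real.sign (x 0) := by
  induction t with
  | zero => simp
  | succ t ih =>
    have h0 := hx t
    have hb : b ≠ 0 := by rintro rfl; simp at h0
    have hxt : x t ≠ 0 := by
      intro h; rw [h, zero_pow hm.pos.ne', mul_zero, mul_zero] at h0; exact lt_irrefl _ h0
    rw [pow_succ', mul_assoc, ← ih, sign_of_mul_pos h0]
    have h1 : Real.sign (x t ^ m) = Real.sign (x t) := by
      refine sign_of_mul_pos ?_
      rw [← pow_succ]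
      exact (hm.add_one).pow_pos hxt
    rcases lt_or_gt_of_ne hb with hb | hb <;> rcases lt_or_gt_of_ne (pow_ne_zero m hxt) with h | h
    · rw [Real.sign_of_pos (mul_pos_of_neg_of_neg hb h), Real.sign_of_neg hb, ← h1,
        Real.sign_of_neg h]; norm_num
    · rw [Real.sign_of_neg (mul_neg_of_neg_of_pos hb h), Real.sign_of_neg hb, ← h1,
        Real.sign_of_pos h]; norm_num
    · rw [Real.sign_of_neg (mul_neg_of_pos_of_neg hb h), Real.sign_of_pos hb, ← h1,
        Real.sign_of_neg h]; norm_num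
    · rw [Real.sign_of_pos (mul_pos hb h), Real.sign_of_pos hb, ← h1, Real.sign_of_pos h]; norm_num

/-- The value of the multilinear form of the observation on the diagonal. -/
def energy (β : Fin r → ℝ) (v : Fin r → E) (m : ℕ) (A : E → E) (x : E) : ℝ :=
  ⟪x, drift β v m A x⟫

lemma energy_smul (hA : ∀ (c : ℝ) (x : E), A (c • x) = c ^ m • A x) (c : ℝ) (x : E) :
    energy β v m A (c • x) = c ^ (m + 1) * energy β v m A x := by
  rw [energy, drift_smul hA, real_inner_smul_left, real_inner_smul_right, energy, pow_succ]; ring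

lemma energy_eq (x : E) :
    energy β v m A x = ∑ j, β j * (⟪v j, x⟫ : ℝ) ^ (m + 1) + ⟪x, A x⟫ := by
  rw [energy, drift, inner_add_right, inner_sum]
  congr 1
  refine Finset.sum_congr rfl fun j _ => ?_
  rw [real_inner_smul_right, real_inner_comm, pow_succ]; ring

lemma continuous_energy (hA : Continuous A) : Continuous (energy β v m A) := by
  have : energy β v m A = fun x => ∑ j, β j * (⟪v j, x⟫ : ℝ) ^ (m + 1) + ⟪x, A x⟫ :=
    funext energy_eq
  rw [this]; fun_prop

/-- Normalization costs `‖h‖²` relative to `β p`, the other signals enter with power `m + 1 ≥ 2`,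
and the noise moves by `O(K ‖h‖)`. With `‖h‖ = O(1/|β p|)` only the term `⟪v p, A (v p)⟫` is left,
and it needs the Gaussian bound. -/
lemma abs_energy_lift_sub_le (hv : Orthonormal ℝ v) (hm : 1 ≤ m) (hβ : β p ≠ 0)
    (hA : NoiseBound A K) {B : ℝ} (hB0 : 0 ≤ B) (hB : ∀ j, j ≠ p → |β j / β p| ≤ B) {h : E}
    (hh : (⟪v p, h⟫ : ℝ) = 0) (hh1 : ‖h‖ ≤ 1) :
    |energy β v m A (lift (v p) h) - β p| ≤
      (m + 1 + r * B) * (|β p| * ‖h‖ ^ 2) + 4 * K * ‖h‖ + |(⟪v p, A (v p)⟫ : ℝ)| := by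
  set y := lift (v p) h with hy
  have he := hv.1 p
  have hnorm := norm_add_le_one_add_sq he hh
  have hone := one_le_norm_add he hh
  have hpos : 0 < ‖v p + h‖ := by linarith
  have hg : (⟪v p, y⟫ : ℝ) = ‖v p + h‖⁻¹ := inner_lift_self he hh
  set g := ‖v p + h‖⁻¹ with hgdef
  have hg0 : 0 < g := inv_pos.2 hpos
  have hg1 : g ≤ 1 := inv_le_one_of_one_le₀ hone
  have hg2 : 1 - g ≤ ‖h‖ ^ 2 := by
    have : g * ‖v p + h‖ = 1 := inv_mul_cancel₀ hpos.ne'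
    nlinarith [sq_nonneg ‖h‖]
  have h1 : |β p * g ^ (m + 1) - β p| ≤ (m + 1) * (|β p| * ‖h‖ ^ 2) := by
    have e : β p * g ^ (m + 1) - β p = -(β p * (1 - g ^ (m + 1))) := by ring
    have h2 : 0 ≤ 1 - g ^ (m + 1) := sub_nonneg.2 (pow_le_one₀ hg0.le hg1)
    have h3 := one_add_mul_le_pow (a := g - 1) (by linarith) (m + 1)
    rw [add_sub_cancel] at h3
    push_cast at h3
    rw [e, abs_neg, abs_mul, abs_of_nonneg h2]
    have h4 : 1 - g ^ (m + 1) ≤ (m + 1) * ‖h‖ ^ 2 := by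
      have : (0 : ℝ) ≤ m + 1 := by positivity
      nlinarith
    calc |β p| * (1 - g ^ (m + 1)) ≤ |β p| * ((m + 1) * ‖h‖ ^ 2) := by gcongr
      _ = _ := by ring
  have h2 : |∑ j ∈ Finset.univ.erase p, β j * (⟪v j, y⟫ : ℝ) ^ (m + 1)| ≤
      r * B * (|β p| * ‖h‖ ^ 2) := by
    refine (Finset.abs_sum_le_sum_abs _ _).trans ?_
    calc _ ≤ ∑ j ∈ Finset.univ.erase p, B * (|β p| * ‖h‖ ^ 2) := by
          refine Finset.sum_le_sum fun j hj => ?_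
          have hj' := Finset.ne_of_mem_erase hj
          have e1 : |(⟪v j, y⟫ : ℝ)| ≤ ‖h‖ := by
            rw [hy, lift, real_inner_smul_right, inner_add_right, inner_basis_of_ne hv hj',
              zero_add, abs_mul, abs_of_pos hg0]
            have := abs_inner_unit_le (y := h) (hv.1 j)
            nlinarith [abs_nonneg (⟪v j, h⟫ : ℝ)]
          have e2 : |β j| = |β j / β p| * |β p| := by
            rw [abs_div, div_mul_cancel₀ _ (abs_ne_zero.2 hβ)]
          rw [abs_mul, abs_pow, e2]
          calc |β j / β p| * |β p| * |(⟪v j, y⟫ : ℝ)| ^ (m + 1) ≤ B * |β p| * ‖h‖ ^ (m + 1) := by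
                gcongr; exact hB j hj'
            _ ≤ B * |β p| * ‖h‖ ^ 2 := by
                gcongr B * |β p| * ?_
                exact pow_le_pow_of_le_one (norm_nonneg _) hh1 (by omega)
            _ = _ := by ring
      _ ≤ ∑ _j : Fin r, B * (|β p| * ‖h‖ ^ 2) :=
          Finset.sum_le_sum_of_subset_of_nonneg (Finset.erase_subset _ _)
            fun _ _ _ => by positivity
      _ = _ := by simp; ring
  have h3 : |(⟪y, A y⟫ : ℝ) - ⟪v p, A (v p)⟫| ≤ 4 * K * ‖h‖ := by
    have e : (⟪y, A y⟫ : ℝ) - ⟪v p, A (v p)⟫ = ⟪y - v p, A y⟫ + ⟪v p, A y - A (v p)⟫ := by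
      rw [inner_sub_left, inner_sub_right]; ring
    have hyn : ‖y‖ ≤ 2 := by rw [hy, norm_lift he hh]; norm_num
    have hen : ‖v p‖ ≤ 2 := by rw [he]; norm_num
    have hd := norm_lift_sub_le he hh
    have hK := hA.nonneg
    rw [e]
    refine (abs_add_le _ _).trans ?_
    have e1 : |(⟪y - v p, A y⟫ : ℝ)| ≤ 2 * ‖h‖ * K :=
      (abs_real_inner_le_norm _ _).trans (mul_le_mul hd (hA.norm_le y hyn) (norm_nonneg _)
        (by positivity))
    have e2 : |(⟪v p, A y - A (v p)⟫ : ℝ)| ≤ K * (2 * ‖h‖) :=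
      (abs_inner_unit_le he).trans ((hA.norm_sub_le y (v p) hyn hen).trans (by gcongr))
    linarith
  have e : energy β v m A y - β p = (β p * g ^ (m + 1) - β p) +
      ∑ j ∈ Finset.univ.erase p, β j * (⟪v j, y⟫ : ℝ) ^ (m + 1) +
      ((⟪y, A y⟫ : ℝ) - ⟪v p, A (v p)⟫) + ⟪v p, A (v p)⟫ := by
    rw [energy_eq, ← Finset.add_sum_erase _ _ (Finset.mem_univ p), hg]; ring
  rw [e]
  refine (abs_add_le _ _).trans (add_le_add_left ((abs_add_le _ _).trans
    (add_le_add ((abs_add_le _ _).trans (le_trans (add_le_add h1 h2) ?_)) h3)) _)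
  linarith

end Limit

/-! ### The power iteration of the observation -/

section Link

variable {n m r : ℕ}

/-- The noise of the power iteration, `x ↦ Z[x ^ ⊗m]`. -/
def noiseMap (Z : Tensor n (m + 1)) (x : Vec n) : Vec n := act Z (tpow x m)

lemma act_observation_eq (β : Fin r → ℝ) (v : Fin r → Vec n) (Z : Tensor n (m + 1)) (x : Vec n) :
    act (observation β v Z) (tpow x m) = drift β v m (noiseMap Z) x := act_observation β v Z x

lemma powerIter_observation (β : Fin r → ℝ) (v : Fin r → Vec n) (Z : Tensor n (m + 1)) (u : Vec n)
    (t : ℕ) :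
    powerIter (observation β v Z) u t = normIter (drift β v m (noiseMap Z)) u t := by
  induction t with
  | zero => rfl
  | succ t ih => rw [powerIter, normIter, ih, act_observation_eq]

lemma strength_observation (β : Fin r → ℝ) (v : Fin r → Vec n) (Z : Tensor n (m + 1)) (u : Vec n)
    (t : ℕ) : strength (observation β v Z) u t =
      energy β v m (noiseMap Z) (normIter (drift β v m (noiseMap Z)) u t) := by
  rw [strength, tinner_tpow_succ, act_observation_eq, powerIter_observation]; rfl

lemma noiseMap_smul (Z : Tensor n (m + 1)) (c : ℝ) (x : Vec n) :
    noiseMap Z (c • x) = c ^ m • noiseMap Z x := by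
  rw [noiseMap, tpow_smul, act_smul_right, noiseMap]

lemma continuous_noiseMap (Z : Tensor n (m + 1)) : Continuous (noiseMap Z) := by
  unfold noiseMap act tpow
  fun_prop

lemma InjBound.noiseBound {Z : Tensor n (m + 1)} {K : ℝ} (hK : 0 ≤ K) (h : InjBound Z K) :
    NoiseBound (noiseMap Z) (K * (m + 1) * 2 ^ m) where
  nonneg := by positivity
  norm_le x hx := by
    refine (h.norm_act_le hK x).trans ?_
    have h1 : ‖x‖ ^ m ≤ 2 ^ m := pow_le_pow_left₀ (norm_nonneg _) hx m
    have h2 : K ≤ K * (m + 1) := le_mul_of_one_le_right hK (by linarith [Nat.cast_nonneg (α := ℝ) m])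
    gcongr
  norm_sub_le x y hx hy := h.norm_act_sub_le hK one_le_two hx hy

lemma norm_normIter_le (F : Vec n → Vec n) {u : Vec n} (hu : ‖u‖ ≤ 1) (t : ℕ) :
    ‖normIter F u t‖ ≤ 1 := by
  cases t with
  | zero => exact hu
  | succ t =>
    rw [normIter, norm_smul, norm_inv, norm_norm]
    exact inv_mul_le_one

/-- During a bounded number of steps the noise is of order `1 / √n` in fixed directions. -/
lemma noise_early_tail (β : Fin r → ℝ) (v : Fin r → Vec n) (hv : ∀ j, ‖v j‖ = 1) {u : Vec n}
    (hu : ‖u‖ ≤ 1) (T : ℕ) {M : ℝ} (hM : 0 < M) :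
    noise n (m + 1) {Z | ∃ j, ∃ t < T, T * M / √n <
      |(⟪v j, noiseMap Z (normIter (drift β v m (noiseMap Z)) u t)⟫ : ℝ)|} ≤
      r * (T * ENNReal.ofReal (1 / M ^ 2)) := by
  set f : Vec n → Vec n → Vec n := fun s y =>
    ‖∑ j, (β j * (⟪v j, s⟫ : ℝ) ^ m) • v j + y‖⁻¹ • (∑ j, (β j * (⟪v j, s⟫ : ℝ) ^ m) • v j + y)
    with hf
  have horb : ∀ (Z : Tensor n (m + 1)) (t : ℕ), orbit f (fun s => tpow s m) Z u t =
      normIter (drift β v m (noiseMap Z)) u t := by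
    intro Z t
    induction t with
    | zero => rfl
    | succ t ih => rw [orbit, ih]; rfl
  have hfm : Measurable fun p : Vec n × Vec n => f p.1 p.2 := by
    have : Measurable fun p : Vec n × Vec n =>
        ∑ j, (β j * (⟪v j, p.1⟫ : ℝ) ^ m) • v j + p.2 := by fun_prop
    exact this.norm.inv.smul this
  have h1 := fun j => noise_adaptive_tail (n := n) (m := m) T hfm (measurable_tpow m) u (v j) hM
  calc _ ≤ noise n (m + 1) (⋃ j, {Z | ∃ t < T, T * (M / √n) * ‖v j‖ *
        tnorm (tpow (orbit f (fun s => tpow s m) Z u t) m) <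
          |⟪v j, act Z (tpow (orbit f (fun s => tpow s m) Z u t) m)⟫|}) := by
        refine measure_mono ?_
        rintro Z ⟨j, t, ht, h⟩
        refine Set.mem_iUnion.2 ⟨j, t, ht, ?_⟩
        rw [horb, tnorm_tpow, hv, mul_one]
        refine lt_of_le_of_lt ?_ h
        rw [mul_div_assoc]
        refine mul_le_of_le_one_right (by positivity) ?_
        exact pow_le_one₀ (norm_nonneg _) (norm_normIter_le _ hu t)
    _ ≤ ∑ j : Fin r, (T : ENNReal) * ENNReal.ofReal (1 / M ^ 2) :=
        (measure_iUnion_fintype_le _ _).trans (Finset.sum_le_sum fun j _ => h1 j)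
    _ = _ := by simp

lemma measurable_act_apply (q : Tensor n m) :
    Measurable fun (Z : Tensor n (m + 1)) (i : Fin n) => act Z q i := by
  simp only [act_apply]; fun_prop

lemma noise_inner_act_tail {q : Tensor n m} (hq : tinner q q = 1) (a : Vec n) {M : ℝ} (hM : 0 < M) :
    noise n (m + 1) {Z | M / √n * ‖a‖ < |(⟪a, act Z q⟫ : ℝ)|} ≤ ENNReal.ofReal (1 / M ^ 2) := by
  have h := rowNoise_inner_tail a hM
  rw [← map_act_noise (m := m) hq, Measure.map_apply (measurable_act_apply q)] at h
  · exact h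
  · refine measurableSet_lt measurable_const ?_
    exact (measurable_const.inner ((PiLp.continuous_toLp 2 _).measurable)).abs

lemma noise_norm_act_tail : ∃ C : ℝ, 0 < C ∧ ∀ (n m : ℕ) (q : Tensor n m) (M : ℝ), 0 < n → 0 < M →
    tinner q q = 1 → noise n (m + 1) {Z | M / √n < |‖act Z q‖ ^ 2 - 1|} ≤
      ENNReal.ofReal (C / M ^ 2) := by
  obtain ⟨C, hC, h⟩ := exists_rowNoise_norm_tail
  refine ⟨C, hC, fun n m q M hn hM hq => ?_⟩
  have h := h n M hn hM
  rw [← map_act_noise (m := m) hq, Measure.map_apply (measurable_act_apply q)] at h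
  · exact h
  · refine measurableSet_lt measurable_const ?_
    exact ((((PiLp.continuous_toLp 2 _).measurable).norm.pow_const 2).sub_const 1).abs

end Link

/-! ### The constants -/

namespace Admissible

variable {m r n : ℕ} [NeZero r] {κ c₀ ε : ℝ} {β : Fin r → ℝ} {v : Fin r → Vec n} {u : Vec n}
  {p : Fin r}

lemma one_le (h : Admissible (m + 1) r n κ c₀ ε β v u p) (hc : 0 < c₀) (hn : 0 < n) : 1 ≤ κ := by
  have h1 := (h.comparable p p).2
  have h2 : 0 < |(⟪u, v p⟫ : ℝ)| := lt_of_lt_of_le (by positivity) (h.overlap p)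
  rwa [div_self (abs_pos.1 h2), abs_one] at h1

lemma overlap' (h : Admissible (m + 1) r n κ c₀ ε β v u p) (j : Fin r) :
    c₀ / √n ≤ |(⟪v j, u⟫ : ℝ)| := by
  rw [real_inner_comm]; exact h.overlap j

lemma strong' (h : Admissible (m + 1) r n κ c₀ ε β v u p) :
    (n : ℝ) ^ ε ≤ |β p| * |(⟪v p, u⟫ : ℝ)| ^ (m - 1) := by
  have := h.strong
  rwa [abs_mul, abs_pow, real_inner_comm] at this

lemma le_abs (h : Admissible (m + 1) r n κ c₀ ε β v u p) : (n : ℝ) ^ ε ≤ |β p| := by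
  refine h.strong'.trans (mul_le_of_le_one_right (abs_nonneg _) (pow_le_one₀ (abs_nonneg _) ?_))
  exact (abs_inner_unit_le (h.orthonormal.1 p)).trans h.unit_init.le

/-- The bound on `|β j / β p|` comes from maximality of `p` and comparability of the overlaps; it
holds even for signals with `|β j| > |β p|`. -/
lemma signalBound (h : Admissible (m + 1) r n κ c₀ ε β v u p) (hc : 0 < c₀) (hn : 0 < n) :
    SignalBound m κ β v p u := by
  have hκ := h.one_le hc hn
  have hx : ∀ j, 0 < |(⟪v j, u⟫ : ℝ)| := fun j => lt_of_lt_of_le (by positivity) (h.overlap' j)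
  have hβ : 0 < |β p| := lt_of_lt_of_le (Real.rpow_pos_of_pos (by exact_mod_cast hn) _) h.le_abs
  have hco : ∀ i j, |(⟪v i, u⟫ : ℝ)| ≤ κ * |(⟪v j, u⟫ : ℝ)| := by
    intro i j
    have := (h.comparable i j).2
    rwa [real_inner_comm, real_inner_comm (v j), abs_div, div_le_iff₀ (hx j)] at this
  have harg : ∀ j, |β j| * |(⟪v j, u⟫ : ℝ)| ^ (m - 1) ≤ |β p| * |(⟪v p, u⟫ : ℝ)| ^ (m - 1) := by
    intro j
    have := h.argmax j
    rwa [abs_mul, abs_mul, abs_pow, abs_pow, real_inner_comm, real_inner_comm (v p)] at this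
  have hch : ∀ j, j ≠ p → |(⟪v j, chart (v p) u⟫ : ℝ)| = |(⟪v j, u⟫ : ℝ)| / |(⟪v p, u⟫ : ℝ)| := by
    intro j hj
    rw [inner_chart (inner_basis_of_ne h.orthonormal hj), abs_div]
  refine ⟨h.orthonormal, hκ, abs_pos.1 hβ, h.unit_init, abs_pos.1 (hx p), ?_, ?_, ?_⟩
  · intro j hj
    rw [abs_div, div_le_iff₀ hβ]
    refine le_of_mul_le_mul_right ?_ (pow_pos (hx j) (m - 1))
    calc _ ≤ _ := harg j
      _ ≤ |β p| * (κ * |(⟪v j, u⟫ : ℝ)|) ^ (m - 1) := by gcongr; exact hco p j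
      _ = _ := by rw [mul_pow]; ring
  · intro j hj
    rw [hch j hj, div_le_iff₀ (hx p)]
    exact hco j p
  · intro j hj
    have := h.dominant j hj
    rw [abs_mul, abs_mul, abs_pow, abs_pow, real_inner_comm, real_inner_comm (v p)] at this
    rw [hch j hj, abs_div, div_pow, div_mul_div_comm, div_le_iff₀ (mul_pos hβ (pow_pos (hx p) _))]
    exact this

end Admissible

/-- The decay rate `exp (-1/κ)` of the smaller overlaps is admissible. -/
lemma exists_recursionBound {m : ℕ} (hm : 1 ≤ m) {κ : ℝ} (hκ : 1 ≤ κ) :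
    ∃ σ s₀ : ℝ, 0 < s₀ ∧ ∀ s, 0 ≤ s → s ≤ s₀ → RecursionBound m κ σ (Real.exp (-(1 / κ))) s := by
  have hκ0 : 0 < κ := by linarith
  have hq : 1 - 1 / κ < Real.exp (-(1 / κ)) := Real.one_sub_lt_exp_neg (by positivity)
  have hq0 : 0 ≤ 1 - 1 / κ := by
    rw [sub_nonneg, div_le_one hκ0]; exact hκ
  obtain ⟨σ, hσ1, hσ2, hσq⟩ : ∃ σ : ℝ, 1 < σ ∧ σ ≤ 2 ∧ σ * (1 - 1 / κ) ≤ Real.exp (-(1 / κ)) := by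
    -- For `κ = 1` there is nothing to multiply and any `σ ≤ 2` will do. Otherwise the strict
    -- inequality `1 - 1/κ < exp (-1/κ)` leaves room for some `σ > 1`.
    rcases hq0.eq_or_lt with h0 | h0
    · exact ⟨2, one_lt_two, le_rfl, by rw [← h0, mul_zero]; exact (Real.exp_pos _).le⟩
    · refine ⟨min 2 (Real.exp (-(1 / κ)) / (1 - 1 / κ)), lt_min one_lt_two ?_, min_le_left _ _, ?_⟩
      · rwa [one_lt_div h0]
      · calc _ ≤ Real.exp (-(1 / κ)) / (1 - 1 / κ) * (1 - 1 / κ) := by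
              gcongr; exact min_le_right _ _
          _ = _ := div_mul_cancel₀ _ h0.ne'
  obtain ⟨s₀, hs₀, h⟩ := exists_threshold hm hκ hσ1
  refine ⟨σ, s₀, hs₀, fun s hs hs' => ?_⟩
  obtain ⟨h1, h2, h3, h4, h5⟩ := h s hs hs'
  exact ⟨hσ1, hσ2, hσq, Real.exp_pos _, Real.exp_lt_one_iff.2 (by rw [neg_lt_zero]; positivity), hs, h1,
    h2, h3, h4, h5⟩

lemma tendsto_natCast_rpow {ε : ℝ} (hε : 0 < ε) :
    Tendsto (fun n : ℕ => (n : ℝ) ^ ε) atTop atTop :=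
  (tendsto_rpow_atTop hε).comp tendsto_natCast_atTop_atTop

lemma tendsto_sqrt_natCast : Tendsto (fun n : ℕ => √(n : ℝ)) atTop atTop :=
  Real.tendsto_sqrt_atTop.comp tendsto_natCast_atTop_atTop

/-- For large `n` the conditions on the trajectory follow from bounds of the noise. -/
lemma eventually_trajHyp {m r : ℕ} [NeZero r] {κ c₀ ε K L s : ℝ} {T₁ : ℕ}
    (hκ : 1 ≤ κ) (hc : 0 < c₀) (hε : 0 < ε) (hK : 0 < K) (hs : 0 < s) (hT : 1 ≤ ε * T₁) :
    ∀ᶠ n : ℕ in atTop, ∃ G : ℝ, ∀ (β : Fin r → ℝ) (v : Fin r → Vec n) (u : Vec n) (p : Fin r)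
      (A : Vec n → Vec n), Admissible (m + 1) r n κ c₀ ε β v u p →
      (∀ x, ‖x‖ = 1 → ‖A x‖ ≤ K) →
      (∀ j, ∀ t < T₁, |(⟪v j, A (normIter (drift β v m A) u t)⟫ : ℝ)| ≤ L / √n) →
      TrajHyp m κ s K ((n : ℝ) ^ ε) G (L / √n) T₁ β v p A u := by
  have hre := reach_pos (r := r) hκ
  set ρ := reach r κ with hρ
  have hpow := tendsto_natCast_rpow hε
  have e1 : ∀ᶠ n : ℕ in atTop, c₀ / ρ ≤ √(n : ℝ) := tendsto_sqrt_natCast.eventually_ge_atTop _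
  have e2 : ∀ᶠ n : ℕ in atTop, L / (s ^ 2 * ρ ^ (m - 1) * c₀) ≤ (n : ℝ) ^ ε :=
    hpow.eventually_ge_atTop _
  have e3 : ∀ᶠ n : ℕ in atTop, K / (s ^ 2 * ρ ^ m) ≤ (n : ℝ) ^ ε := hpow.eventually_ge_atTop _
  have e4 : ∀ᶠ n : ℕ in atTop, K / ρ ^ m ≤ (n : ℝ) ^ ε := hpow.eventually_ge_atTop _
  have e5 : ∀ᶠ n : ℕ in atTop, 1 / (c₀ * (ρ ^ m / K) ^ T₁) < √(n : ℝ) :=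
    tendsto_sqrt_natCast.eventually_gt_atTop _
  filter_upwards [e1, e2, e3, e4, e5, eventually_ge_atTop 1] with n h1 h2 h3 h4 h5 hn
  have hn0 : (0 : ℝ) < n := by exact_mod_cast hn
  have hn1 : (1 : ℝ) ≤ n := by exact_mod_cast hn
  have hsq : 0 < √(n : ℝ) := Real.sqrt_pos.2 hn0
  have hnε : 0 < (n : ℝ) ^ ε := Real.rpow_pos_of_pos hn0 _
  rw [div_le_iff₀ (by positivity)] at h1 h2 h3 h4
  rw [div_lt_iff₀ (by positivity)] at h5
  -- The largest growth factor `G` permitted by `G K ≤ ρ^m Λ` with `Λ = n^ε`.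
  refine ⟨ρ ^ m / K * (n : ℝ) ^ ε, fun β v u p A hA hAn hAe => ?_⟩
  have hx := hA.overlap' p
  refine ⟨hK, hAn, hnε, hA.le_abs, hA.strong', fun t ht j => hAe j t ht, ?_, ?_, ?_, ?_, ?_⟩
  · have hmin : c₀ / √n ≤ min ρ |(⟪v p, u⟫ : ℝ)| :=
      le_min (by rw [div_le_iff₀ hsq]; linarith) hx
    calc L / √n ≤ s ^ 2 * (ρ ^ (m - 1) * (n : ℝ) ^ ε * (c₀ / √n)) := by
          rw [div_le_iff₀ hsq]
          calc L ≤ _ := h2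
            _ = s ^ 2 * (ρ ^ (m - 1) * (n : ℝ) ^ ε * (c₀ / √n)) * √n := by field_simp
      _ ≤ _ := by gcongr
  · have := hA.le_abs
    calc K ≤ _ := h3
      _ = s ^ 2 * (ρ ^ m * (n : ℝ) ^ ε) := by ring
      _ ≤ _ := by gcongr
  · rw [div_mul_eq_mul_div, le_div_iff₀ hK]; linarith
  · exact le_of_eq (by rw [← hρ]; field_simp)
  -- As `ε T₁ ≥ 1`, the growth over `T₁` steps is at least a constant times `n`, more than enough
  -- against the initial overlap `c₀ / √n`.
  · rw [mul_pow, ← Real.rpow_natCast ((n : ℝ) ^ ε), ← Real.rpow_mul hn0.le]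
    have h6 : (n : ℝ) ≤ (n : ℝ) ^ (ε * T₁) := by
      conv_lhs => rw [← Real.rpow_one (n : ℝ)]
      exact Real.rpow_le_rpow_of_exponent_le hn1 hT
    calc (1 : ℝ) < √n * (c₀ * (ρ ^ m / K) ^ T₁) := h5
      _ = c₀ / √n * ((ρ ^ m / K) ^ T₁ * n) := by
          have := Real.sq_sqrt hn0.le
          have h7 : (n : ℝ) / √n = √n := by rw [div_eq_iff hsq.ne']; nlinarith
          calc √(n : ℝ) * (c₀ * (ρ ^ m / K) ^ T₁) = n / √n * (c₀ * (ρ ^ m / K) ^ T₁) := by rw [h7]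
            _ = _ := by ring
      _ ≤ _ := by gcongr

/-! ### The good event -/

lemma one_sub_le_measureReal {Ω : Type*} [MeasurableSpace Ω] {μ : Measure Ω} [IsProbabilityMeasure μ]
    {S B : Set Ω} {δ : ℝ} (hδ : 0 ≤ δ) (hB : μ B ≤ ENNReal.ofReal δ) (h : ∀ x, x ∉ B → x ∈ S) :
    1 - δ ≤ μ.real S := by
  have h1 : μ.real Set.univ ≤ μ.real S + μ.real B := by
    refine (measureReal_mono fun x _ => ?_).trans (measureReal_union_le _ _)
    by_cases hx : x ∈ B
    · exact Or.inr hx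
    · exact Or.inl (h x hx)
  have h2 : μ.real B ≤ δ := ENNReal.toReal_le_of_le_ofReal hδ hB
  rw [probReal_univ] at h1
  linarith

lemma eventually_ofReal_exp_le {δ : ℝ} (hδ : 0 < δ) :
    ∀ᶠ n : ℕ in atTop, ENNReal.ofReal (2 * Real.exp (-n)) ≤ ENNReal.ofReal δ := by
  have h : Tendsto (fun n : ℕ => 2 * Real.exp (-(n : ℝ))) atTop (𝓝 (2 * 0)) :=
    ((Real.tendsto_exp_neg_atTop_nhds_zero).comp tendsto_natCast_atTop_atTop).const_mul 2
  rw [mul_zero] at h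
  filter_upwards [h.eventually_le_const hδ] with n hn
  exact ENNReal.ofReal_le_ofReal hn

lemma exists_div_sq_le (c : ℝ) {δ : ℝ} (hδ : 0 < δ) : ∃ M : ℝ, 1 ≤ M ∧ c / M ^ 2 ≤ δ := by
  refine ⟨max 1 (c / δ), le_max_left _ _, ?_⟩
  set M := max 1 (c / δ)
  have h1 : 1 ≤ M := le_max_left _ _
  have h2 : c / δ ≤ M := le_max_right _ _
  rw [div_le_iff₀ hδ] at h2
  rw [div_le_iff₀ (by positivity)]
  nlinarith [mul_nonneg hδ.le (by linarith : 0 ≤ M)]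

/-- The properties of the noise on which the convergence of the power iteration relies. -/
structure GoodNoise {n m r : ℕ} (κ s K Λ G η μ : ℝ) (T₁ : ℕ) (β : Fin r → ℝ)
    (v : Fin r → Vec n) (p : Fin r) (u : Vec n) (Z : Tensor n (m + 1)) : Prop where
  traj : TrajHyp m κ s K Λ G η T₁ β v p (noiseMap Z) u
  bound : NoiseBound (noiseMap Z) (K * (m + 1) * 2 ^ m)
  energy_le : |(⟪v p, noiseMap Z (v p)⟫ : ℝ)| ≤ μ

/-- Since `T₁` does not depend on `n`, the constant `M` can be fixed before `n`; this makes the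
probability bounds uniform over all admissible instances. -/
lemma eventually_goodNoise {m r : ℕ} [NeZero r] {κ c₀ ε K s δ : ℝ} {T₁ : ℕ}
    (hκ : 1 ≤ κ) (hc : 0 < c₀) (hε : 0 < ε) (hK : 1 ≤ K)
    (hinj : ∀ n, noise n (m + 1) {Z | ¬ InjBound Z K} ≤ ENNReal.ofReal (2 * Real.exp (-n)))
    (hs : 0 < s) (hT : 1 ≤ ε * T₁) (hδ : 0 < δ) :
    ∃ M : ℝ, ∀ᶠ n : ℕ in atTop, ∃ G : ℝ, ∀ (β : Fin r → ℝ) (v : Fin r → Vec n) (u : Vec n)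
      (p : Fin r), Admissible (m + 1) r n κ c₀ ε β v u p →
      noise n (m + 1) {Z | ¬ GoodNoise κ s K ((n : ℝ) ^ ε) G (T₁ * M / √n) (M / √n) T₁ β v p u Z} ≤
        ENNReal.ofReal δ := by
  obtain ⟨M, hM1, hM⟩ := exists_div_sq_le (r * T₁ + 1 : ℝ) (half_pos hδ)
  have hM0 : 0 < M := by linarith
  refine ⟨M, ?_⟩
  filter_upwards [eventually_trajHyp (m := m) (r := r) (L := T₁ * M) hκ hc hε
    (lt_of_lt_of_le one_pos hK) hs hT, eventually_ofReal_exp_le (half_pos hδ)] with n ⟨G, hG⟩ hexp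
  refine ⟨G, fun β v u p hA => ?_⟩
  have hv := hA.orthonormal.1
  have h1 := noise_early_tail (m := m) β v hv hA.unit_init.le T₁ hM0
  have hq : tinner (tpow (v p) m) (tpow (v p) m) = 1 := by
    rw [tinner_tpow, real_inner_self_eq_norm_sq, hv]; norm_num
  have h2 := noise_inner_act_tail hq (v p) hM0
  rw [hv, mul_one] at h2
  have hsub : {Z | ¬ GoodNoise κ s K ((n : ℝ) ^ ε) G (T₁ * M / √n) (M / √n) T₁ β v p u Z} ⊆
      {Z : Tensor n (m + 1) | ¬ InjBound Z K} ∪ ({Z | ∃ j, ∃ t < T₁, T₁ * M / √n <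
      |(⟪v j, noiseMap Z (normIter (drift β v m (noiseMap Z)) u t)⟫ : ℝ)|} ∪
      {Z | M / √n < |(⟪v p, act Z (tpow (v p) m)⟫ : ℝ)|}) := by
    intro Z hZ
    by_contra hcon
    simp only [Set.mem_union, Set.mem_ofPred_eq, not_or, not_not, not_exists, not_and, not_lt]
      at hcon
    obtain ⟨c1, c2, c3⟩ := hcon
    refine hZ ⟨hG β v u p _ hA (fun x hx => ?_) c2, c1.noiseBound (by linarith), c3⟩
    have := c1.norm_act_le (by linarith) x
    rwa [hx, one_pow, mul_one] at this
  refine (measure_mono hsub).trans ((measure_union_le _ _).trans (le_trans (add_le_add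
    ((hinj n).trans hexp) ((measure_union_le _ _).trans (add_le_add h1 h2))) ?_))
  have e : (r : ENNReal) * (T₁ * ENNReal.ofReal (1 / M ^ 2)) + ENNReal.ofReal (1 / M ^ 2) =
      ENNReal.ofReal ((r * T₁ + 1) / M ^ 2) := by
    rw [← ENNReal.ofReal_natCast, ← ENNReal.ofReal_natCast, ← ENNReal.ofReal_mul (by positivity),
      ← ENNReal.ofReal_mul (by positivity), ← ENNReal.ofReal_add (by positivity) (by positivity)]
    congr 1; ring
  rw [e]
  calc _ ≤ ENNReal.ofReal (δ / 2) + ENNReal.ofReal (δ / 2) := by gcongr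
    _ = ENNReal.ofReal δ := by
      rw [← ENNReal.ofReal_add (by positivity) (by positivity), add_halves]

/-! ### Convergence of the power iteration -/

section Converge

variable {E : Type*} [NormedAddCommGroup E] [InnerProductSpace ℝ E] {r : ℕ}
  {β : Fin r → ℝ} {v : Fin r → E} {m : ℕ} {A : E → E} {p : Fin r} {u : E}
  {κ σ θ s K Λ G η : ℝ} {T₁ : ℕ}

/-- For `m ≥ 2` the radius is chosen so that the rivals have Lipschitz constant at most `1/2`. For
`m = 1` no radius helps, and the ratio bound `1 - 1/κ` is used. Half of the gap `1 - ℓ` is reserved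
for the noise. -/
lemma exists_contractionHyp {m : ℕ} (hm : 1 ≤ m) {κ : ℝ} (hκ : 1 ≤ κ) :
    ∃ ℓ R lam ν₀ : ℝ, 0 < R ∧ R ≤ 1 ∧ lam < 1 ∧ 0 < ν₀ ∧ ∀ (K : ℝ) {E : Type}
      [NormedAddCommGroup E] [InnerProductSpace ℝ E] {r : ℕ} (β : Fin r → ℝ) (v : Fin r → E)
      (p : Fin r) (A : E → E) (u : E), SignalBound m κ β v p u → NoiseBound A K →
        K / |β p| ≤ ν₀ → ContractionHyp m K ℓ R lam β v p A := by
  have hκ0 : 0 < κ := by linarith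
  have hq1 : 1 - 1 / κ < 1 := by have : 0 < 1 / κ := by positivity
                                 linarith
  set ℓ := max (1 - 1 / κ) (1 / 2) with hℓ
  have hℓ1 : ℓ < 1 := max_lt hq1 (by norm_num)
  have hℓ0 : 1 / 2 ≤ ℓ := le_max_right _ _
  have hm0 : (1 : ℝ) ≤ m := by exact_mod_cast hm
  have hκm : 1 ≤ κ ^ (m - 1) := one_le_pow₀ hκ
  set R := 1 / (2 * m * κ ^ (m - 1)) with hR
  have hR0 : 0 < R := by positivity
  have hR1 : R ≤ 1 := by
    rw [hR, div_le_one (by positivity)]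
    nlinarith
  refine ⟨ℓ, R, (1 + ℓ) / 2, (1 - ℓ) * R / 6, hR0, hR1, by linarith, by nlinarith, ?_⟩
  intro K E _ _ r β v p A u hS hA hν
  have hν0 : 0 ≤ K / |β p| := by have := hA.nonneg; positivity
  have hν1 : K / |β p| ≤ (1 - ℓ) / 6 := by nlinarith
  refine ⟨hS.orthonormal, hm, hS.ne_zero, hA, by linarith, by linarith, hR0.le, hR1, ?_, ?_,
    by linarith, by nlinarith⟩
  · intro j hj
    by_cases hm1 : m = 1
    · refine le_trans ?_ (le_max_left _ _)
      have := hS.ratio_one hm1 j hj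
      simpa [hm1] using this
    · refine le_trans ?_ (le_max_right _ _)
      have h1 : R ^ (m - 1) ≤ R := pow_le_of_le_one hR0.le hR1 (by omega)
      calc |β j / β p| * (m * R ^ (m - 1)) ≤ κ ^ (m - 1) * (m * R) := by
            gcongr; exact hS.ratio j hj
        _ = 1 / 2 := by rw [hR]; field_simp
  · rw [div_le_iff₀ (by have : 0 < 1 - K / |β p| := by linarith
                        positivity)]
    nlinarith [sq_nonneg (K / |β p|)]

lemma rivalSum_le_of_decay (hm : 1 ≤ m) (hS : SignalBound m κ β v p u)
    (hR : RecursionBound m κ σ θ s) {t : ℕ} {h : E}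
    (hd : ∀ j, j ≠ p → FastDecay m |β j / β p| κ σ θ t |(⟪v j, h⟫ : ℝ)| ∨
      |(⟪v j, h⟫ : ℝ)| ≤ 4 * s) : rivalSum β v p m h ≤ r * (κ * θ ^ t + 4 * s) := by
  have hκ : 0 ≤ κ := by linarith [hS.one_le]
  have hs := hR.nonneg
  have hθ := hR.pos
  calc rivalSum β v p m h ≤ ∑ j ∈ Finset.univ.erase p, (κ * θ ^ t + 4 * s) := by
        refine Finset.sum_le_sum fun j hj => ?_
        rcases hd j (Finset.ne_of_mem_erase hj) with hd | hd
        · have h1 := hd.mul_le hm hR (abs_nonneg _) (abs_nonneg _)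
          have h2 : |(⟪v j, h⟫ : ℝ)| ≤ κ * θ ^ t :=
            hd.1.trans (mul_le_mul_of_nonneg_left
              (pow_le_pow_of_le_one hθ.le hR.lt_one.le (le_geomExp hm t)) hκ)
          have h3 := pow_le_one₀ hθ.le hR.lt_one.le (n := m ^ t)
          have h4 := abs_nonneg (⟪v j, h⟫ : ℝ)
          nlinarith
        · have h1 := hR.small _ (abs_nonneg (β j / β p)) (hS.ratio j (Finset.ne_of_mem_erase hj))
            fun h => hS.ratio_one h j (Finset.ne_of_mem_erase hj)
          have h2 : |β j / β p| * |(⟪v j, h⟫ : ℝ)| ^ m ≤ |β j / β p| * (4 * s) ^ m := by gcongr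
          have h3 : 0 ≤ κ * θ ^ t := by positivity
          nlinarith [sq_nonneg s, mul_nonneg hs (sq_nonneg s)]
    _ ≤ ∑ _j : Fin r, (κ * θ ^ t + 4 * s) :=
        Finset.sum_le_sum_of_subset_of_nonneg (Finset.erase_subset _ _) fun _ _ _ => by positivity
    _ = _ := by rw [Finset.sum_const, Finset.card_univ, Fintype.card_fin, nsmul_eq_mul]

/-- Up to signs the trajectory converges, close to `v p`. -/
structure Converged (m : ℕ) (β : Fin r → ℝ) (v : Fin r → E) (p : Fin r) (u : E) (A : E → E)
    (δ : ℝ) (h : E) : Prop where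
  norm_eq : ‖v p‖ = 1
  inner_eq : (⟪v p, h⟫ : ℝ) = 0
  norm_lift_le : ‖lift (v p) h - v p‖ ≤ δ
  energy_le : |energy β v m A (lift (v p) h) - β p| ≤ δ
  tendsto_chart : Tendsto (fun t => chart (v p) (normIter (drift β v m A) u t)) atTop (𝓝 h)
  unit : ∀ t, ‖normIter (drift β v m A) u t‖ = 1
  sign_step : ∀ t, 0 < (⟪v p, normIter (drift β v m A) u (t + 1)⟫ : ℝ) *
      (β p * (⟪v p, normIter (drift β v m A) u t⟫ : ℝ) ^ m)
  inner_ne_zero : ∀ t, (⟪v p, normIter (drift β v m A) u t⟫ : ℝ) ≠ 0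
  smul : ∀ (c : ℝ) (x : E), A (c • x) = c ^ m • A x
  continuous : Continuous A

/-- At time `T₁ + 1` the iterate has entered the contracting ball; from then on the chart coordinate
converges and its limit is at distance at most `D / |β p|`. -/
lemma converged_of_trajHyp [CompleteSpace E] {ℓ R lam δ K' : ℝ} (hm : 1 ≤ m)
    (hS : SignalBound m κ β v p u)
    (hR : RecursionBound m κ σ θ s) (hH : TrajHyp m κ s K Λ G η T₁ β v p A u)
    (hC : ContractionHyp m K' ℓ R lam β v p A)
    (hsm : ∀ (c : ℝ) (x : E), A (c • x) = c ^ m • A x) (hcont : Continuous A)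
    (hstart : 2 * (r * (κ * θ ^ T₁ + 4 * s) + K / (reach r κ ^ m * |β p|)) ≤ R)
    {D : ℝ} (hD : D = 2 * K' / (1 - lam)) (h1 : 2 * (D / |β p|) ≤ δ)
    (h2 : ((m + 1 + r * κ ^ (m - 1)) * D ^ 2 + 4 * K' * D) / |β p| +
      |(⟪v p, A (v p)⟫ : ℝ)| ≤ δ) :
    ∃ h, Converged m β v p u A δ h := by
  have hI := trajInv hm hS hR hH
  have he := hS.orthonormal.1 p
  have hβ : 0 < |β p| := abs_pos.2 hS.ne_zero
  have hstep : ∀ t, chart (v p) (normIter (drift β v m A) u (t + 1)) =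
      chartMap β v p m A (chart (v p) (normIter (drift β v m A) u t)) := fun t => by
    rw [(hI t).chart_step hm hS hR hH, chart_drift hsm (hI t).inner_ne_zero]
  obtain ⟨h, hmem, hle, hlim⟩ := hC.exists_limit
    (f := fun t => chart (v p) (normIter (drift β v m A) u (t + (T₁ + 1))))
    ⟨inner_chart_self he (hI _).inner_ne_zero, by
      rw [zero_add]
      refine ((hI T₁).norm_chart_succ_le hm hS hR hH le_rfl).trans (le_trans ?_ hstart)
      have := rivalSum_le_of_decay hm hS hR (hI T₁).decay
      gcongr⟩
    (fun t => by rw [add_right_comm]; exact hstep _)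
  have hD' : ‖h‖ ≤ D / |β p| := hle.trans (le_of_eq (by rw [hD]; ring))
  have hK' := hC.bound.nonneg
  refine ⟨h, he, hmem.1, ?_, ?_, ?_, fun t => (hI t).unit, fun t => (hI t).sign_step hm hS hR hH,
    fun t => (hI t).inner_ne_zero, hsm, hcont⟩
  · exact (norm_lift_sub_le he hmem.1).trans (by linarith)
  · refine (abs_energy_lift_sub_le hS.orthonormal hm hS.ne_zero hC.bound
      (B := κ ^ (m - 1)) (by have := hS.one_le; positivity) hS.ratio hmem.1
      (hmem.2.trans hC.R_le)).trans (le_trans ?_ h2)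
    gcongr ?_ + _
    have hk : 0 ≤ κ := by linarith [hS.one_le]
    have e1 : |β p| * ‖h‖ ^ 2 ≤ D ^ 2 / |β p| := by
      calc |β p| * ‖h‖ ^ 2 ≤ |β p| * (D / |β p|) ^ 2 := by gcongr
        _ = _ := by field_simp
    calc _ ≤ (m + 1 + r * κ ^ (m - 1)) * (D ^ 2 / |β p|) + 4 * K' * (D / |β p|) := by
          gcongr
      _ = _ := by ring
  · exact (tendsto_add_atTop_iff_nat (T₁ + 1)).1 hlim

namespace Converged

variable {δ : ℝ} {h : E} (hc : Converged m β v p u A δ h)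
include hc

lemma tendsto {f : ℕ → ℕ} (hf : Tendsto f atTop atTop) {c : ℝ}
    (hsign : ∀ᶠ t in atTop, Real.sign (⟪v p, normIter (drift β v m A) u (f t)⟫ : ℝ) = c) :
    Tendsto (fun t => (energy β v m A (normIter (drift β v m A) u (f t)),
      normIter (drift β v m A) u (f t))) atTop
      (𝓝 (c ^ (m + 1) * energy β v m A (lift (v p) h), c • lift (v p) h)) := by
  have h1 : Tendsto (fun t => lift (v p) (chart (v p) (normIter (drift β v m A) u (f t)))) atTop
      (𝓝 (lift (v p) h)) :=
    (continuousAt_lift hc.norm_eq hc.inner_eq).tendsto.comp (hc.tendsto_chart.comp hf)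
  have h2 := ((continuous_energy (β := β) (v := v) (m := m) hc.continuous).tendsto _).comp h1
  refine Tendsto.congr' ?_ ((h2.const_mul (c ^ (m + 1))).prodMk_nhds (h1.const_smul c))
  filter_upwards [hsign] with t ht
  have h3 := eq_sign_smul_lift (hc.unit (f t)) (hc.inner_ne_zero (f t))
  rw [ht] at h3
  rw [Function.comp_apply, ← energy_smul hc.smul, ← h3]

lemma norm_lift_eq : ‖lift (v p) h‖ = 1 := norm_lift hc.norm_eq hc.inner_eq

end Converged

end Converge

/-! ### The four sign cases of the limit -/

section Cases

variable {n m r : ℕ} {β : Fin r → ℝ} {v : Fin r → Vec n} {Z : Tensor n (m + 1)} {p : Fin r}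
  {u h : Vec n} {δ : ℝ}

lemma abs_sign_eq_one {x : ℝ} (hx : x ≠ 0) : |Real.sign x| = 1 := by
  rcases Real.sign_apply_eq_of_ne_zero x hx with h | h <;> rw [h] <;> norm_num

lemma Converged.convergesNear (hc : Converged m β v p u (noiseMap Z) δ h) {c : ℝ} (habs : |c| = 1)
    (hsign : ∀ᶠ t in atTop,
      Real.sign (⟪v p, normIter (drift β v m (noiseMap Z)) u t⟫ : ℝ) = c) :
    ConvergesNear (observation β v Z) u (c ^ (m + 1) * β p) (c • v p) δ := by
  refine ⟨c ^ (m + 1) * energy β v m (noiseMap Z) (lift (v p) h), c • lift (v p) h, ?_, ?_, ?_⟩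
  · have := hc.tendsto tendsto_id hsign
    simpa only [strength_observation, powerIter_observation, id] using this
  · rw [← mul_sub, abs_mul, abs_pow, habs, one_pow, one_mul]; exact hc.energy_le
  · rw [← smul_sub, norm_smul, Real.norm_eq_abs, habs, one_mul]; exact hc.norm_lift_le

lemma Converged.of_even (hc : Converged m β v p u (noiseMap Z) δ h) (hm : Even m) (hβ : β p ≠ 0) :
    ConvergesNear (observation β v Z) u (Real.sign (β p) * β p) (Real.sign (β p) • v p) δ := by
  have h1 : Real.sign (β p) ^ (m + 1) = Real.sign (β p) := by
    rw [pow_succ, ← hm.pow_abs, abs_sign_eq_one hβ, one_pow, one_mul]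
  have := hc.convergesNear (abs_sign_eq_one hβ) ?_
  · rwa [h1] at this
  · filter_upwards [eventually_ge_atTop 1] with t ht
    exact sign_eq_of_even
      (x := fun t => (⟪v p, normIter (drift β v m (noiseMap Z)) u t⟫ : ℝ)) hm hc.sign_step ht

lemma Converged.of_odd_pos (hc : Converged m β v p u (noiseMap Z) δ h) (hm : Odd m)
    (hβ : 0 < β p) :
    ConvergesNear (observation β v Z) u (β p) (Real.sign ⟪u, v p⟫ • v p) δ := by
  have hx : Real.sign (⟪u, v p⟫ : ℝ) = Real.sign ⟪v p, u⟫ := by rw [real_inner_comm]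
  have h1 := abs_sign_eq_one (hc.inner_ne_zero 0)
  have := hc.convergesNear h1 (Eventually.of_forall fun t => ?_)
  · rwa [← hm.add_one.pow_abs, h1, one_pow, one_mul, normIter, ← hx] at this
  · rw [sign_eq_of_odd (x := fun t => (⟪v p, normIter (drift β v m (noiseMap Z)) u t⟫ : ℝ)) hm
      hc.sign_step, Real.sign_of_pos hβ, one_pow, one_mul]

lemma Converged.of_odd_neg (hc : Converged m β v p u (noiseMap Z) δ h) (hm : Odd m)
    (hβ : β p < 0) :
    AlternatesNear (observation β v Z) u (β p) (Real.sign ⟪u, v p⟫ • v p) δ := by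
  have hx : Real.sign (⟪u, v p⟫ : ℝ) = Real.sign ⟪v p, u⟫ := by rw [real_inner_comm]
  set c := Real.sign (⟪u, v p⟫ : ℝ) with hcdef
  have h1 : |c| = 1 := by rw [hx]; exact abs_sign_eq_one (hc.inner_ne_zero 0)
  have h2 : c ^ (m + 1) = 1 := by rw [← hm.add_one.pow_abs, h1, one_pow]
  have hs : ∀ t, Real.sign (⟪v p, normIter (drift β v m (noiseMap Z)) u t⟫ : ℝ) = (-1) ^ t * c := by
    intro t
    rw [sign_eq_of_odd (x := fun t => (⟪v p, normIter (drift β v m (noiseMap Z)) u t⟫ : ℝ)) hm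
      hc.sign_step, Real.sign_of_neg hβ, hx]; rfl
  have htwo : Tendsto (fun t : ℕ => 2 * t) atTop atTop :=
    tendsto_atTop_mono (fun t => by rw [id]; omega) tendsto_id
  have htwo' : Tendsto (fun t : ℕ => 2 * t + 1) atTop atTop :=
    tendsto_atTop_mono (fun t => by rw [id]; omega) tendsto_id
  have he : Tendsto (fun t => (strength (observation β v Z) u (2 * t),
      powerIter (observation β v Z) u (2 * t))) atTop
      (𝓝 (energy β v m (noiseMap Z) (lift (v p) h), c • lift (v p) h)) := by
    have := hc.tendsto (c := c) htwo (Eventually.of_forall fun t => by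
        rw [hs, pow_mul]; norm_num)
    simpa only [strength_observation, powerIter_observation, h2, one_mul] using this
  have ho : Tendsto (fun t => (strength (observation β v Z) u (2 * t + 1),
      powerIter (observation β v Z) u (2 * t + 1))) atTop
      (𝓝 (energy β v m (noiseMap Z) (lift (v p) h), -(c • lift (v p) h))) := by
    have := hc.tendsto (c := -c) htwo'
      (Eventually.of_forall fun t => by rw [hs, pow_succ, pow_mul]; norm_num)
    rw [hm.add_one.neg_pow, h2, one_mul, neg_smul] at this
    simpa only [strength_observation, powerIter_observation] using this
  refine ⟨?_, _, _, he, ho, hc.energy_le, ?_⟩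
  -- A common limit would force `c • lift (v p) h` to equal its own negative, which is impossible
  -- for a unit vector.
  · rintro ⟨l, hl⟩
    have e1 := tendsto_nhds_unique he (hl.comp htwo)
    have e2 := tendsto_nhds_unique ho (hl.comp htwo')
    have e3 := congrArg Prod.snd (e1.trans e2.symm)
    have e4 : c • lift (v p) h = 0 := by
      have := add_eq_zero_iff_eq_neg.2 e3
      rw [← two_smul ℝ] at this
      exact (smul_eq_zero.1 this).resolve_left two_ne_zero
    have e5 : ‖c • lift (v p) h‖ = 1 := by
      rw [norm_smul, hc.norm_lift_eq, Real.norm_eq_abs, h1, one_mul]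
    rw [e4, norm_zero] at e5
    exact zero_ne_one e5
  · rw [← smul_sub, norm_smul, Real.norm_eq_abs, h1, one_mul]; exact hc.norm_lift_le

end Cases

lemma tendsto_const_div_rpow (c : ℝ) {ε : ℝ} (hε : 0 < ε) :
    Tendsto (fun n : ℕ => c / (n : ℝ) ^ ε) atTop (𝓝 0) :=
  (tendsto_natCast_rpow hε).const_div_atTop c

lemma tendsto_const_div_sqrt (c : ℝ) : Tendsto (fun n : ℕ => c / √(n : ℝ)) atTop (𝓝 0) :=
  tendsto_sqrt_natCast.const_div_atTop c

/-- One time serves two purposes: the overlap with `v p` has reached order one, and the other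
overlaps have decayed into the contracting ball. -/
lemma exists_time {ε θ c ρ : ℝ} (hε : 0 < ε) (h0 : 0 ≤ θ) (h1 : θ < 1) (hρ : 0 < ρ) :
    ∃ T : ℕ, 1 ≤ ε * T ∧ c * θ ^ T ≤ ρ := by
  have e1 : ∀ᶠ T : ℕ in atTop, 1 ≤ ε * T :=
    (tendsto_natCast_atTop_atTop.const_mul_atTop hε).eventually_ge_atTop 1
  have e2 : Tendsto (fun T : ℕ => c * θ ^ T) atTop (𝓝 (c * 0)) :=
    (tendsto_pow_atTop_nhds_zero_of_lt_one h0 h1).const_mul c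
  rw [mul_zero] at e2
  exact (e1.and (e2.eventually_le_const hρ)).exists

/-- With probability close to one the power iteration converges up to signs. -/
theorem eventually_converged {m r : ℕ} [NeZero r] (hm : 1 ≤ m) {κ c₀ ε δ : ℝ} (hc : 0 < c₀)
    (hε : 0 < ε) (hδ : 0 < δ) :
    ∀ᶠ n : ℕ in atTop, ∀ (β : Fin r → ℝ) (v : Fin r → Vec n) (u : Vec n)
      (p : Fin r), Admissible (m + 1) r n κ c₀ ε β v u p →
      noise n (m + 1) {Z | ¬ ∃ h, Converged m β v p u (noiseMap Z) δ h} ≤ ENNReal.ofReal δ := by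
  by_cases hκ : 1 ≤ κ
  -- For `κ < 1` no admissible instance exists, since the ratio of an overlap with itself is `1`.
  swap
  · filter_upwards [eventually_gt_atTop 0] with n hn β v u p hA
    exact absurd (hA.one_le hc hn) hκ
  obtain ⟨K, hK, hinj⟩ := noise_injBound (m + 1)
  obtain ⟨ℓ, R, lam, ν₀, hR0, hR1, hlam, hν₀, hcontr⟩ := exists_contractionHyp hm hκ
  obtain ⟨σ, s₀, hs₀, hrec⟩ := exists_recursionBound hm hκ
  set θ := Real.exp (-(1 / κ)) with hθ
  have hr : (0 : ℝ) < r := by exact_mod_cast Nat.pos_of_ne_zero (NeZero.ne r)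
  have hθ1 := (hrec s₀ hs₀.le le_rfl).lt_one
  obtain ⟨T₁, hT, hT'⟩ := exists_time (c := κ) (ρ := R / (8 * r)) hε (Real.exp_pos _).le hθ1
    (by positivity)
  -- With `κ θ^T₁ ≤ R / (8 r)` and noise ratio at most `R / 8`, this `s` makes the chart norm at
  -- time `T₁ + 1` at most `3 R / 4`.
  set s := min s₀ (R / (32 * r)) with hs
  have hs1 : 0 < s := lt_min hs₀ (by positivity)
  have hs2 : s ≤ R / (32 * r) := min_le_right _ _
  have hRs := hrec s hs1.le (min_le_left _ _)
  obtain ⟨M, hM⟩ := eventually_goodNoise (r := r) hκ hc hε hK hinj hs1 hT hδ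
  set K' := K * (m + 1) * 2 ^ m with hK'
  set D := 2 * K' / (1 - lam) with hD
  have hreach := reach_pos (r := r) hκ
  have hK0 : 0 < K := by linarith
  have hK'0 : 0 < K' := by positivity
  have hD0 : 0 < D := div_pos (by positivity) (by linarith)
  filter_upwards [hM, eventually_gt_atTop 0,
    (tendsto_const_div_rpow K' hε).eventually_le_const hν₀,
    (tendsto_const_div_rpow (K / reach r κ ^ m) hε).eventually_le_const
      (by positivity : 0 < R / 8),
    (tendsto_const_div_rpow D hε).eventually_le_const (half_pos hδ),
    (tendsto_const_div_rpow ((m + 1 + r * κ ^ (m - 1)) * D ^ 2 + 4 * K' * D) hε).eventually_le_const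
      (half_pos hδ),
    (tendsto_const_div_sqrt M).eventually_le_const (half_pos hδ)] with n ⟨G, hG⟩ hn0 h1 h2 h3 h4 h5
    β v u p hA
  have hS := hA.signalBound hc hn0
  have hle := hA.le_abs
  have hnε : 0 < (n : ℝ) ^ ε := Real.rpow_pos_of_pos (by exact_mod_cast hn0) _
  have hdiv : ∀ {c : ℝ}, 0 ≤ c → c / |β p| ≤ c / (n : ℝ) ^ ε := fun hc =>
    div_le_div_of_nonneg_left hc hnε hle
  refine (measure_mono ?_).trans (hG β v u p hA)
  intro Z hZ hgood
  refine hZ (converged_of_trajHyp hm hS hRs hgood.traj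
    (hcontr K' β v p _ u hS hgood.bound ((hdiv hK'0.le).trans h1)) (noiseMap_smul Z)
    (continuous_noiseMap Z) ?_ hD ?_ ?_)
  · have e1 : K / (reach r κ ^ m * |β p|) ≤ R / 8 := by
      rw [← div_div]; exact (hdiv (by positivity)).trans h2
    have e2 : r * (κ * θ ^ T₁ + 4 * s) ≤ R / 4 := by
      calc r * (κ * θ ^ T₁ + 4 * s) ≤ r * (R / (8 * r) + 4 * (R / (32 * r))) := by gcongr
        _ = R / 4 := by field_simp; norm_num
    linarith
  · linarith [hdiv hD0.le]
  · have e1 := hgood.energy_le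
    have e2 := hdiv (c := (m + 1 + r * κ ^ (m - 1)) * D ^ 2 + 4 * K' * D) (by positivity)
    linarith

/-! ### The number of iterations -/

/-- The time after which the smaller overlaps are below `1 / (√n B)`. -/
def arrivalTime (m n : ℕ) (κ B : ℝ) : ℝ :=
  (Real.log (Real.log (√n * B)) + Real.log κ) / Real.log m

/-- The threshold for `ε` above which the number of iterations has to be increased. -/
def epsThreshold (k : ℕ) (κ : ℝ) : ℝ := 1 / (2 * (|Real.log κ| / Real.log ((k : ℝ) - 1) + 1))

lemma epsThreshold_pos {k : ℕ} (hk : 2 ≤ k) (κ : ℝ) : 0 < epsThreshold k κ := by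
  have hk' : (2 : ℝ) ≤ k := by exact_mod_cast hk
  have : 0 ≤ Real.log ((k : ℝ) - 1) := Real.log_nonneg (by linarith)
  unfold epsThreshold
  positivity

/-- From `log B / log n ≥ ε` the prescribed time exceeds `log log (√n B) / log m` by at least `3 +
1/(2ε)`. For `ε` below the threshold, `1/(2ε)` pays for `log κ / log m` and one further step; above
it `log κ / log m` is added by hand. Only for `ε ≥ 1/2` is the fourth step missing, and then `|β p|
≥ √n` compensates. -/
lemma arrivalTime_le {m n T : ℕ} (hm : 2 ≤ m) {κ ε B : ℝ} (hn : 2 ≤ n) (hε : 0 < ε)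
    (hB : (n : ℝ) ^ ε ≤ B) (hT : iterTime (m + 1) n ε B ≤ T)
    (hT' : epsThreshold (m + 1) κ < ε →
      iterTime (m + 1) n ε B + Real.log κ / Real.log (((m + 1 : ℕ) : ℝ) - 1) ≤ T) :
    arrivalTime m n κ B + 4 ≤ T ∨ (1 / 2 ≤ ε ∧ arrivalTime m n κ B + 3 ≤ T) := by
  have hcast : (((m + 1 : ℕ) : ℝ) - 1) = m := by push_cast; ring
  have hn0 : (0 : ℝ) < n := by positivity
  have hlogn : 0 < Real.log n := Real.log_pos (by exact_mod_cast (by omega : 1 < n))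
  have hlogm : 0 < Real.log m := Real.log_pos (by exact_mod_cast (by omega : 1 < m))
  have hlogB : ε * Real.log n ≤ Real.log B := by
    rw [← Real.log_rpow hn0]
    exact Real.log_le_log (Real.rpow_pos_of_pos hn0 _) hB
  have h1 : 3 + 1 / (2 * ε) + Real.log (Real.log (√n * B)) / Real.log m ≤
      iterTime (m + 1) n ε B := by
    rw [iterTime, hcast]
    have h2 : ε ≤ Real.log B / Real.log n := by rw [le_div_iff₀ hlogn]; exact hlogB
    have h3 : 1 / ε * (1 / 2 + 2 * ε) ≤ 1 / ε * (1 / 2 + 2 * Real.log B / Real.log n) := by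
      rw [mul_div_assoc]; gcongr
    have h4 : 1 / ε * (1 / 2 + 2 * ε) = 1 / (2 * ε) + 2 := by field_simp
    linarith
  rw [hcast] at hT'
  rw [arrivalTime, add_div]
  by_cases hc : epsThreshold (m + 1) κ < ε
  · have h2 := hT' hc
    by_cases hε2 : 1 / 2 ≤ ε
    · right
      have : 0 < 1 / (2 * ε) := by positivity
      exact ⟨hε2, by linarith⟩
    · left
      have : 1 ≤ 1 / (2 * ε) := by rw [le_div_iff₀ (by positivity)]; linarith
      linarith
  · left
    have h2 : |Real.log κ| / Real.log m + 1 ≤ 1 / (2 * ε) := by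
      rw [not_lt, epsThreshold, hcast, le_div_iff₀ (by positivity)] at hc
      rw [le_div_iff₀ (by positivity)]
      linarith
    have h3 : Real.log κ / Real.log m ≤ |Real.log κ| / Real.log m := by
      gcongr; exact le_abs_self _
    linarith

/-- `arrivalTime` solves `m ^ t = κ log (√n B)`. -/
lemma exp_pow_le_of_arrivalTime_le {m n t : ℕ} (hm : 2 ≤ m) {κ B : ℝ} (hκ : 0 < κ)
    (hB : 1 < √n * B) (ht : arrivalTime m n κ B ≤ t) :
    Real.exp (-(1 / κ)) ^ m ^ t ≤ 1 / (√n * B) := by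
  have hlogm : 0 < Real.log m := Real.log_pos (by exact_mod_cast (by omega : 1 < m))
  have hm0 : (0 : ℝ) < m := by positivity
  have hlog : 0 < Real.log (√n * B) := Real.log_pos hB
  have hpos : 0 < √n * B := by linarith
  have h1 : Real.log (√n * B) * κ ≤ (m : ℝ) ^ t := by
    rw [arrivalTime, div_le_iff₀ hlogm, ← Real.log_mul hlog.ne' hκ.ne', ← Real.log_pow,
      Real.log_le_log_iff (by positivity) (by positivity)] at ht
    exact ht
  rw [← Real.exp_nat_mul, one_div (√n * B), ← Real.exp_log (inv_pos.2 hpos), Real.log_inv,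
    Real.exp_le_exp]
  push_cast
  have : Real.log (√n * B) ≤ (m : ℝ) ^ t * (1 / κ) := by
    rw [mul_one_div, le_div_iff₀ hκ]; exact h1
  linarith

lemma eventually_le_arrivalTime {m : ℕ} (hm : 2 ≤ m) {κ ε : ℝ} (hκ : 1 ≤ κ) (hε : 0 < ε)
    (T₁ : ℕ) : ∀ᶠ n : ℕ in atTop, ∀ B, (n : ℝ) ^ ε ≤ B → T₁ ≤ arrivalTime m n κ B := by
  have hlogm : 0 < Real.log m := Real.log_pos (by exact_mod_cast (by omega : 1 < m))
  have h : Tendsto (fun n : ℕ => Real.log (Real.log √(n : ℝ)) / Real.log m) atTop atTop :=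
    ((Real.tendsto_log_atTop.comp (Real.tendsto_log_atTop.comp tendsto_sqrt_natCast)).atTop_div_const
      hlogm)
  filter_upwards [h.eventually_ge_atTop T₁, tendsto_sqrt_natCast.eventually_gt_atTop 1,
    eventually_ge_atTop 1] with n hn hn1 hn2 B hB
  refine hn.trans ?_
  have hB1 : 1 ≤ B := (Real.one_le_rpow (by exact_mod_cast hn2) hε.le).trans hB
  have h1 : 0 < Real.log √(n : ℝ) := Real.log_pos hn1
  have h2 : 0 ≤ Real.log κ := Real.log_nonneg hκ
  have h3 : Real.log (Real.log √(n : ℝ)) ≤ Real.log (Real.log (√n * B)) := by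
    refine Real.log_le_log h1 (Real.log_le_log (by linarith) ?_)
    exact le_mul_of_one_le_right (by linarith) hB1
  rw [arrivalTime]
  gcongr
  linarith

/-! ### Arrival near the signal -/

section Arrival

variable {E : Type*} [NormedAddCommGroup E] [InnerProductSpace ℝ E] {r : ℕ}
  {β : Fin r → ℝ} {v : Fin r → E} {m : ℕ} {A : E → E} {p : Fin r} {u : E}
  {κ σ θ s s' K Λ G η : ℝ} {T₁ : ℕ}

/-- The overlaps are so small at the time `T₁` that they continue to decay superexponentially. -/
structure LateHyp (m : ℕ) (κ θ s : ℝ) (T₁ : ℕ) : Prop where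
  four_le_one : 4 * s ≤ 1
  four_le : 4 * s ≤ κ * θ ^ geomExp m T₁
  eight_le : 2 * κ ^ (m - 1) * (4 * s) ≤ θ ^ m ^ T₁

lemma exists_lateHyp (m : ℕ) {κ θ : ℝ} (hκ : 1 ≤ κ) (hθ : 0 < θ) (T₁ : ℕ) {s₀ : ℝ}
    (hs₀ : 0 < s₀) : ∃ s, 0 < s ∧ s ≤ s₀ ∧ LateHyp m κ θ s T₁ := by
  have hκ0 : 0 < κ := by linarith
  set s := min (min s₀ (1 / 4))
    (min (κ * θ ^ geomExp m T₁ / 4) (θ ^ m ^ T₁ / (8 * κ ^ (m - 1)))) with hs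
  refine ⟨s, by positivity, (min_le_left _ _).trans (min_le_left _ _), ?_, ?_, ?_⟩
  · have : s ≤ 1 / 4 := (min_le_left _ _).trans (min_le_right _ _)
    linarith
  · have : s ≤ κ * θ ^ geomExp m T₁ / 4 := (min_le_right _ _).trans (min_le_left _ _)
    linarith
  · have : s ≤ θ ^ m ^ T₁ / (8 * κ ^ (m - 1)) := (min_le_right _ _).trans (min_le_right _ _)
    rw [le_div_iff₀ (by positivity)] at this
    linarith

/-- With `s` this small, having dropped below the noise level `4 s` already implies the ideal decay
at time `T₁`. Thus the recursion can be restarted there with the lower level of `decay_late`. -/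
lemma fastDecay_of_le (hm : 2 ≤ m) (hS : SignalBound m κ β v p u) (hR : RecursionBound m κ σ θ s)
    (hL : LateHyp m κ θ s T₁) {h : ℝ} (hh : 0 ≤ h) {j : Fin r} (hj : j ≠ p)
    (hd : FastDecay m |β j / β p| κ σ θ T₁ h ∨ h ≤ 4 * s) :
    FastDecay m |β j / β p| κ σ θ T₁ h := by
  rcases hd with hd | hd
  · exact hd
  · refine ⟨hd.trans hL.four_le, le_trans ?_ hL.eight_le⟩
    have h1 : h ^ (m - 1) ≤ 4 * s :=
      (pow_le_of_le_one hh (hd.trans hL.four_le_one) (by omega)).trans hd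
    have h2 := hS.ratio j hj
    have h3 := hR.le_two
    have h4 : 0 ≤ h ^ (m - 1) := by positivity
    have h5 : 0 ≤ κ ^ (m - 1) := (abs_nonneg _).trans h2
    calc σ * |β j / β p| * h ^ (m - 1) ≤ 2 * κ ^ (m - 1) * (4 * s) := by gcongr

/-- After the arrival time the distance to the signal is of order `1 / |β p|`. -/
lemma norm_chart_le_of_arrival (hm : 2 ≤ m) (hS : SignalBound m κ β v p u)
    (hR : RecursionBound m κ σ θ s) (hR' : RecursionBound m κ σ θ s') (h4s : 4 * s' ≤ 1)
    (hL : LateHyp m κ θ s T₁) (hH : TrajHyp m κ s K Λ G η T₁ β v p A u)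
    (hs' : s' ^ 2 = K / (reach r κ ^ m * |β p|)) {t : ℕ} (ht : T₁ ≤ t)
    (harr : θ ^ m ^ t ≤ 1 / |β p|) :
    ‖chart (v p) (normIter (drift β v m A) u (t + 1))‖ ≤
      2 * (r * (κ + 16 * κ ^ (m - 1) * (K / reach r κ ^ m)) + K / reach r κ ^ m) / |β p| := by
  have hm1 : 1 ≤ m := by omega
  have hκ : 0 ≤ κ := by linarith [hS.one_le]
  have hc := reach_pos (r := r) hS.one_le
  have hβ : 0 < |β p| := abs_pos.2 hS.ne_zero
  have hK := hH.K_pos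
  have hI := trajInv hm1 hS hR hH
  have hlate := decay_late hm1 hS hR hR' hH le_rfl
    (by rw [hs', div_mul_cancel₀ _ (by positivity)])
    (fun j hj => fastDecay_of_le hm hS hR hL (abs_nonneg _) hj ((hI T₁).decay j hj)) t ht
  refine ((hI t).norm_chart_succ_le hm1 hS hR hH ht).trans ?_
  set h := chart (v p) (normIter (drift β v m A) u t) with hdef
  have hs0 := hR'.nonneg
  have hterm : ∀ j, j ≠ p → |β j / β p| * |(⟪v j, h⟫ : ℝ)| ^ m ≤
      (κ + 16 * κ ^ (m - 1) * (K / reach r κ ^ m)) / |β p| := by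
    intro j hj
    rw [add_div]
    rcases hlate j hj with hd | hd
    · have h1 := hd.mul_le hm1 hR (abs_nonneg _) (abs_nonneg _)
      have h2 := hd.le hR hκ
      calc _ ≤ _ := h1
        _ ≤ 1 / |β p| * κ := by gcongr
        _ = κ / |β p| := by ring
        _ ≤ _ := le_add_of_nonneg_right (by positivity)
    -- The level `s'` is only of order `|β p|^(-1/2)`; the power `m ≥ 2` turns it into `1 / |β p|`.
    · calc |β j / β p| * |(⟪v j, h⟫ : ℝ)| ^ m ≤ κ ^ (m - 1) * (4 * s') ^ m := by
            gcongr; exact hS.ratio j hj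
        _ ≤ κ ^ (m - 1) * (4 * s') ^ 2 := by
            gcongr κ ^ (m - 1) * ?_
            exact pow_le_pow_of_le_one (by positivity) h4s hm
        _ = 16 * κ ^ (m - 1) * (K / reach r κ ^ m) / |β p| := by
            rw [mul_pow, hs', ← div_div]; ring
        _ ≤ _ := le_add_of_nonneg_left (by positivity)
  have hsum : rivalSum β v p m h ≤
      r * ((κ + 16 * κ ^ (m - 1) * (K / reach r κ ^ m)) / |β p|) := by
    calc rivalSum β v p m h ≤ ∑ j ∈ Finset.univ.erase p,
          (κ + 16 * κ ^ (m - 1) * (K / reach r κ ^ m)) / |β p| :=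
          Finset.sum_le_sum fun j hj => hterm j (Finset.ne_of_mem_erase hj)
      _ ≤ ∑ _j : Fin r, (κ + 16 * κ ^ (m - 1) * (K / reach r κ ^ m)) / |β p| :=
          Finset.sum_le_sum_of_subset_of_nonneg (Finset.erase_subset _ _)
            fun _ _ _ => by positivity
      _ = _ := by rw [Finset.sum_const, Finset.card_univ, Fintype.card_fin, nsmul_eq_mul]
  calc _ ≤ 2 * (r * ((κ + 16 * κ ^ (m - 1) * (K / reach r κ ^ m)) / |β p|) +
        K / (reach r κ ^ m * |β p|)) := by gcongr
    _ = _ := by rw [← div_div]; ring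

/-- The contraction of a small ball around the signal. -/
lemma contractionHyp_of_large {K Q C : ℝ} (hm : 2 ≤ m) (hS : SignalBound m κ β v p u)
    (hA : NoiseBound A K) (hQ : Q = κ ^ (m - 1) * m) (hC : 4 * K ≤ C)
    (hβ : 8 * (1 + Q) * (1 + C) ≤ |β p|) :
    ContractionHyp m K (Q * (C / |β p|)) (C / |β p|) (4 * (Q + 1) * C / |β p|) β v p A := by
  have hK := hA.nonneg
  have hC0 : 0 ≤ C := by linarith
  have hQ0 : 0 ≤ Q := by rw [hQ]; have := hS.one_le; positivity
  have hβ0 : 0 < |β p| := abs_pos.2 hS.ne_zero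
  have hCβ : C / |β p| ≤ 1 := by rw [div_le_one hβ0]; nlinarith
  have hKβ : K / |β p| ≤ C / |β p| / 4 := by
    rw [div_div, mul_comm, ← div_div]; gcongr; linarith
  have hK8 : C / |β p| ≤ 1 / 8 := by rw [div_le_iff₀ hβ0]; nlinarith
  have hCβ0 : 0 ≤ C / |β p| := by positivity
  have hl : 4 * (Q + 1) * C / |β p| ≤ 1 / 2 := by rw [div_le_iff₀ hβ0]; nlinarith
  refine ⟨hS.orthonormal, by omega, hS.ne_zero, hA, by linarith, by positivity, hCβ0, hCβ, ?_, ?_,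
    by linarith, by nlinarith⟩
  · intro j hj
    have h1 : (C / |β p|) ^ (m - 1) ≤ C / |β p| := pow_le_of_le_one hCβ0 hCβ (by omega)
    calc |β j / β p| * (m * (C / |β p|) ^ (m - 1)) ≤ κ ^ (m - 1) * (m * (C / |β p|)) := by
          have := hS.one_le
          gcongr; exact hS.ratio j hj
      _ = _ := by rw [hQ]; ring
  · rw [div_le_iff₀ (by have : 0 < 1 - K / |β p| := by linarith
                        positivity)]
    have e : 4 * (Q + 1) * C / |β p| = 4 * (Q + 1) * (C / |β p|) := by ring
    rw [e]
    have h1 : 1 / 2 ≤ (1 - K / |β p|) ^ 2 := by nlinarith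
    have h2 : 0 ≤ (Q + 1) * (C / |β p|) := by positivity
    nlinarith

end Arrival

/-! ### First order expansion of the fixed point -/

section Scalar

/-- Second order expansion of `(1 + x) ^ (-1/2)`, with `y = √(1 + x)`. -/
lemma abs_inv_sub_le {y x : ℝ} (hy : 1 ≤ y) (hx : y ^ 2 = 1 + x) :
    |y⁻¹ - (1 - x / 2)| ≤ x ^ 2 := by
  have hy0 : 0 < y := by linarith
  have e : y⁻¹ - (1 - x / 2) = (y - 1) ^ 2 * ((y + 2) / (2 * y)) := by
    have : x = y ^ 2 - 1 := by linarith
    rw [this]; field_simp; ring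
  have h1 : (y + 2) / (2 * y) ≤ 3 / 2 := by rw [div_le_iff₀ (by positivity)]; linarith
  have h2 : 0 ≤ (y + 2) / (2 * y) := by positivity
  have h3 : 2 * (y - 1) ≤ x := by nlinarith [sq_nonneg (y - 1)]
  rw [e, abs_of_nonneg (by positivity)]
  have h4 : (y - 1) ^ 2 * ((y + 2) / (2 * y)) ≤ (y - 1) ^ 2 * (3 / 2) := by gcongr
  nlinarith

lemma one_sub_pow_le {d : ℝ} (h0 : 0 ≤ d) (h1 : d ≤ 1) (k : ℕ) :
    |(1 - d) ^ k - (1 - k * d)| ≤ k ^ 2 * d ^ 2 := by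
  have hlow : 0 ≤ (1 - d) ^ k - (1 - k * d) := by
    have := one_add_mul_le_pow (a := -d) (by linarith) k
    rw [← sub_eq_add_neg] at this
    linarith
  rw [abs_of_nonneg hlow]
  clear hlow
  induction k with
  | zero => simp
  | succ k ih =>
    have h2 : (1 - d) ^ k * (1 - d) ≤ (1 - k * d + k ^ 2 * d ^ 2) * (1 - d) :=
      mul_le_mul_of_nonneg_right (by linarith) (by linarith)
    rw [pow_succ]
    push_cast
    have h3 : 0 ≤ (k : ℝ) ^ 2 * d ^ 3 := by positivity
    have h4 : 0 ≤ (k : ℝ) * d ^ 2 := by positivity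
    nlinarith [sq_nonneg d]

end Scalar

/-! ### Expansion of a vector given to first order by Gaussian noise -/

section Core

variable {E : Type*} [NormedAddCommGroup E] [InnerProductSpace ℝ E]

/-- The rate of the first order expansion of the estimated direction. -/
def coreRate (β μ : ℝ) : ℝ := μ / |β| ^ 2 + 1 / |β| ^ 4

/-- A vector `h` which to first order is the component of `(ξ + w) / β` orthogonal to `e`, where `ξ`
looks like Gaussian noise and `w` is a smaller perturbation. -/
structure CoreHyp (e ξ w h : E) (β μ M : ℝ) : Prop where
  unit : ‖e‖ = 1
  one_le : 1 ≤ |β|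
  nonneg : 0 ≤ μ
  le_one : μ ≤ 1
  one_le_M : 1 ≤ M
  inner_le : |(⟪e, ξ⟫ : ℝ)| ≤ M * μ
  norm_sq : |‖ξ‖ ^ 2 - 1| ≤ M * μ
  inner_w : |(⟪e, w⟫ : ℝ)| ≤ M * μ / |β|
  inner_ξw : |(⟪ξ, w⟫ : ℝ)| ≤ M * μ / |β|
  norm_w : ‖w‖ ≤ M / |β|
  approx : ‖h - β⁻¹ • (ξ + w - (⟪e, ξ + w⟫ : ℝ) • e)‖ ≤ M * coreRate β μ

lemma inner_lead (e ξ w a : E) (β : ℝ) : (⟪a, β⁻¹ • (ξ + w - (⟪e, ξ + w⟫ : ℝ) • e)⟫ : ℝ) =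
    β⁻¹ * (⟪a, ξ⟫ + ⟪a, w⟫ - (⟪e, ξ⟫ + ⟪e, w⟫) * ⟪a, e⟫) := by
  rw [real_inner_smul_right, inner_sub_right, real_inner_smul_right, inner_add_right,
    inner_add_right]

namespace CoreHyp

variable {e ξ w h : E} {β μ M : ℝ} (H : CoreHyp e ξ w h β μ M)
include H

lemma abs_pos' : 0 < |β| := by linarith [H.one_le]

lemma ne_zero : β ≠ 0 := abs_pos.1 H.abs_pos'

lemma inv_le_one : |β|⁻¹ ≤ 1 := inv_le_one_of_one_le₀ H.one_le

lemma coreRate_nonneg : 0 ≤ coreRate β μ := by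
  have := H.nonneg
  unfold coreRate; positivity

lemma coreRate_le : coreRate β μ ≤ 2 * |β|⁻¹ ^ 2 := by
  have h0 := inv_nonneg.2 (abs_nonneg β)
  have h1 : coreRate β μ = μ * |β|⁻¹ ^ 2 + |β|⁻¹ ^ 2 * |β|⁻¹ ^ 2 := by
    unfold coreRate; rw [div_eq_mul_inv, one_div, inv_pow, ← mul_inv, ← pow_add]
  have h2 : |β|⁻¹ ^ 2 ≤ 1 := pow_le_one₀ h0 H.inv_le_one
  have h3 := H.le_one
  have h4 : 0 ≤ |β|⁻¹ ^ 2 := by positivity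
  rw [h1]
  nlinarith

lemma inv_sq_le : μ * |β|⁻¹ ^ 2 ≤ coreRate β μ ∧ |β|⁻¹ ^ 4 ≤ coreRate β μ := by
  have h1 : coreRate β μ = μ * |β|⁻¹ ^ 2 + |β|⁻¹ ^ 4 := by
    unfold coreRate; rw [div_eq_mul_inv, one_div, inv_pow, inv_pow]
  have := H.nonneg
  rw [h1]
  constructor
  · exact le_add_of_nonneg_right (by positivity)
  · exact le_add_of_nonneg_left (by positivity)

lemma abs_inner_sub_le {a : E} (ha : ‖a‖ = 1) (haw : |(⟪a, w⟫ : ℝ)| ≤ M * μ / |β|) :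
    |(⟪a, h⟫ : ℝ) - β⁻¹ * (⟪a, ξ⟫ - ⟪a, e⟫ * ⟪e, ξ⟫)| ≤ 3 * M * coreRate β μ := by
  set ρ := h - β⁻¹ • (ξ + w - (⟪e, ξ + w⟫ : ℝ) • e) with hρ
  have e1 : (⟪a, h⟫ : ℝ) - β⁻¹ * (⟪a, ξ⟫ - ⟪a, e⟫ * ⟪e, ξ⟫) =
      β⁻¹ * (⟪a, w⟫ - ⟪e, w⟫ * ⟪a, e⟫) + ⟪a, ρ⟫ := by
    rw [hρ, inner_sub_right, inner_lead e ξ w a]; ring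
  have h1 : |(⟪a, ρ⟫ : ℝ)| ≤ M * coreRate β μ := (abs_inner_unit_le ha).trans H.approx
  have h2 : |(⟪a, e⟫ : ℝ)| ≤ 1 := (abs_inner_unit_le ha).trans H.unit.le
  have h3 : |(⟪e, w⟫ : ℝ) * ⟪a, e⟫| ≤ M * μ / |β| := by
    rw [abs_mul]
    calc _ ≤ M * μ / |β| * 1 := by
          have := H.inner_w
          gcongr
          exact (abs_nonneg _).trans this
      _ = _ := mul_one _
  have h4 : |β⁻¹ * (⟪a, w⟫ - ⟪e, w⟫ * ⟪a, e⟫ : ℝ)| ≤ 2 * M * (μ * |β|⁻¹ ^ 2) := by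
    rw [abs_mul, abs_inv]
    calc _ ≤ |β|⁻¹ * (M * μ / |β| + M * μ / |β|) := by
          gcongr
          exact (abs_sub _ _).trans (add_le_add haw h3)
      _ = _ := by rw [div_eq_mul_inv]; ring
  have h5 := H.inv_sq_le.1
  rw [e1]
  refine (abs_add_le _ _).trans ?_
  have hM := H.one_le_M
  nlinarith

/-- `‖ξ‖²` is `1` up to `O(μ)` and the cross term `⟪ξ, w⟫` is no larger. Only `‖w‖²` is not
proportional to `μ`; after division by `β²` it produces the `1 / β⁴` of the rate. -/
lemma norm_lead : |‖β⁻¹ • (ξ + w - (⟪e, ξ + w⟫ : ℝ) • e)‖ ^ 2 - |β|⁻¹ ^ 2| ≤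
    7 * M ^ 2 * coreRate β μ := by
  have hM := H.one_le_M
  have hμ := H.nonneg
  have hμ1 := H.le_one
  have hi := H.inv_le_one
  have hi0 := inv_nonneg.2 (abs_nonneg β)
  set x := |β|⁻¹ with hx
  have ew : |(⟪e, w⟫ : ℝ)| ≤ M * μ * x := H.inner_w
  have eξw : |(⟪ξ, w⟫ : ℝ)| ≤ M * μ * x := H.inner_ξw
  have nw : ‖w‖ ≤ M * x := H.norm_w
  have e1 : ‖β⁻¹ • (ξ + w - (⟪e, ξ + w⟫ : ℝ) • e)‖ ^ 2 - x ^ 2 =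
      x ^ 2 * ((‖ξ‖ ^ 2 - 1) + 2 * ⟪ξ, w⟫ + ‖w‖ ^ 2 - (⟪e, ξ⟫ + ⟪e, w⟫) ^ 2) := by
    rw [norm_smul, norm_inv, Real.norm_eq_abs, ← hx, mul_pow, norm_sub_sq_real, norm_add_sq_real,
      norm_smul, H.unit, real_inner_smul_right, real_inner_comm e (ξ + w), Real.norm_eq_abs,
      mul_one, sq_abs, inner_add_right]
    ring
  have h1 : |(‖ξ‖ ^ 2 - 1) + 2 * ⟪ξ, w⟫ + ‖w‖ ^ 2 - (⟪e, ξ⟫ + ⟪e, w⟫) ^ 2| ≤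
      7 * M ^ 2 * (μ + x ^ 2) := by
    have a1 := H.norm_sq
    have a2 : |2 * (⟪ξ, w⟫ : ℝ)| ≤ 2 * (M * μ) := by
      rw [abs_mul, abs_two]
      have : M * μ * x ≤ M * μ := mul_le_of_le_one_right (by positivity) hi
      linarith
    have a3 : |‖w‖ ^ 2| ≤ M ^ 2 * x ^ 2 := by
      rw [abs_of_nonneg (by positivity), ← mul_pow]; gcongr
    have a4 : |((⟪e, ξ⟫ : ℝ) + ⟪e, w⟫) ^ 2| ≤ 4 * M ^ 2 * μ := by
      rw [abs_pow]
      have : |(⟪e, ξ⟫ : ℝ) + ⟪e, w⟫| ≤ 2 * M * μ := by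
        refine (abs_add_le _ _).trans ?_
        have : M * μ * x ≤ M * μ := mul_le_of_le_one_right (by positivity) hi
        linarith [H.inner_le]
      calc _ ≤ (2 * M * μ) ^ 2 := by gcongr
        _ = 4 * M ^ 2 * (μ * μ) := by ring
        _ ≤ 4 * M ^ 2 * (μ * 1) := by gcongr
        _ = _ := by ring
    have a5 : M * μ ≤ M ^ 2 * μ := by gcongr; nlinarith
    refine (abs_sub _ _).trans ((add_le_add ((abs_add_le _ _).trans (add_le_add
      ((abs_add_le _ _).trans (add_le_add a1 a2)) a3)) a4).trans ?_)
    have : 0 ≤ M ^ 2 * x ^ 2 := by positivity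
    linarith
  rw [e1, abs_mul, abs_of_nonneg (by positivity : 0 ≤ x ^ 2)]
  calc _ ≤ x ^ 2 * (7 * M ^ 2 * (μ + x ^ 2)) := by gcongr
    _ = 7 * M ^ 2 * coreRate β μ := by
      unfold coreRate; rw [div_eq_mul_inv, one_div, ← inv_pow, ← inv_pow]; ring

lemma norm_lead_le : ‖β⁻¹ • (ξ + w - (⟪e, ξ + w⟫ : ℝ) • e)‖ ≤ 4 * M * |β|⁻¹ := by
  have h1 := (abs_le.1 H.norm_lead).2
  have h2 := H.coreRate_le
  have hM := H.one_le_M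
  have h3 : 0 ≤ |β|⁻¹ := inv_nonneg.2 (abs_nonneg β)
  refine le_of_sq_le_sq ?_ (by positivity)
  have h4 : 7 * M ^ 2 * coreRate β μ ≤ 7 * M ^ 2 * (2 * |β|⁻¹ ^ 2) := by gcongr
  have h5 : |β|⁻¹ ^ 2 ≤ M ^ 2 * |β|⁻¹ ^ 2 := le_mul_of_one_le_left (by positivity) (one_le_pow₀ hM)
  have h6 : 0 ≤ M ^ 2 * |β|⁻¹ ^ 2 := by positivity
  linarith [mul_pow (4 * M) |β|⁻¹ 2, mul_pow 4 M 2]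

lemma norm_le : ‖h‖ ≤ 6 * M * |β|⁻¹ := by
  have h1 := norm_add_le (h - β⁻¹ • (ξ + w - (⟪e, ξ + w⟫ : ℝ) • e))
    (β⁻¹ • (ξ + w - (⟪e, ξ + w⟫ : ℝ) • e))
  rw [sub_add_cancel] at h1
  have h2 : coreRate β μ ≤ 2 * |β|⁻¹ := by
    have h3 := H.coreRate_le
    have h4 : |β|⁻¹ ^ 2 ≤ |β|⁻¹ :=
      pow_le_of_le_one (inv_nonneg.2 (abs_nonneg β)) H.inv_le_one two_ne_zero
    linarith
  have hM := H.one_le_M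
  have h3 : M * coreRate β μ ≤ M * (2 * |β|⁻¹) := by gcongr
  linarith [H.approx, H.norm_lead_le]

lemma norm_sq_sub_le : |‖h‖ ^ 2 - |β|⁻¹ ^ 2| ≤ 17 * M ^ 2 * coreRate β μ := by
  have hM := H.one_le_M
  set X := β⁻¹ • (ξ + w - (⟪e, ξ + w⟫ : ℝ) • e) with hX
  have h1 : |‖X‖ ^ 2 - |β|⁻¹ ^ 2| ≤ 7 * M ^ 2 * coreRate β μ := H.norm_lead
  have h2 : |‖h‖ ^ 2 - ‖X‖ ^ 2| ≤ 10 * M ^ 2 * coreRate β μ := by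
    have e : ‖h‖ ^ 2 - ‖X‖ ^ 2 = (‖h‖ - ‖X‖) * (‖h‖ + ‖X‖) := by ring
    rw [e, abs_mul, abs_of_nonneg (by positivity : 0 ≤ ‖h‖ + ‖X‖)]
    have h3 : |‖h‖ - ‖X‖| ≤ M * coreRate β μ := (abs_norm_sub_norm_le _ _).trans H.approx
    have h4 : ‖h‖ + ‖X‖ ≤ 10 * M := by
      have h5 : ‖X‖ ≤ 4 * M * |β|⁻¹ := H.norm_lead_le
      have h6 := H.norm_le
      have h7 : M * |β|⁻¹ ≤ M := mul_le_of_le_one_right (by linarith) H.inv_le_one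
      linarith
    have h5 := H.coreRate_nonneg
    calc _ ≤ (M * coreRate β μ) * (10 * M) := by gcongr
      _ = _ := by ring
  have := abs_add_le (‖h‖ ^ 2 - ‖X‖ ^ 2) (‖X‖ ^ 2 - |β|⁻¹ ^ 2)
  rw [sub_add_sub_cancel] at this
  linarith

/-- The rate of the first order expansion of the estimated strength. -/
lemma coreRate_le_mul : coreRate β μ ≤ |β| * coreRate β μ :=
  le_mul_of_one_le_left H.coreRate_nonneg H.one_le

lemma mul_coreRate : |β| * coreRate β μ = μ * |β|⁻¹ + |β|⁻¹ ^ 3 := by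
  have := H.abs_pos'.ne'
  unfold coreRate
  field_simp

/-- `h` is essentially the part of `ξ / β` orthogonal to `e` and `‖ξ‖² ≈ 1`; this correlation with
the noise is the source of the deterministic bias `1 / β`. -/
lemma abs_inner_ξ_sub_le : |(⟪h, ξ⟫ : ℝ) - β⁻¹| ≤ 6 * M ^ 2 * (|β| * coreRate β μ) := by
  have hM := H.one_le_M
  have hμ := H.nonneg
  have hμ1 := H.le_one
  have hi := H.inv_le_one
  have hi0 := inv_nonneg.2 (abs_nonneg β)
  set ρ := h - β⁻¹ • (ξ + w - (⟪e, ξ + w⟫ : ℝ) • e) with hρ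
  have e1 : (⟪h, ξ⟫ : ℝ) - β⁻¹ = β⁻¹ * ((‖ξ‖ ^ 2 - 1) + ⟪ξ, w⟫ - (⟪e, ξ⟫ + ⟪e, w⟫) * ⟪e, ξ⟫) +
      ⟪ρ, ξ⟫ := by
    rw [real_inner_comm, real_inner_comm ξ ρ, hρ, inner_sub_right, inner_lead e ξ w ξ,
      real_inner_self_eq_norm_sq, real_inner_comm ξ e]
    ring
  set x := |β|⁻¹ with hx
  have ew : |(⟪e, w⟫ : ℝ)| ≤ M * μ := H.inner_w.trans (by
    rw [div_eq_mul_inv]; exact mul_le_of_le_one_right (by positivity) hi)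
  have eξw : |(⟪ξ, w⟫ : ℝ)| ≤ M * μ := H.inner_ξw.trans (by
    rw [div_eq_mul_inv]; exact mul_le_of_le_one_right (by positivity) hi)
  have hξ : ‖ξ‖ ≤ 2 * M := by
    refine le_of_sq_le_sq ?_ (by positivity)
    have := (abs_le.1 H.norm_sq).2
    nlinarith
  have a1 : |(⟪ρ, ξ⟫ : ℝ)| ≤ 2 * M ^ 2 * (|β| * coreRate β μ) := by
    refine (abs_real_inner_le_norm _ _).trans ?_
    have := H.coreRate_nonneg
    calc ‖ρ‖ * ‖ξ‖ ≤ (M * coreRate β μ) * (2 * M) := by gcongr; exact H.approx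
      _ = 2 * M ^ 2 * coreRate β μ := by ring
      _ ≤ _ := by gcongr; exact H.coreRate_le_mul
  have a2 : |((⟪e, ξ⟫ : ℝ) + ⟪e, w⟫) * ⟪e, ξ⟫| ≤ 2 * M ^ 2 * μ := by
    rw [abs_mul]
    calc _ ≤ (M * μ + M * μ) * (M * μ) := by
          gcongr
          · exact (abs_add_le _ _).trans (add_le_add H.inner_le ew)
          · exact H.inner_le
      _ = 2 * M ^ 2 * (μ * μ) := by ring
      _ ≤ 2 * M ^ 2 * (μ * 1) := by gcongr
      _ = _ := by ring
  have a3 : M * μ ≤ M ^ 2 * μ := by gcongr; nlinarith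
  have a4 : |β⁻¹ * ((‖ξ‖ ^ 2 - 1) + ⟪ξ, w⟫ - (⟪e, ξ⟫ + ⟪e, w⟫) * ⟪e, ξ⟫)| ≤
      4 * M ^ 2 * (|β| * coreRate β μ) := by
    rw [abs_mul, abs_inv, H.mul_coreRate]
    calc _ ≤ x * (M * μ + M * μ + 2 * M ^ 2 * μ) := by
          gcongr
          exact (abs_sub _ _).trans (add_le_add ((abs_add_le _ _).trans
            (add_le_add H.norm_sq eξw)) a2)
      _ ≤ x * (4 * M ^ 2 * μ) := by gcongr; linarith
      _ = 4 * M ^ 2 * (μ * x) := by ring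
      _ ≤ _ := by gcongr; exact le_add_of_nonneg_right (by positivity)
  rw [e1]
  refine (abs_add_le _ _).trans ?_
  linarith

/-- Cauchy-Schwarz would only give `1 / β²`. Inserting the leading form of `h` shows that the main
contribution is `⟪ξ, w'⟫ / β`, small by near orthogonality, while `⟪w, w'⟫ / β` is of order `1 /
|β|³`. -/
lemma abs_inner_pert_le {w' : E} (hw' : ‖w'‖ ≤ M / |β|) (hew' : |(⟪e, w'⟫ : ℝ)| ≤ M * μ / |β|)
    (hξw' : |(⟪ξ, w'⟫ : ℝ)| ≤ M * μ / |β|) :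
    |(⟪h, w'⟫ : ℝ)| ≤ 5 * M ^ 2 * (|β| * coreRate β μ) := by
  have hM := H.one_le_M
  have hμ := H.nonneg
  have hμ1 := H.le_one
  have hi := H.inv_le_one
  have hi0 := inv_nonneg.2 (abs_nonneg β)
  have hw := H.norm_w
  have hwe := H.inner_w
  rw [div_eq_mul_inv] at hw' hew' hξw' hw hwe
  set ρ := h - β⁻¹ • (ξ + w - (⟪e, ξ + w⟫ : ℝ) • e) with hρ
  have e1 : (⟪h, w'⟫ : ℝ) = β⁻¹ * (⟪ξ, w'⟫ + ⟪w, w'⟫ - (⟪e, ξ⟫ + ⟪e, w⟫) * ⟪e, w'⟫) +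
      ⟪ρ, w'⟫ := by
    rw [real_inner_comm, real_inner_comm w' ρ, hρ, inner_sub_right, inner_lead e ξ w w',
      real_inner_comm w' ξ, real_inner_comm w' w, real_inner_comm w' e]
    ring
  set x := |β|⁻¹ with hx
  have a1 : |(⟪ρ, w'⟫ : ℝ)| ≤ M ^ 2 * (|β| * coreRate β μ) := by
    refine (abs_real_inner_le_norm _ _).trans ?_
    have := H.coreRate_nonneg
    calc ‖ρ‖ * ‖w'‖ ≤ (M * coreRate β μ) * (M * 1) := by
          gcongr
          · exact H.approx
          · exact hw'.trans (by gcongr)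
      _ = M ^ 2 * coreRate β μ := by ring
      _ ≤ _ := by gcongr; exact H.coreRate_le_mul
  have a2 : |((⟪e, ξ⟫ : ℝ) + ⟪e, w⟫) * ⟪e, w'⟫| ≤ 2 * M ^ 2 * μ := by
    rw [abs_mul]
    calc _ ≤ (M * μ + M * μ * x) * (M * μ * x) := by
          gcongr
          exact (abs_add_le _ _).trans (add_le_add H.inner_le hwe)
      _ ≤ (M * 1 + M * 1 * 1) * (M * μ * 1) := by gcongr
      _ = 2 * M ^ 2 * μ := by ring
  have a3 : |(⟪ξ, w'⟫ : ℝ)| ≤ M ^ 2 * μ := by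
    refine hξw'.trans ?_
    calc M * μ * x ≤ M * μ * 1 := by gcongr
      _ ≤ M ^ 2 * μ := by rw [mul_one]; gcongr; nlinarith
  have a4 : |(⟪w, w'⟫ : ℝ)| ≤ M ^ 2 * x ^ 2 := by
    refine (abs_real_inner_le_norm _ _).trans ?_
    calc ‖w‖ * ‖w'‖ ≤ (M * x) * (M * x) := by gcongr
      _ = _ := by ring
  have a5 : |β⁻¹ * ((⟪ξ, w'⟫ : ℝ) + ⟪w, w'⟫ - (⟪e, ξ⟫ + ⟪e, w⟫) * ⟪e, w'⟫)| ≤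
      4 * M ^ 2 * (|β| * coreRate β μ) := by
    rw [abs_mul, abs_inv, H.mul_coreRate]
    calc _ ≤ x * (M ^ 2 * μ + M ^ 2 * x ^ 2 + 2 * M ^ 2 * μ) := by
          gcongr
          exact (abs_sub _ _).trans (add_le_add ((abs_add_le _ _).trans (add_le_add a3 a4)) a2)
      _ = M ^ 2 * (3 * (μ * x) + x ^ 3) := by ring
      _ ≤ M ^ 2 * (4 * (μ * x + x ^ 3)) := by
          have : 0 ≤ μ * x := by positivity
          have : 0 ≤ x ^ 3 := by positivity
          gcongr; linarith
      _ = _ := by ring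
  rw [e1]
  refine (abs_add_le _ _).trans ?_
  linarith

lemma abs_inner_noise_sub_le {y w' : E} (hw' : ‖w'‖ ≤ M / |β|)
    (hew' : |(⟪e, w'⟫ : ℝ)| ≤ M * μ / |β|) (hξw' : |(⟪ξ, w'⟫ : ℝ)| ≤ M * μ / |β|)
    (hy : ‖y - (ξ + w')‖ ≤ M * coreRate β μ) :
    |(⟪e + h, y⟫ : ℝ) - (⟪e, ξ⟫ + β⁻¹)| ≤ 19 * M ^ 2 * (|β| * coreRate β μ) := by
  have hM := H.one_le_M
  have hμ := H.nonneg
  have hi := H.inv_le_one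
  have hi0 := inv_nonneg.2 (abs_nonneg β)
  have e1 : (⟪e + h, y⟫ : ℝ) - (⟪e, ξ⟫ + β⁻¹) =
      ⟪e, w'⟫ + (⟪h, ξ⟫ - β⁻¹) + ⟪h, w'⟫ + ⟪e + h, y - (ξ + w')⟫ := by
    rw [inner_sub_right, inner_add_right, inner_add_left e h ξ, inner_add_left e h w']; ring
  have a1 : |(⟪e, w'⟫ : ℝ)| ≤ M ^ 2 * (|β| * coreRate β μ) := by
    refine hew'.trans ?_
    rw [H.mul_coreRate, div_eq_mul_inv, mul_assoc]
    have : 0 ≤ |β|⁻¹ ^ 3 := by positivity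
    have : M ≤ M ^ 2 := by nlinarith
    gcongr
    linarith
  have a2 : |(⟪e + h, y - (ξ + w')⟫ : ℝ)| ≤ 7 * M ^ 2 * (|β| * coreRate β μ) := by
    refine (abs_real_inner_le_norm _ _).trans ?_
    have h1 : ‖e + h‖ ≤ 7 * M := by
      refine (norm_add_le _ _).trans ?_
      have h2 := H.norm_le
      have h3 : M * |β|⁻¹ ≤ M := mul_le_of_le_one_right (by linarith) hi
      rw [H.unit]
      linarith
    have := H.coreRate_nonneg
    calc _ ≤ (7 * M) * (M * coreRate β μ) := by gcongr
      _ = 7 * M ^ 2 * coreRate β μ := by ring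
      _ ≤ _ := by gcongr; exact H.coreRate_le_mul
  rw [e1]
  refine (abs_add_le _ _).trans ?_
  refine (add_le_add_left ((abs_add_le _ _).trans
    (add_le_add_left (abs_add_le _ _) _)) _).trans ?_
  linarith [H.abs_inner_ξ_sub_le, H.abs_inner_pert_le hw' hew' hξw']

lemma norm_sq_le : ‖h‖ ^ 2 ≤ 36 * M ^ 2 * |β|⁻¹ ^ 2 := by
  calc ‖h‖ ^ 2 ≤ (6 * M * |β|⁻¹) ^ 2 := by gcongr; exact H.norm_le
    _ = _ := by ring

/-- The norm of `e + h` to second order. -/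
lemma abs_inv_norm_sub_le (hh : (⟪e, h⟫ : ℝ) = 0) :
    |‖e + h‖⁻¹ - (1 - |β|⁻¹ ^ 2 / 2)| ≤ 1305 * M ^ 4 * coreRate β μ ∧
      0 ≤ 1 - ‖e + h‖⁻¹ ∧ 1 - ‖e + h‖⁻¹ ≤ 18 * M ^ 2 * |β|⁻¹ ^ 2 := by
  have hM := H.one_le_M
  have hR := H.coreRate_nonneg
  have h1 := abs_inv_sub_le (one_le_norm_add H.unit hh) (norm_sq_add_of_inner_eq_zero H.unit hh)
  have h2 := H.norm_sq_sub_le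
  have h3 := H.norm_sq_le
  have hn := one_le_norm_add H.unit hh
  have h4 : (‖h‖ ^ 2) ^ 2 ≤ 1296 * M ^ 4 * coreRate β μ := by
    calc (‖h‖ ^ 2) ^ 2 ≤ (36 * M ^ 2 * |β|⁻¹ ^ 2) ^ 2 := by gcongr
      _ = 1296 * M ^ 4 * |β|⁻¹ ^ 4 := by ring
      _ ≤ _ := by gcongr; exact H.inv_sq_le.2
  refine ⟨?_, sub_nonneg.2 (inv_le_one_of_one_le₀ hn), ?_⟩
  · have e1 : ‖e + h‖⁻¹ - (1 - |β|⁻¹ ^ 2 / 2) = (‖e + h‖⁻¹ - (1 - ‖h‖ ^ 2 / 2)) +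
        -((‖h‖ ^ 2 - |β|⁻¹ ^ 2) / 2) := by ring
    rw [e1]
    refine (abs_add_le _ _).trans ?_
    rw [abs_neg, abs_div, abs_two]
    have h5 : 17 * M ^ 2 * coreRate β μ ≤ 17 * M ^ 4 * coreRate β μ := by
      gcongr 17 * ?_ * _
      exact pow_le_pow_right₀ hM (by norm_num)
    have h6 : 0 ≤ M ^ 4 * coreRate β μ := by positivity
    linarith
  · have h5 : 0 < ‖e + h‖ := by linarith
    have h6 := norm_add_le_one_add_sq H.unit hh
    have h7 : 1 - ‖e + h‖⁻¹ ≤ ‖h‖ ^ 2 / 2 := by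
      have h8 := norm_sq_add_of_inner_eq_zero H.unit hh
      have h9 : ‖e + h‖ * ‖e + h‖⁻¹ = 1 := mul_inv_cancel₀ h5.ne'
      have h10 : ‖e + h‖⁻¹ ≤ 1 := inv_le_one_of_one_le₀ hn
      have h11 : 0 ≤ 1 - ‖e + h‖⁻¹ := by linarith
      nlinarith [mul_nonneg h11 (by linarith : 0 ≤ ‖e + h‖ - 1), sq_nonneg (‖e + h‖ - 1)]
    linarith

/-- First order expansion of the direction. -/
theorem abs_inner_lift_sub_le (hh : (⟪e, h⟫ : ℝ) = 0) {a : E} (ha : ‖a‖ = 1)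
    (haw : |(⟪a, w⟫ : ℝ)| ≤ M * μ / |β|) (haξ : |(⟪a, ξ⟫ : ℝ)| ≤ M * μ) :
    |(⟪a, lift e h⟫ : ℝ) - ((1 - 1 / (2 * β ^ 2)) * ⟪a, e⟫ +
      (⟪a, ξ⟫ - ⟪a, e⟫ * ⟪e, ξ⟫) / β)| ≤ 1344 * M ^ 4 * coreRate β μ := by
  have hM := H.one_le_M
  have hμ := H.nonneg
  have hμ1 := H.le_one
  have hi := H.inv_le_one
  have hi0 := inv_nonneg.2 (abs_nonneg β)
  have hR := H.coreRate_nonneg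
  obtain ⟨h1, h2, h3⟩ := H.abs_inv_norm_sub_le hh
  have h4 := H.abs_inner_sub_le ha haw
  set f := ‖e + h‖⁻¹ with hf
  set ζ := β⁻¹ * ((⟪a, ξ⟫ : ℝ) - ⟪a, e⟫ * ⟪e, ξ⟫) with hζ
  have hf1 : |f| ≤ 1 := by
    rw [abs_of_nonneg (inv_nonneg.2 (norm_nonneg _))]; linarith
  have hae : |(⟪a, e⟫ : ℝ)| ≤ 1 := (abs_inner_unit_le ha).trans H.unit.le
  -- Splits the error into that of the normalization `f`, that of the first order term, and the
  -- product of `1 - f` with the first order term.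
  have e1 : (⟪a, lift e h⟫ : ℝ) - ((1 - 1 / (2 * β ^ 2)) * ⟪a, e⟫ +
      (⟪a, ξ⟫ - ⟪a, e⟫ * ⟪e, ξ⟫) / β) =
      (f - (1 - |β|⁻¹ ^ 2 / 2)) * ⟪a, e⟫ + f * (⟪a, h⟫ - ζ) + -((1 - f) * ζ) := by
    have : |β|⁻¹ ^ 2 / 2 = 1 / (2 * β ^ 2) := by
      rw [inv_pow, sq_abs, one_div, mul_inv]; ring
    rw [this, lift, real_inner_smul_right, inner_add_right, hζ, div_eq_inv_mul]
    ring
  have a1 : |(f - (1 - |β|⁻¹ ^ 2 / 2)) * (⟪a, e⟫ : ℝ)| ≤ 1305 * M ^ 4 * coreRate β μ := by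
    rw [abs_mul]
    calc _ ≤ (1305 * M ^ 4 * coreRate β μ) * 1 := by gcongr
      _ = _ := mul_one _
  have a2 : |f * (⟪a, h⟫ - ζ)| ≤ 3 * M ^ 4 * coreRate β μ := by
    rw [abs_mul]
    calc _ ≤ 1 * (3 * M * coreRate β μ) := by gcongr
      _ ≤ _ := by
        rw [one_mul]; gcongr; exact le_self_pow₀ hM (by norm_num)
  have hζ' : |ζ| ≤ 2 * M * μ * |β|⁻¹ := by
    rw [hζ, abs_mul, abs_inv]
    calc _ ≤ |β|⁻¹ * (M * μ + 1 * (M * μ)) := by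
          gcongr
          refine (abs_sub _ _).trans (add_le_add haξ ?_)
          rw [abs_mul]
          exact mul_le_mul hae H.inner_le (abs_nonneg _) zero_le_one
      _ = _ := by ring
  have a3 : |-((1 - f) * ζ)| ≤ 36 * M ^ 4 * coreRate β μ := by
    rw [abs_neg, abs_mul, abs_of_nonneg h2]
    calc _ ≤ (18 * M ^ 2 * |β|⁻¹ ^ 2) * (2 * M * μ * |β|⁻¹) := by gcongr
      _ ≤ (18 * M ^ 2 * |β|⁻¹ ^ 2) * (2 * M * μ * 1) := by gcongr
      _ = 36 * M ^ 3 * (μ * |β|⁻¹ ^ 2) := by ring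
      _ ≤ 36 * M ^ 4 * coreRate β μ := by
          gcongr 36 * ?_ * ?_
          · exact pow_le_pow_right₀ hM (by norm_num)
          · exact H.inv_sq_le.1
  rw [e1]
  refine (abs_add_le _ _).trans ((add_le_add_left (abs_add_le _ _) _).trans ?_)
  linarith

/-- First order expansion of the strength. -/
theorem abs_pow_mul_sub_le (hh : (⟪e, h⟫ : ℝ) = 0) {k : ℕ} (hk : 1 ≤ k) {Y N : ℝ}
    (hY : |Y - (⟪e, ξ⟫ + β⁻¹)| ≤ N * (|β| * coreRate β μ)) :
    |‖e + h‖⁻¹ ^ k * (β + Y) - (β + ⟪e, ξ⟫ - (k / 2 - 1) / β)| ≤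
      (1665 * k ^ 2 * M ^ 4 + N) * (|β| * coreRate β μ) := by
  have hM := H.one_le_M
  have hμ := H.nonneg
  have hμ1 := H.le_one
  have hi := H.inv_le_one
  have hi0 := inv_nonneg.2 (abs_nonneg β)
  have hR := H.coreRate_nonneg
  have hβ := H.ne_zero
  obtain ⟨h1, h2, h3⟩ := H.abs_inv_norm_sub_le hh
  have hfpos : 0 ≤ ‖e + h‖⁻¹ := inv_nonneg.2 (norm_nonneg _)
  set f := ‖e + h‖⁻¹ with hf
  have hk1 : (1 : ℝ) ≤ k := by exact_mod_cast hk
  have hp := one_sub_pow_le h2 (by linarith) k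
  rw [sub_sub_cancel] at hp
  have hfk1 : f ^ k ≤ 1 := pow_le_one₀ hfpos (by linarith)
  have hd2 : (1 - f) ^ 2 ≤ 324 * M ^ 4 * coreRate β μ := by
    calc (1 - f) ^ 2 ≤ (18 * M ^ 2 * |β|⁻¹ ^ 2) ^ 2 := by gcongr
      _ = 324 * M ^ 4 * |β|⁻¹ ^ 4 := by ring
      _ ≤ _ := by gcongr; exact H.inv_sq_le.2
  have hfk : |f ^ k - (1 - k * (|β|⁻¹ ^ 2 / 2))| ≤ 1629 * k ^ 2 * M ^ 4 * coreRate β μ := by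
    have e1 : f ^ k - (1 - k * (|β|⁻¹ ^ 2 / 2)) = (f ^ k - (1 - k * (1 - f))) +
        k * (f - (1 - |β|⁻¹ ^ 2 / 2)) := by ring
    rw [e1]
    refine (abs_add_le _ _).trans ?_
    rw [abs_mul, Nat.abs_cast]
    calc _ ≤ (k : ℝ) ^ 2 * (324 * M ^ 4 * coreRate β μ) + k ^ 2 * (1305 * M ^ 4 * coreRate β μ) := by
          refine add_le_add (hp.trans (by gcongr)) (mul_le_mul ?_ h1 (abs_nonneg _) (by positivity))
          exact le_self_pow₀ hk1 two_ne_zero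
      _ = _ := by ring
  have hlow : 0 ≤ 1 - f ^ k ∧ 1 - f ^ k ≤ k * (18 * M ^ 2 * |β|⁻¹ ^ 2) := by
    refine ⟨by linarith, ?_⟩
    have := one_add_mul_le_pow (a := -(1 - f)) (by linarith) k
    rw [neg_sub, add_sub_cancel] at this
    have h5 : k * (1 - f) ≤ k * (18 * M ^ 2 * |β|⁻¹ ^ 2) := by gcongr
    linarith
  -- To leading order `f ^ k = 1 - k / (2 β²)` turns `β` into `β - k / (2 β)`; together with the `1
  -- / β` contained in `Y` this gives `-(k/2 - 1) / β`.
  have e1 : f ^ k * (β + Y) - (β + ⟪e, ξ⟫ - (k / 2 - 1) / β) =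
      (f ^ k - (1 - k * (|β|⁻¹ ^ 2 / 2))) * β + f ^ k * (Y - (⟪e, ξ⟫ + β⁻¹)) +
        -((1 - f ^ k) * (⟪e, ξ⟫ + β⁻¹)) := by
    generalize f ^ k = F
    rw [inv_pow, sq_abs]
    field_simp
    ring
  have a1 : |(f ^ k - (1 - k * (|β|⁻¹ ^ 2 / 2))) * β| ≤
      1629 * k ^ 2 * M ^ 4 * (|β| * coreRate β μ) := by
    rw [abs_mul]
    calc _ ≤ (1629 * k ^ 2 * M ^ 4 * coreRate β μ) * |β| := by gcongr
      _ = _ := by ring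
  have a2 : |f ^ k * (Y - (⟪e, ξ⟫ + β⁻¹))| ≤ N * (|β| * coreRate β μ) := by
    rw [abs_mul, abs_of_nonneg (by positivity : 0 ≤ f ^ k)]
    exact (mul_le_of_le_one_left (abs_nonneg _) hfk1).trans hY
  have a3 : |-((1 - f ^ k) * (⟪e, ξ⟫ + β⁻¹))| ≤ 36 * k ^ 2 * M ^ 4 * (|β| * coreRate β μ) := by
    rw [abs_neg, abs_mul, abs_of_nonneg hlow.1]
    have hb : |(⟪e, ξ⟫ : ℝ) + β⁻¹| ≤ M * μ + |β|⁻¹ := by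
      refine (abs_add_le _ _).trans ?_
      rw [abs_inv]
      exact add_le_add_left H.inner_le _
    calc _ ≤ (k * (18 * M ^ 2 * |β|⁻¹ ^ 2)) * (M * μ + |β|⁻¹) := by
          gcongr
          exact hlow.2
      _ = 18 * k * M ^ 2 * (M * (μ * |β|⁻¹ ^ 2) + |β|⁻¹ ^ 3) := by ring
      _ ≤ 18 * k ^ 2 * M ^ 2 * (M ^ 2 * (μ * |β|⁻¹) + M ^ 2 * |β|⁻¹ ^ 3) := by
          have b1 : |β|⁻¹ ^ 2 ≤ |β|⁻¹ := pow_le_of_le_one hi0 hi two_ne_zero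
          have b2 : M ≤ M ^ 2 := le_self_pow₀ hM two_ne_zero
          have b3 : (k : ℝ) ≤ k ^ 2 := le_self_pow₀ hk1 two_ne_zero
          have b4 : |β|⁻¹ ^ 3 ≤ M ^ 2 * |β|⁻¹ ^ 3 :=
            le_mul_of_one_le_left (by positivity) (one_le_pow₀ hM)
          gcongr
      _ = 18 * k ^ 2 * M ^ 4 * (μ * |β|⁻¹ + |β|⁻¹ ^ 3) := by ring
      _ ≤ _ := by
          rw [H.mul_coreRate]
          gcongr
          norm_num
  rw [e1]
  refine (abs_add_le _ _).trans ((add_le_add_left (abs_add_le _ _) _).trans ?_)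
  linarith

end CoreHyp

end Core

/-! ### The expansion after two steps of the chart map -/

section Response

variable {E : Type*} [NormedAddCommGroup E] [InnerProductSpace ℝ E] {r : ℕ}
  {β : Fin r → ℝ} {v : Fin r → E} {m : ℕ} {A : E → E} {p : Fin r} {K Q C L μ : ℝ} {a g h : E}

lemma norm_rival_le (hm : 2 ≤ m) (hv : Orthonormal ℝ v) (hQ : 0 ≤ Q)
    (hr : ∀ j, j ≠ p → |β j / β p| ≤ Q) {x : ℝ} (hx1 : x ≤ 1)
    (hx : ∀ j, j ≠ p → |(⟪v j, g⟫ : ℝ)| ≤ x) : ‖rival β v p m g‖ ≤ r * (Q * x ^ 2) := by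
  calc ‖rival β v p m g‖ ≤ ∑ j ∈ Finset.univ.erase p, Q * x ^ 2 := by
        refine (norm_sum_le _ _).trans (Finset.sum_le_sum fun j hj => ?_)
        have hj' := Finset.ne_of_mem_erase hj
        have hx0 : 0 ≤ x := (abs_nonneg _).trans (hx j hj')
        rw [norm_smul, hv.1, mul_one, Real.norm_eq_abs, abs_mul, abs_pow]
        calc _ ≤ Q * x ^ m := by
              gcongr
              · exact hr j hj'
              · exact hx j hj'
          _ ≤ _ := by gcongr Q * ?_; exact pow_le_pow_of_le_one hx0 hx1 hm
    _ ≤ ∑ _j : Fin r, Q * x ^ 2 :=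
        Finset.sum_le_sum_of_subset_of_nonneg (Finset.erase_subset _ _) fun _ _ _ => by positivity
    _ = _ := by rw [Finset.sum_const, Finset.card_univ, Fintype.card_fin, nsmul_eq_mul]

lemma abs_inv_one_add_le {x : ℝ} (hx : |x| ≤ 1 / 2) :
    1 + x ≠ 0 ∧ |(1 + x)⁻¹| ≤ 2 ∧ |(1 + x)⁻¹ - 1| ≤ 2 * |x| := by
  have h1 : 1 / 2 ≤ 1 + x := by linarith [neg_abs_le x]
  have h2 : 0 < 1 + x := by linarith
  have h3 : |(1 + x)⁻¹| ≤ 2 := by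
    rw [abs_of_pos (inv_pos.2 h2)]
    exact (inv_anti₀ (by norm_num) h1).trans (by norm_num)
  refine ⟨h2.ne', h3, ?_⟩
  have e : (1 + x)⁻¹ - 1 = -((1 + x)⁻¹ * x) := by field_simp; ring
  rw [e, abs_neg, abs_mul]
  gcongr

lemma abs_inner_chartMap_le (hm : 2 ≤ m) (hv : Orthonormal ℝ v) (hβ : β p ≠ 0)
    (hA : NoiseBound A K) (hK : K / |β p| ≤ 1 / 2) (hr : ∀ j, j ≠ p → |β j / β p| ≤ Q)
    (hg : (⟪v p, g⟫ : ℝ) = 0) (hg1 : ‖g‖ ≤ 1) {j : Fin r} (hj : j ≠ p) :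
    |(⟪v j, chartMap β v p m A g⟫ : ℝ)| ≤
      2 * (Q * ‖g‖ ^ 2 + |(⟪v j, A (v p + g)⟫ : ℝ)| * |β p|⁻¹) := by
  obtain ⟨hD, hD2, -⟩ := abs_inv_one_add_le ((abs_noise_div_le (β := β) hv hA hg1).trans hK)
  have hin : (⟪v j, rival β v p m g⟫ : ℝ) = β j / β p * (⟪v j, g⟫ : ℝ) ^ m := by
    rw [rival, inner_sum, Finset.sum_eq_single_of_mem j (by simp [hj])]
    · rw [real_inner_smul_right, real_inner_self_eq_norm_sq, hv.1]; ring
    · intro i _ hi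
      rw [real_inner_smul_right, inner_basis_of_ne hv hi.symm, mul_zero]
  rw [chartMap_eq hv hβ hg hD, real_inner_smul_right, inner_add_right, hin, real_inner_smul_right,
    inner_sub_right, real_inner_smul_right, inner_basis_of_ne hv hj, mul_zero, sub_zero, abs_mul]
  gcongr
  refine (abs_add_le _ _).trans (add_le_add ?_ ?_)
  · rw [abs_mul, abs_pow]
    have h1 : |(⟪v j, g⟫ : ℝ)| ≤ ‖g‖ := abs_inner_unit_le (hv.1 j)
    have := (abs_nonneg _).trans (hr j hj)
    calc _ ≤ Q * ‖g‖ ^ m := by gcongr; exact hr j hj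
      _ ≤ _ := by
        gcongr Q * ?_
        exact pow_le_pow_of_le_one (norm_nonneg _) hg1 hm
  · rw [abs_mul, abs_inv, mul_comm]

/-- Dropping the rivals and the denominator from `chartMap`. The denominator differs from one by the
noise in direction `v p` divided by `β p`, which is why a directional bound enters next to `K`. -/
lemma norm_chartMap_sub_lead_le (hv : Orthonormal ℝ v) (hβ : β p ≠ 0)
    (hA : NoiseBound A K) (hK : K / |β p| ≤ 1 / 2)
    (hg : (⟪v p, g⟫ : ℝ) = 0) (hg1 : ‖g‖ ≤ 1) :
    ‖chartMap β v p m A g -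
      (β p)⁻¹ • (A (v p + g) - (⟪v p, A (v p + g)⟫ : ℝ) • v p)‖ ≤
      2 * ‖rival β v p m g‖ + 2 * |(⟪v p, A (v p + g)⟫ : ℝ)| * K * |β p|⁻¹ ^ 2 := by
  obtain ⟨hD, hD2, hD3⟩ := abs_inv_one_add_le ((abs_noise_div_le (β := β) hv hA hg1).trans hK)
  set y := A (v p + g) with hy
  set D := (1 + (⟪v p, y⟫ : ℝ) / β p)⁻¹ with hDdef
  have e : chartMap β v p m A g - (β p)⁻¹ • (y - (⟪v p, y⟫ : ℝ) • v p) =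
      D • rival β v p m g + (D - 1) • (β p)⁻¹ • (y - (⟪v p, y⟫ : ℝ) • v p) := by
    rw [chartMap_eq hv hβ hg hD, smul_add, sub_smul, one_smul]; abel
  have hyK : ‖y‖ ≤ K := hA.norm_le _ (norm_add_le_two (hv.1 p) hg1)
  rw [e]
  refine (norm_add_le _ _).trans (add_le_add ?_ ?_)
  · rw [norm_smul, Real.norm_eq_abs]; gcongr
  · rw [norm_smul, norm_smul, norm_inv, Real.norm_eq_abs, Real.norm_eq_abs]
    calc _ ≤ (2 * |(⟪v p, y⟫ : ℝ) / β p|) * (|β p|⁻¹ * K) := by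
          gcongr
          exact (norm_sub_inner_smul_le (hv.1 p)).trans hyK
      _ = _ := by rw [abs_div, div_eq_mul_inv]; ring

/-- The constant in the bounds of the overlaps. -/
def overlapConst (Q C L : ℝ) : ℝ := 2 * (Q * C ^ 2 + L)

/-- The constant in the expansion. -/
def coreConst (r : ℕ) (K Q C L : ℝ) : ℝ :=
  1 + L + K * C + 4 * L * K + 4 * r * Q * overlapConst Q C L ^ 2

/-- The bounds of the responses of the noise from which the expansion follows: `g` and its first two
iterates are close to zero, and the noise at these points differs from that at zero by a vector with
small inner products with fixed directions. -/
structure ResponseHyp (m : ℕ) (K Q C L μ : ℝ) (β : Fin r → ℝ) (v : Fin r → E) (p : Fin r)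
    (A : E → E) (a g h : E) : Prop where
  orthonormal : Orthonormal ℝ v
  two_le : 2 ≤ m
  ne_zero : β p ≠ 0
  bound : NoiseBound A K
  ratio_le : K / |β p| ≤ 1 / 2
  Q_nonneg : 0 ≤ Q
  ratio : ∀ j, j ≠ p → |β j / β p| ≤ Q
  radius_le : C / |β p| ≤ 1
  nonneg : 0 ≤ μ
  le_one : μ ≤ 1
  L_nonneg : 0 ≤ L
  one_le : 1 ≤ |β p|
  large : 6 * coreConst r K Q C L ≤ |β p|
  unit : ‖a‖ = 1
  mem₀ : g ∈ chartBall (v p) (C / |β p|)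
  mem₁ : chartMap β v p m A g ∈ chartBall (v p) (C / |β p|)
  mem₂ : chartMap β v p m A (chartMap β v p m A g) ∈ chartBall (v p) (C / |β p|)
  resp₀ : ∀ j, |(⟪v j, A (v p + g)⟫ : ℝ)| ≤ L * μ
  resp₁ : ∀ j, |(⟪v j, A (v p + chartMap β v p m A g)⟫ : ℝ)| ≤ L * μ
  pert₁ : ∀ b, b = v p ∨ b = A (v p) ∨ b = a →
    |(⟪b, A (v p + chartMap β v p m A g) - A (v p)⟫ : ℝ)| ≤ L * μ / |β p|
  pert₂ : ∀ b, b = v p ∨ b = A (v p) →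
    |(⟪b, A (v p + chartMap β v p m A (chartMap β v p m A g)) - A (v p)⟫ : ℝ)| ≤ L * μ / |β p|
  inner_a : |(⟪a, A (v p)⟫ : ℝ)| ≤ L * μ
  inner_e : |(⟪v p, A (v p)⟫ : ℝ)| ≤ L * μ
  norm_sq : |‖A (v p)‖ ^ 2 - 1| ≤ L * μ
  inner_h : (⟪v p, h⟫ : ℝ) = 0
  approx : ‖h - chartMap β v p m A (chartMap β v p m A g)‖ ≤ L * coreRate (β p) μ

namespace ResponseHyp

variable (H : ResponseHyp m K Q C L μ β v p A a g h)
include H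

lemma C_nonneg : 0 ≤ C := by
  have h1 := (norm_nonneg _).trans H.mem₀.2
  have := H.one_le
  rw [le_div_iff₀ (by linarith), zero_mul] at h1
  exact h1

lemma overlapConst_nonneg : 0 ≤ overlapConst Q C L := by
  have := H.Q_nonneg
  have := H.L_nonneg
  unfold overlapConst; positivity

lemma le_coreConst : 1 ≤ coreConst r K Q C L ∧ L ≤ coreConst r K Q C L ∧
    K * C ≤ coreConst r K Q C L ∧ K * L ≤ coreConst r K Q C L := by
  have h1 := H.Q_nonneg
  have h2 := H.L_nonneg
  have h3 := H.C_nonneg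
  have h4 := H.bound.nonneg
  have h5 : 0 ≤ K * C := by positivity
  have h6 : 0 ≤ L * K := by positivity
  have h7 : 0 ≤ 4 * r * Q * overlapConst Q C L ^ 2 := by positivity
  unfold coreConst
  refine ⟨?_, ?_, ?_, ?_⟩ <;> linarith

/-- One step from the small ball improves the overlap with `v j` from order `1 / |β p|` to `1 / |β
p|² + μ / |β p|`: the rival is at least quadratic and the response in direction `v j` is of order
`μ`. -/
lemma overlap_le {g : E} (hg : g ∈ chartBall (v p) (C / |β p|))
    (hresp : ∀ j, |(⟪v j, A (v p + g)⟫ : ℝ)| ≤ L * μ) {j : Fin r} (hj : j ≠ p) :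
    |(⟪v j, chartMap β v p m A g⟫ : ℝ)| ≤
      overlapConst Q C L * (|β p|⁻¹ ^ 2 + μ * |β p|⁻¹) := by
  have h1 := abs_inner_chartMap_le H.two_le H.orthonormal H.ne_zero H.bound H.ratio_le H.ratio hg.1
    (hg.2.trans H.radius_le) hj
  have hQ := H.Q_nonneg
  have hL := H.L_nonneg
  have hμ := H.nonneg
  have hi0 := inv_nonneg.2 (abs_nonneg (β p))
  have h2 : ‖g‖ ^ 2 ≤ C ^ 2 * |β p|⁻¹ ^ 2 := by
    rw [← mul_pow, ← div_eq_mul_inv]; gcongr; exact hg.2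
  calc _ ≤ _ := h1
    _ ≤ 2 * (Q * (C ^ 2 * |β p|⁻¹ ^ 2) + L * μ * |β p|⁻¹) := by gcongr; exact hresp j
    _ ≤ 2 * (Q * (C ^ 2 * |β p|⁻¹ ^ 2) + L * μ * |β p|⁻¹) +
        2 * (Q * C ^ 2 * (μ * |β p|⁻¹) + L * |β p|⁻¹ ^ 2) := le_add_of_nonneg_right (by positivity)
    _ = _ := by unfold overlapConst; ring

lemma norm_rival_le : ‖rival β v p m (chartMap β v p m A g)‖ ≤
    2 * r * Q * overlapConst Q C L ^ 2 * coreRate (β p) μ := by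
  have hx := fun j hj => H.overlap_le H.mem₀ H.resp₀ (j := j) hj
  have hQ := H.Q_nonneg
  have hμ := H.nonneg
  have hμ1 := H.le_one
  have hi0 := inv_nonneg.2 (abs_nonneg (β p))
  have hN := H.overlapConst_nonneg
  set N := overlapConst Q C L with hNdef
  set i := |β p|⁻¹ with hi
  -- The minimum with `1` meets the requirement `x ≤ 1`, under which the power `m` may be lowered to
  -- `2`.
  have h1 := SpikedTensor.norm_rival_le H.two_le H.orthonormal H.Q_nonneg H.ratio
    (g := chartMap β v p m A g) (x := min 1 (N * (i ^ 2 + μ * i))) (min_le_left _ _)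
    (fun j hj => le_min ((abs_inner_unit_le (H.orthonormal.1 j)).trans
      (H.mem₁.2.trans H.radius_le)) (hx j hj))
  have h2 : (i ^ 2 + μ * i) ^ 2 ≤ 2 * coreRate (β p) μ := by
    have e : coreRate (β p) μ = μ * i ^ 2 + i ^ 4 := by
      unfold coreRate; rw [div_eq_mul_inv, one_div, hi, inv_pow, inv_pow]
    rw [e]
    have h3 : μ ^ 2 * i ^ 2 ≤ μ * i ^ 2 := by
      gcongr; exact pow_le_of_le_one hμ hμ1 two_ne_zero
    nlinarith [sq_nonneg (i ^ 2 - μ * i)]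
  calc _ ≤ _ := h1
    _ ≤ r * (Q * (N * (i ^ 2 + μ * i)) ^ 2) := by
        have : 0 ≤ min 1 (N * (i ^ 2 + μ * i)) := by positivity
        gcongr
        exact min_le_right _ _
    _ = r * Q * N ^ 2 * (i ^ 2 + μ * i) ^ 2 := by ring
    _ ≤ r * Q * N ^ 2 * (2 * coreRate (β p) μ) := by gcongr
    _ = _ := by ring

/-- Two steps are needed: the first makes the rival overlaps so small that their squares are within
the rate, the second then writes the iterate through the noise at the first. -/
lemma coreHyp : CoreHyp (v p) (A (v p)) (A (v p + chartMap β v p m A g) - A (v p)) h (β p) μ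
    (coreConst r K Q C L) := by
  obtain ⟨M1, M2, M3, M4⟩ := H.le_coreConst
  have hμ := H.nonneg
  have hL := H.L_nonneg
  have hK := H.bound.nonneg
  have hi0 := inv_nonneg.2 (abs_nonneg (β p))
  have hLM : L * μ ≤ coreConst r K Q C L * μ := by gcongr
  have hLM' : L * μ / |β p| ≤ coreConst r K Q C L * μ / |β p| := by gcongr
  have he := H.orthonormal.1 p
  refine ⟨he, H.one_le, hμ, H.le_one, M1, H.inner_e.trans hLM, H.norm_sq.trans hLM,
    (H.pert₁ _ (Or.inl rfl)).trans hLM', (H.pert₁ _ (Or.inr (Or.inl rfl))).trans hLM', ?_, ?_⟩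
  · have h1 := H.bound.norm_sub_le (v p + chartMap β v p m A g) (v p)
      (norm_add_le_two he (H.mem₁.2.trans H.radius_le)) (by rw [he]; norm_num)
    rw [add_sub_cancel_left] at h1
    calc _ ≤ K * (C / |β p|) := h1.trans (by gcongr; exact H.mem₁.2)
      _ = K * C / |β p| := by ring
      _ ≤ _ := by gcongr
  · rw [add_sub_cancel]
    have h1 := norm_chartMap_sub_lead_le (m := m) H.orthonormal H.ne_zero H.bound H.ratio_le
      H.mem₁.1 (H.mem₁.2.trans H.radius_le)
    have h2 := H.norm_rival_le
    have h3 := norm_add_le (h - chartMap β v p m A (chartMap β v p m A g))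
      (chartMap β v p m A (chartMap β v p m A g) - (β p)⁻¹ • (A (v p + chartMap β v p m A g) -
        (⟪v p, A (v p + chartMap β v p m A g)⟫ : ℝ) • v p))
    rw [sub_add_sub_cancel] at h3
    have h4 : 2 * |(⟪v p, A (v p + chartMap β v p m A g)⟫ : ℝ)| * K * |β p|⁻¹ ^ 2 ≤
        2 * L * K * coreRate (β p) μ := by
      calc _ ≤ 2 * (L * μ) * K * |β p|⁻¹ ^ 2 := by gcongr; exact H.resp₁ p
        _ = 2 * L * K * (μ / |β p| ^ 2) := by rw [div_eq_mul_inv, inv_pow]; ring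
        _ ≤ _ := by
          unfold coreRate
          gcongr 2 * L * K * ?_
          exact le_add_of_nonneg_right (by positivity)
    have h5 : 0 ≤ coreRate (β p) μ := by unfold coreRate; positivity
    have h6 : coreConst r K Q C L * coreRate (β p) μ = coreRate (β p) μ + L * coreRate (β p) μ +
        K * C * coreRate (β p) μ + 4 * L * K * coreRate (β p) μ +
        4 * r * Q * overlapConst Q C L ^ 2 * coreRate (β p) μ := by unfold coreConst; ring
    have h7 : 0 ≤ K * C * coreRate (β p) μ := by have := H.C_nonneg; positivity
    have h8 : 0 ≤ L * K * coreRate (β p) μ := by positivity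
    rw [h6]
    linarith [H.approx]

theorem abs_inner_lift_sub_le :
    |(⟪a, lift (v p) h⟫ : ℝ) - ((1 - 1 / (2 * β p ^ 2)) * ⟪a, v p⟫ +
      (⟪a, A (v p)⟫ - ⟪a, v p⟫ * ⟪v p, A (v p)⟫) / β p)| ≤
      1344 * coreConst r K Q C L ^ 4 * coreRate (β p) μ := by
  obtain ⟨M1, M2, M3, M4⟩ := H.le_coreConst
  have hμ := H.nonneg
  refine H.coreHyp.abs_inner_lift_sub_le H.inner_h H.unit
    ((H.pert₁ _ (Or.inr (Or.inr rfl))).trans (by gcongr)) (H.inner_a.trans (by gcongr))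

lemma norm_le_one : ‖h‖ ≤ 1 := by
  refine H.coreHyp.norm_le.trans ?_
  have := H.coreHyp.abs_pos'
  rw [← div_eq_mul_inv, div_le_one this]
  exact H.large

/-- As `m + 1 ≥ 3`, two factors of the overlap are bounded by `‖h‖ = O(1/|β p|)` and one by the
improved estimate `overlap_le`. -/
lemma abs_sum_rival_le :
    |∑ j ∈ Finset.univ.erase p, β j * (⟪v j, v p + h⟫ : ℝ) ^ (m + 1)| ≤
      r * (36 * Q * (overlapConst Q C L + L) * coreConst r K Q C L ^ 2 *
        (|β p| * coreRate (β p) μ)) := by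
  have hcore := H.coreHyp
  obtain ⟨M1, M2, M3, M4⟩ := H.le_coreConst
  have hμ := H.nonneg
  have hμ1 := H.le_one
  have hL := H.L_nonneg
  have hQ := H.Q_nonneg
  have hN := H.overlapConst_nonneg
  have hβ0 := hcore.abs_pos'
  have hi0 := inv_nonneg.2 (abs_nonneg (β p))
  have hi1 := hcore.inv_le_one
  set M := coreConst r K Q C L with hM
  set N := overlapConst Q C L with hNdef
  set i := |β p|⁻¹ with hi
  have hrate : coreRate (β p) μ = μ * i ^ 2 + i ^ 4 := by
    unfold coreRate; rw [div_eq_mul_inv, one_div, hi, inv_pow, inv_pow]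
  have hterm : ∀ j, j ≠ p → |β j * (⟪v j, v p + h⟫ : ℝ) ^ (m + 1)| ≤
      36 * Q * (N + L) * M ^ 2 * (|β p| * coreRate (β p) μ) := by
    intro j hj
    rw [inner_add_right, inner_basis_of_ne H.orthonormal hj, zero_add, abs_mul, abs_pow]
    have h1 : |(⟪v j, h⟫ : ℝ)| ≤ (N + L) * (i ^ 2 + μ * i) := by
      have e : (⟪v j, h⟫ : ℝ) = ⟪v j, chartMap β v p m A (chartMap β v p m A g)⟫ +
          ⟪v j, h - chartMap β v p m A (chartMap β v p m A g)⟫ := by rw [inner_sub_right]; ring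
      have h2 := H.overlap_le H.mem₁ H.resp₁ hj
      have h3 : |(⟪v j, h - chartMap β v p m A (chartMap β v p m A g)⟫ : ℝ)| ≤
          L * (i ^ 2 + μ * i) := by
        refine (abs_inner_unit_le (H.orthonormal.1 j)).trans (H.approx.trans ?_)
        rw [hrate, add_comm (i ^ 2)]
        have : i ^ 4 ≤ i ^ 2 := pow_le_pow_of_le_one hi0 hi1 (by norm_num)
        have : i ^ 2 ≤ i := pow_le_of_le_one hi0 hi1 two_ne_zero
        gcongr
      rw [e]
      refine (abs_add_le _ _).trans ?_
      linarith
    have h2 : |(⟪v j, h⟫ : ℝ)| ≤ 6 * M * i :=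
      (abs_inner_unit_le (H.orthonormal.1 j)).trans hcore.norm_le
    have h5 : |(⟪v j, h⟫ : ℝ)| ^ (m + 1) ≤ |(⟪v j, h⟫ : ℝ)| ^ 3 := by
      have := H.two_le
      exact pow_le_pow_of_le_one (abs_nonneg _)
        ((abs_inner_unit_le (H.orthonormal.1 j)).trans H.norm_le_one) (by omega)
    have h6 : |β j| ≤ Q * |β p| := by
      have := H.ratio j hj
      rwa [abs_div, div_le_iff₀ hβ0] at this
    calc _ ≤ (Q * |β p|) * (|(⟪v j, h⟫ : ℝ)| * |(⟪v j, h⟫ : ℝ)| ^ 2) := by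
          rw [← pow_succ']; gcongr
      _ ≤ (Q * |β p|) * (((N + L) * (i ^ 2 + μ * i)) * (6 * M * i) ^ 2) := by gcongr
      _ = 36 * Q * (N + L) * M ^ 2 * (|β p| * (i ^ 4 + μ * i ^ 3)) := by ring
      _ ≤ _ := by
          have : i ^ 3 ≤ i ^ 2 := pow_le_pow_of_le_one hi0 hi1 (by norm_num)
          rw [hrate, add_comm (i ^ 4)]
          gcongr
  calc _ ≤ ∑ j ∈ Finset.univ.erase p,
        36 * Q * (N + L) * M ^ 2 * (|β p| * coreRate (β p) μ) :=
        (Finset.abs_sum_le_sum_abs _ _).trans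
          (Finset.sum_le_sum fun j hj => hterm j (Finset.ne_of_mem_erase hj))
    _ ≤ ∑ _j : Fin r, 36 * Q * (N + L) * M ^ 2 * (|β p| * coreRate (β p) μ) :=
        Finset.sum_le_sum_of_subset_of_nonneg (Finset.erase_subset _ _) fun _ _ _ => by
          have := hcore.coreRate_nonneg
          positivity
    _ = _ := by rw [Finset.sum_const, Finset.card_univ, Fintype.card_fin, nsmul_eq_mul]

theorem abs_energy_lift_sub_le (hsm : ∀ (c : ℝ) (x : E), A (c • x) = c ^ m • A x) :
    |energy β v m A (lift (v p) h) -
      (β p + ⟪v p, A (v p)⟫ - (((m + 1 : ℕ) : ℝ) / 2 - 1) / β p)| ≤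
      (1665 * ((m + 1 : ℕ) : ℝ) ^ 2 * coreConst r K Q C L ^ 4 +
        (r * (36 * Q * (overlapConst Q C L + L) * coreConst r K Q C L ^ 2) +
          19 * coreConst r K Q C L ^ 2)) * (|β p| * coreRate (β p) μ) := by
  have hcore := H.coreHyp
  obtain ⟨M1, M2, M3, M4⟩ := H.le_coreConst
  have hμ := H.nonneg
  have hβ0 := hcore.abs_pos'
  have he := H.orthonormal.1 p
  have hLM : L * μ / |β p| ≤ coreConst r K Q C L * μ / |β p| := by gcongr
  set Y := ∑ j ∈ Finset.univ.erase p, β j * (⟪v j, v p + h⟫ : ℝ) ^ (m + 1) +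
    ⟪v p + h, A (v p + h)⟫ with hY
  have e : energy β v m A (lift (v p) h) = ‖v p + h‖⁻¹ ^ (m + 1) * (β p + Y) := by
    rw [lift, energy_smul hsm, energy_eq, ← Finset.add_sum_erase _ _ (Finset.mem_univ p),
      inner_add_right (v p) (v p) h, H.inner_h, real_inner_self_eq_norm_sq, he, hY]
    ring
  rw [e]
  refine hcore.abs_pow_mul_sub_le H.inner_h (by omega) ?_
  have h1 := H.abs_sum_rival_le
  have h2 := hcore.abs_inner_noise_sub_le (y := A (v p + h))
    (w' := A (v p + chartMap β v p m A (chartMap β v p m A g)) - A (v p)) ?_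
    ((H.pert₂ _ (Or.inl rfl)).trans hLM) ((H.pert₂ _ (Or.inr rfl)).trans hLM) ?_
  · have e2 : Y - (⟪v p, A (v p)⟫ + (β p)⁻¹) =
        ∑ j ∈ Finset.univ.erase p, β j * (⟪v j, v p + h⟫ : ℝ) ^ (m + 1) +
        ((⟪v p + h, A (v p + h)⟫ : ℝ) - (⟪v p, A (v p)⟫ + (β p)⁻¹)) := by rw [hY]; ring
    rw [e2]
    refine (abs_add_le _ _).trans ((add_le_add h1 h2).trans (le_of_eq (by ring)))
  · have h3 := H.bound.norm_sub_le (v p + chartMap β v p m A (chartMap β v p m A g)) (v p)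
      (norm_add_le_two he (H.mem₂.2.trans H.radius_le)) (by rw [he]; norm_num)
    have hK := H.bound.nonneg
    rw [add_sub_cancel_left] at h3
    calc _ ≤ K * (C / |β p|) := h3.trans (by gcongr; exact H.mem₂.2)
      _ = K * C / |β p| := by ring
      _ ≤ _ := by gcongr
  · rw [add_sub_cancel]
    have h3 := H.bound.norm_sub_le (v p + h)
      (v p + chartMap β v p m A (chartMap β v p m A g)) (norm_add_le_two he H.norm_le_one)
      (norm_add_le_two he (H.mem₂.2.trans H.radius_le))
    rw [add_sub_add_left_eq_sub] at h3
    have hK := H.bound.nonneg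
    have := hcore.coreRate_nonneg
    calc _ ≤ K * (L * coreRate (β p) μ) := h3.trans (by gcongr; exact H.approx)
      _ = K * L * coreRate (β p) μ := by ring
      _ ≤ _ := by gcongr

end ResponseHyp

end Response

/-! ### The responses along the iterates of the chart map -/

section Responses

variable {n m r : ℕ}

/-- The iterates of the chart map that start at zero. -/
def chartIter (β : Fin r → ℝ) (v : Fin r → Vec n) (p : Fin r) (Z : Tensor n (m + 1)) : ℕ → Vec n
  | 0 => 0
  | t + 1 => chartMap β v p m (noiseMap Z) (chartIter β v p Z t)

/-- The noise at a point of the chart, with the component along the noise at zero removed. -/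
def residualNoise (e : Vec n) (Z : Tensor n (m + 1)) (g : Vec n) : Vec n :=
  act Z (residual (tpow e m) (tpow (e + g) m))

lemma tinner_tpow_self {e : Vec n} (he : ‖e‖ = 1) : tinner (tpow e m) (tpow e m) = 1 := by
  rw [tinner_tpow, real_inner_self_eq_norm_sq, he]; norm_num

/-- The chart iterates started at `0` form an adaptive procedure with deterministic start. The
direction may depend on the response at `v p`, since only the residual noise is measured. -/
lemma noise_residualNoise_tail (β : Fin r → ℝ) (v : Fin r → Vec n) (p : Fin r) (he : ‖v p‖ = 1)
    (T : ℕ) {b : Vec n → Vec n} (hb : Measurable b) {M : ℝ} (hM : 0 < M) :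
    noise n (m + 1) {Z | ∃ t < T, T * (M / √n) * ‖b (noiseMap Z (v p))‖ *
        tnorm (residual (tpow (v p) m) (tpow (v p + chartIter β v p Z t) m)) <
      |(⟪b (noiseMap Z (v p)), residualNoise (v p) Z (chartIter β v p Z t)⟫ : ℝ)|} ≤
        T * ENNReal.ofReal (1 / M ^ 2) := by
  set f : Vec n → Vec n → Vec n := fun g y =>
    chart (v p) (∑ j, (β j * (⟪v j, v p + g⟫ : ℝ) ^ m) • v j + y) with hf
  set x : Vec n → Tensor n m := fun g => tpow (v p + g) m with hx
  have hfm : Measurable fun q : Vec n × Vec n => f q.1 q.2 := by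
    have h1 : Measurable fun q : Vec n × Vec n =>
        ∑ j, (β j * (⟪v j, v p + q.1⟫ : ℝ) ^ m) • v j + q.2 := by fun_prop
    have h2 : Measurable (chart (v p)) := by
      unfold chart
      have h3 : Measurable fun y : Vec n => (⟪v p, y⟫ : ℝ) := by fun_prop
      exact (h3.inv.smul measurable_id).sub_const _
    exact h2.comp h1
  have hxm : Measurable x := (measurable_tpow m).comp (measurable_const.add measurable_id)
  have horb : ∀ (Z : Tensor n (m + 1)) (t : ℕ), orbit f x Z 0 t = chartIter β v p Z t := by
    intro Z t
    induction t with
    | zero => rfl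
    | succ t ih => rw [orbit, ih]; rfl
  have := noise_residual_tail T hfm hxm (s := fun _ => 0) measurable_const hb
    (tinner_tpow_self (m := m) he) hM
  simp only [horb] at this
  exact this

lemma tinner_tpow_add {e g : Vec n} (he : ‖e‖ = 1) (hg : (⟪e, g⟫ : ℝ) = 0) :
    tinner (tpow e m) (tpow (e + g) m) = 1 := by
  rw [tinner_tpow, inner_add_right, hg, real_inner_self_eq_norm_sq, he]; norm_num

/-- For `g` orthogonal to `e` the component of `(e + g)^⊗m` along `e^⊗m` is exactly one, so removing
it subtracts precisely the noise at `e`. -/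
lemma residualNoise_eq {e g : Vec n} (he : ‖e‖ = 1) (hg : (⟪e, g⟫ : ℝ) = 0)
    (Z : Tensor n (m + 1)) : residualNoise e Z g = noiseMap Z (e + g) - noiseMap Z e := by
  rw [residualNoise, residual, tinner_tpow_add he hg, one_smul, act_sub_right]; rfl

/-- The squared norm equals `(1 + ‖g‖²)^m - 1`, hence the residual query is of the order of `‖g‖`.
-/
lemma tnorm_residual_add_le {e g : Vec n} (he : ‖e‖ = 1) (hg : (⟪e, g⟫ : ℝ) = 0)
    (hg1 : ‖g‖ ≤ 1) : tnorm (residual (tpow e m) (tpow (e + g) m)) ≤ (m + 1) * 2 ^ m * ‖g‖ := by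
  refine le_of_sq_le_sq ?_ (by positivity)
  rw [tnorm_sq, tinner_residual_self (Or.inl (tinner_tpow_self he)), tinner_tpow_add he hg,
    tinner_tpow, real_inner_self_eq_norm_sq, norm_sq_add_of_inner_eq_zero he hg]
  have h1 : ‖g‖ ^ 2 ≤ 1 := pow_le_one₀ (norm_nonneg _) hg1
  have h2 := abs_pow_sub_pow_le_of_abs_le (a := 1 + ‖g‖ ^ 2) (b := 1) (R := 2)
    (by rw [abs_of_nonneg (by positivity)]; linarith) (by norm_num) m
  rw [one_pow, add_sub_cancel_left, abs_of_nonneg (by positivity : 0 ≤ ‖g‖ ^ 2)] at h2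
  have h3 : (m : ℝ) * 2 ^ (m - 1) ≤ ((m + 1) * 2 ^ m) ^ 2 := by
    have h4 : (2 : ℝ) ^ (m - 1) ≤ 2 ^ m := pow_le_pow_right₀ one_le_two (by omega)
    have h5 : (1 : ℝ) ≤ (m + 1) * 2 ^ m := by
      have : (1 : ℝ) ≤ 2 ^ m := one_le_pow₀ one_le_two
      nlinarith [Nat.cast_nonneg (α := ℝ) m]
    calc (m : ℝ) * 2 ^ (m - 1) ≤ (m + 1) * 2 ^ m := by gcongr; linarith
      _ ≤ _ := le_self_pow₀ h5 two_ne_zero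
  rw [mul_pow _ ‖g‖]
  calc (1 + ‖g‖ ^ 2) ^ m - 1 ^ 2 ≤ m * 2 ^ (m - 1) * ‖g‖ ^ 2 := by
        rw [one_pow]; exact (le_abs_self _).trans h2
    _ ≤ _ := by gcongr

/-- The noise behaves in finitely many directions, among them its own value at `v p`, as if these
and the iterates of the chart map were chosen in advance. -/
structure GoodResponse (M : ℝ) (β : Fin r → ℝ) (v : Fin r → Vec n) (p : Fin r) (a : Vec n)
    (Z : Tensor n (m + 1)) : Prop where
  pert : ∀ b, b = a ∨ b = noiseMap Z (v p) ∨ (∃ j, b = v j) → ∀ t < 4,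
    |(⟪b, residualNoise (v p) Z (chartIter β v p Z t)⟫ : ℝ)| ≤ (4 : ℕ) * (M / √n) * ‖b‖ *
      tnorm (residual (tpow (v p) m) (tpow (v p + chartIter β v p Z t) m))
  inner_le : ∀ b, b = a ∨ (∃ j, b = v j) → |(⟪b, noiseMap Z (v p)⟫ : ℝ)| ≤ M / √n * ‖b‖
  norm_sq : |‖noiseMap Z (v p)‖ ^ 2 - 1| ≤ M / √n

lemma exists_goodResponse (m r : ℕ) {δ : ℝ} (hδ : 0 < δ) : ∃ M : ℝ, 1 ≤ M ∧ ∀ n : ℕ, 0 < n →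
    ∀ (β : Fin r → ℝ) (v : Fin r → Vec n) (p : Fin r) (a : Vec n), Orthonormal ℝ v →
      noise n (m + 1) {Z | ¬ GoodResponse M β v p a Z} ≤ ENNReal.ofReal δ := by
  obtain ⟨C, hC, hnorm⟩ := noise_norm_act_tail
  obtain ⟨M, hM1, hM⟩ := exists_div_sq_le ((r + 2) * 4 + ((r + 1) + C) : ℝ) hδ
  have hM0 : 0 < M := by linarith
  refine ⟨M, hM1, fun n hn β v p a hv => ?_⟩
  have he := hv.1 p
  have hq := tinner_tpow_self (m := m) he
  -- the directions are indexed by `Option (Option (Fin r))`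
  set dir : Option (Option (Fin r)) → Vec n → Vec n := fun o ξ =>
    o.elim ξ fun o' => o'.elim a v with hdir
  have hdm : ∀ o, Measurable (dir o) := by
    rintro (_ | o)
    · exact measurable_id
    · exact measurable_const
  have h1 := fun o => noise_residualNoise_tail (m := m) β v p he 4 (hdm o) hM0
  have h2 := fun o : Option (Fin r) => noise_inner_act_tail hq (o.elim a v) hM0
  have h3 := hnorm n m _ M hn hM0 hq
  have hsub : {Z : Tensor n (m + 1) | ¬ GoodResponse M β v p a Z} ⊆
      (⋃ o, {Z | ∃ t < 4, (4 : ℕ) * (M / √n) * ‖dir o (noiseMap Z (v p))‖ *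
        tnorm (residual (tpow (v p) m) (tpow (v p + chartIter β v p Z t) m)) <
      |(⟪dir o (noiseMap Z (v p)), residualNoise (v p) Z (chartIter β v p Z t)⟫ : ℝ)|}) ∪
      ((⋃ o : Option (Fin r), {Z | M / √n * ‖o.elim a v‖ <
        |(⟪o.elim a v, act Z (tpow (v p) m)⟫ : ℝ)|}) ∪
      {Z | M / √n < |‖act Z (tpow (v p) m)‖ ^ 2 - 1|}) := by
    intro Z hZ
    by_contra hcon
    simp only [Set.mem_union, Set.mem_iUnion, Set.mem_ofPred_eq, not_or, not_exists, not_and,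
      not_lt] at hcon
    obtain ⟨c1, c2, c3⟩ := hcon
    refine hZ ⟨?_, ?_, c3⟩
    · rintro b (rfl | rfl | ⟨j, rfl⟩) t ht
      · exact c1 (some none) t ht
      · exact c1 none t ht
      · exact c1 (some (some j)) t ht
    · rintro b (rfl | ⟨j, rfl⟩)
      · exact c2 none
      · exact c2 (some j)
  refine (measure_mono hsub).trans ((measure_union_le _ _).trans (le_trans (add_le_add
    ((measure_iUnion_fintype_le _ _).trans (Finset.sum_le_sum fun o _ => h1 o))
    ((measure_union_le _ _).trans (add_le_add
      ((measure_iUnion_fintype_le _ _).trans (Finset.sum_le_sum fun o _ => h2 o)) h3))) ?_))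
  rw [Finset.sum_const, Finset.sum_const, Finset.card_univ, Finset.card_univ, Fintype.card_option,
    Fintype.card_option, Fintype.card_fin, nsmul_eq_mul, nsmul_eq_mul,
    ← ENNReal.ofReal_natCast, ← ENNReal.ofReal_natCast, ← ENNReal.ofReal_natCast,
    ← ENNReal.ofReal_mul (by positivity), ← ENNReal.ofReal_mul (by positivity),
    ← ENNReal.ofReal_mul (by positivity), ← ENNReal.ofReal_add (by positivity) (by positivity),
    ← ENNReal.ofReal_add (by positivity) (by positivity)]
  refine ENNReal.ofReal_le_ofReal (le_trans (le_of_eq ?_) hM)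
  push_cast
  ring

end Responses

/-! ### The response bounds hold for the power iteration -/

section Combine

variable {n m r : ℕ} {β : Fin r → ℝ} {v : Fin r → Vec n} {p : Fin r} {u a : Vec n}
  {Z : Tensor n (m + 1)} {κ K Q C M : ℝ}

/-- The constant in the response bounds. -/
def responseConst (m : ℕ) (K Q C M : ℝ) : ℝ :=
  M * (1 + 4 * ((m + 1) * 2 ^ m) * (1 + K) * (1 + C)) +
    ((4 * (Q * m + 1) * C) ^ 3 + (4 * (Q * m + 1) * C) ^ 2) * C

/-- Transfers the probabilistic bounds from the comparison sequence `chartIter`, which starts at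
`0`, to the actual trajectory `f`. The trajectory depends on all earlier queries, but it is pulled
to the comparison sequence by the contraction. -/
lemma responseHyp (hm : 2 ≤ m) (hn : 0 < n) (hS : SignalBound m κ β v p u) (ha : ‖a‖ = 1)
    (hQ : Q = κ ^ (m - 1))
    (hA : NoiseBound (noiseMap Z) K) (hC : 4 * K ≤ C) (hM : 1 ≤ M)
    (hG : GoodResponse M β v p a Z)
    (hβ : 8 * (1 + Q * m) * (1 + C) ≤ |β p|)
    (hβ' : 6 * coreConst r K Q C (responseConst m K Q C M) ≤ |β p|)
    {f : ℕ → Vec n} (hf : ∀ t, f (t + 1) = chartMap β v p m (noiseMap Z) (f t))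
    (hf0 : f 0 ∈ chartBall (v p) (C / |β p|)) {i : ℕ}
    (hi : i = 1 ∨ (i = 0 ∧ √n ≤ |β p|)) :
    ResponseHyp m K Q C (responseConst m K Q C M) (1 / √n) β v p (noiseMap Z) a
      (chartIter β v p Z i) (f (i + 2)) := by
  have hcon := contractionHyp_of_large (K := K) (Q := Q * m) (C := C) hm hS hA (by rw [hQ]) hC hβ
  have hK := hA.nonneg
  have hC0 : 0 ≤ C := by linarith
  have hκ := hS.one_le
  have hQ0 : 0 ≤ Q := by rw [hQ]; positivity
  have hβ0 : 0 < |β p| := abs_pos.2 hS.ne_zero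
  have hn1 : (1 : ℝ) ≤ n := by exact_mod_cast hn
  have hsn : 1 ≤ √(n : ℝ) := Real.one_le_sqrt.2 hn1
  have hsn0 : 0 < √(n : ℝ) := by linarith
  have he := hS.orthonormal.1 p
  set D := 4 * (Q * m + 1) * C with hD
  have hD0 : 0 ≤ D := by positivity
  set c := ((m : ℝ) + 1) * 2 ^ m with hc
  have hc0 : 0 ≤ c := by positivity
  set L := responseConst m K Q C M with hL
  have hLdef : L = M * (1 + 4 * c * (1 + K) * (1 + C)) + (D ^ 3 + D ^ 2) * C := rfl
  have hL1 : M * (1 + 4 * c * (1 + K) * (1 + C)) ≤ L :=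
    le_add_of_nonneg_right (by positivity)
  have hL2 : (D ^ 3 + D ^ 2) * C ≤ L := le_add_of_nonneg_left (by positivity)
  have hL0 : 0 ≤ L := le_trans (by positivity) hL2
  have hM4 : M ≤ M * (1 + 4 * c * (1 + K) * (1 + C)) :=
    le_mul_of_one_le_right (by linarith) (le_add_of_nonneg_right (by positivity))
  have hg : ∀ t, chartIter β v p Z t ∈ chartBall (v p) (C / |β p|) :=
    hcon.iter_mem (zero_mem_chartBall _ hcon.R_nonneg) fun t => rfl
  have hg1 : ∀ t, ‖chartIter β v p Z t‖ ≤ 1 := fun t => (hg t).2.trans hcon.R_le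
  have hres : ∀ t, residualNoise (v p) Z (chartIter β v p Z t) =
      noiseMap Z (v p + chartIter β v p Z t) - noiseMap Z (v p) :=
    fun t => residualNoise_eq he (hg t).1 Z
  -- The noise is needed along the comparison sequence up to index `i + 2 ≤ 3`, covered by the four
  -- queries of `GoodResponse`.
  have hi3 : i + 2 < 4 := by rcases hi with rfl | ⟨rfl, -⟩ <;> norm_num
  -- the perturbations
  have hpert : ∀ b, b = a ∨ b = noiseMap Z (v p) ∨ (∃ j, b = v j) → ∀ t < 4,
      |(⟪b, noiseMap Z (v p + chartIter β v p Z t) - noiseMap Z (v p)⟫ : ℝ)| ≤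
        4 * c * (1 + K) * M * (1 / √n) * ‖chartIter β v p Z t‖ := by
    intro b hb t ht
    have h1 := hG.pert b hb t ht
    rw [hres] at h1
    have h2 := tnorm_residual_add_le (m := m) he (hg t).1 (hg1 t)
    have h3 : ‖b‖ ≤ 1 + K := by
      rcases hb with rfl | rfl | ⟨j, rfl⟩
      · linarith
      · have := hA.norm_le (v p) (by rw [he]; norm_num)
        linarith
      · rw [hS.orthonormal.1]; linarith
    have h4 := tnorm_nonneg (residual (tpow (v p) m) (tpow (v p + chartIter β v p Z t) m))
    calc _ ≤ _ := h1
      _ ≤ (4 : ℕ) * (M / √n) * (1 + K) * (c * ‖chartIter β v p Z t‖) := by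
          gcongr
      _ = _ := by push_cast; ring
  have hresp : ∀ t < 4, ∀ j,
      |(⟪v j, noiseMap Z (v p + chartIter β v p Z t)⟫ : ℝ)| ≤ L * (1 / √n) := by
    intro t ht j
    have h1 := hpert (v j) (Or.inr (Or.inr ⟨j, rfl⟩)) t ht
    have h2 := hG.inner_le (v j) (Or.inr ⟨j, rfl⟩)
    rw [hS.orthonormal.1, mul_one] at h2
    have e : (⟪v j, noiseMap Z (v p + chartIter β v p Z t)⟫ : ℝ) = ⟪v j, noiseMap Z (v p)⟫ +
        ⟪v j, noiseMap Z (v p + chartIter β v p Z t) - noiseMap Z (v p)⟫ := by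
      rw [inner_sub_right]; ring
    rw [e]
    calc _ ≤ M / √n + 4 * c * (1 + K) * M * (1 / √n) * 1 := by
          refine (abs_add_le _ _).trans (add_le_add h2 (h1.trans ?_))
          gcongr; exact hg1 t
      _ = M * (1 + 4 * c * (1 + K) * 1) * (1 / √n) := by ring
      _ ≤ M * (1 + 4 * c * (1 + K) * (1 + C)) * (1 / √n) := by gcongr; linarith
      _ ≤ _ := by gcongr
  have hpert' : ∀ b, b = a ∨ b = noiseMap Z (v p) ∨ (∃ j, b = v j) → ∀ t < 4,
      |(⟪b, noiseMap Z (v p + chartIter β v p Z t) - noiseMap Z (v p)⟫ : ℝ)| ≤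
        L * (1 / √n) / |β p| := by
    intro b hb t ht
    calc _ ≤ _ := hpert b hb t ht
      _ ≤ 4 * c * (1 + K) * M * (1 / √n) * (C / |β p|) := by gcongr; exact (hg t).2
      _ = (M * (4 * c * (1 + K) * C)) * (1 / √n) / |β p| := by ring
      _ ≤ (M * (1 + 4 * c * (1 + K) * (1 + C))) * (1 / √n) / |β p| := by
          have : 4 * c * (1 + K) * C ≤ 1 + 4 * c * (1 + K) * (1 + C) := by
            have : 0 ≤ 4 * c * (1 + K) := by positivity
            nlinarith
          gcongr
      _ ≤ _ := by gcongr
  refine ⟨hS.orthonormal, hm, hS.ne_zero, hA, hcon.ratio_le, hQ0, fun j hj => ?_, hcon.R_le,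
    by positivity, ?_, hL0, ?_, hβ', ha, hg i, hg (i + 1), hg (i + 2), hresp i (by omega),
    hresp (i + 1) (by omega), ?_, ?_, ?_, ?_, ?_, ?_, ?_⟩
  · rw [hQ]; exact hS.ratio j hj
  · rw [div_le_one hsn0]; exact hsn
  · have : 0 ≤ Q * m := by positivity
    nlinarith [mul_nonneg this hC0]
  · rintro b (rfl | rfl | rfl)
    · exact hpert' _ (Or.inr (Or.inr ⟨p, rfl⟩)) (i + 1) (by omega)
    · exact hpert' _ (Or.inr (Or.inl rfl)) (i + 1) (by omega)
    · exact hpert' _ (Or.inl rfl) (i + 1) (by omega)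
  · rintro b (rfl | rfl)
    · exact hpert' _ (Or.inr (Or.inr ⟨p, rfl⟩)) (i + 2) hi3
    · exact hpert' _ (Or.inr (Or.inl rfl)) (i + 2) hi3
  · have := hG.inner_le a (Or.inl rfl)
    rw [ha, mul_one] at this
    calc _ ≤ M / √n := this
      _ = M * (1 / √n) := by ring
      _ ≤ _ := by gcongr; linarith
  · have := hG.inner_le (v p) (Or.inr ⟨p, rfl⟩)
    rw [he, mul_one] at this
    calc _ ≤ M / √n := this
      _ = M * (1 / √n) := by ring
      _ ≤ _ := by gcongr; linarith
  · calc _ ≤ M / √n := hG.norm_sq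
      _ = M * (1 / √n) := by ring
      _ ≤ _ := by gcongr; linarith
  · exact (hcon.iter_mem hf0 hf _).1
  · have h1 := hcon.iter_sub_le (g := chartIter β v p Z) hf0
      (zero_mem_chartBall _ hcon.R_nonneg) hf (fun t => rfl) (i + 2)
    have h2 : ‖f 0 - chartIter β v p Z 0‖ ≤ C / |β p| := by
      rw [chartIter, sub_zero]; exact hf0.2
    have hlam : 4 * (Q * m + 1) * C / |β p| = D / |β p| := rfl
    rw [hlam] at h1
    refine (h1.trans (mul_le_mul_of_nonneg_left h2 (by positivity))).trans ?_
    refine le_trans ?_ (mul_le_mul_of_nonneg_right hL2 (by unfold coreRate; positivity))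
    unfold coreRate
    -- Three contractions turn the radius `C / |β p|` into `O(1 / |β p|⁴)`. With only two the
    -- distance is `O(1 / |β p|³)`, which `√n ≤ |β p|` converts into `1 / (√n |β p|²)`.
    rcases hi with rfl | ⟨rfl, hsq⟩
    · calc (D / |β p|) ^ (1 + 2) * (C / |β p|) = D ^ 3 * C * (1 / |β p| ^ 4) := by
            norm_num only
            field_simp
        _ ≤ (D ^ 3 + D ^ 2) * C * (1 / √n / |β p| ^ 2 + 1 / |β p| ^ 4) := by
            gcongr
            · exact le_add_of_nonneg_right (by positivity)
            · exact le_add_of_nonneg_left (by positivity)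
    · have h3 : 1 / |β p| ≤ 1 / √n := one_div_le_one_div_of_le hsn0 hsq
      calc (D / |β p|) ^ (0 + 2) * (C / |β p|) = D ^ 2 * C * (1 / |β p| / |β p| ^ 2) := by
            norm_num only
            field_simp
        _ ≤ (D ^ 3 + D ^ 2) * C * (1 / √n / |β p| ^ 2 + 1 / |β p| ^ 4) := by
            gcongr
            · exact le_add_of_nonneg_left (by positivity)
            · refine le_trans ?_ (le_add_of_nonneg_right (by positivity))
              gcongr

end Combine

/-! ### The Gaussian expansions -/

lemma one_le_log_natCast {n : ℕ} (hn : 3 ≤ n) : 1 ≤ Real.log n := by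
  rw [Real.le_log_iff_exp_le (by positivity)]
  have : (3 : ℝ) ≤ n := by exact_mod_cast hn
  linarith [Real.exp_one_lt_three]

/-- Only the second and fourth terms of the rate are used. The first and third are nonnegative
extras, and `B ≤ Q |b|` accounts for the rate being stated with the largest signal. -/
lemma coreRate_le_vecRate (k : ℕ) {n : ℕ} (hn : 3 ≤ n) {b B Q : ℝ} (hB : 0 < B) (hQ : 1 ≤ Q)
    (hBb : B ≤ Q * |b|) : coreRate b (1 / √n) ≤ Q ^ 4 * vecRate k n B := by
  have hlog := one_le_log_natCast hn
  have hn0 : (0 : ℝ) < n := by positivity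
  have hsq : 0 < √(n : ℝ) := Real.sqrt_pos.2 hn0
  have hb : 0 < |b| := by
    by_contra hcon
    nlinarith [abs_nonneg b]
  have hi : 1 / |b| ≤ Q / B := by rw [div_le_div_iff₀ hb hB]; linarith
  have h1 : 0 ≤ Real.log n / √n * (Real.log n / (√n * B)) ^ (k - 1) := by positivity
  have h2 : 0 ≤ Real.log n ^ (3 / 2 : ℝ) / (B ^ (3 / 2 : ℝ) * (n : ℝ) ^ (3 / 4 : ℝ)) := by
    positivity
  have h3 : 1 / √n / |b| ^ 2 ≤ Q ^ 4 * (Real.log n / (B ^ 2 * √n)) := by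
    calc 1 / √n / |b| ^ 2 = 1 * (1 / √n) * (1 / |b|) ^ 2 := by field_simp
      _ ≤ Real.log n * (1 / √n) * (Q / B) ^ 2 := by gcongr
      _ = Q ^ 2 * (Real.log n / (B ^ 2 * √n)) := by field_simp
      _ ≤ _ := by
        have : Q ^ 2 ≤ Q ^ 4 := pow_le_pow_right₀ hQ (by norm_num)
        gcongr
  have h4 : 1 / |b| ^ 4 ≤ Q ^ 4 * (1 / B ^ 4) := by
    calc 1 / |b| ^ 4 = (1 / |b|) ^ 4 := by rw [one_div_pow]
      _ ≤ (Q / B) ^ 4 := by gcongr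
      _ = _ := by rw [div_pow]; ring
  have h5 : 0 ≤ Q ^ 4 := by positivity
  unfold coreRate vecRate
  nlinarith [mul_nonneg h5 h1, mul_nonneg h5 h2]

lemma mul_coreRate_le_strengthRate (k : ℕ) {n : ℕ} (hn : 3 ≤ n) {b B Q : ℝ} (hB : 0 < B)
    (hQ : 1 ≤ Q) (hBb : B ≤ Q * |b|) :
    |b| * coreRate b (1 / √n) ≤ Q ^ 4 * strengthRate k n B := by
  have hlog := one_le_log_natCast hn
  have hn0 : (0 : ℝ) < n := by positivity
  have hsq : 0 < √(n : ℝ) := Real.sqrt_pos.2 hn0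
  have hb : 0 < |b| := by
    by_contra hcon
    nlinarith [abs_nonneg b]
  have hi : 1 / |b| ≤ Q / B := by rw [div_le_div_iff₀ hb hB]; linarith
  have h1 : 0 ≤ Real.log n / √n * (Real.log n / (√n * B)) ^ (k - 1) := by positivity
  have h2 : 0 ≤ Real.log n ^ (3 / 2 : ℝ) / (B ^ (1 / 2 : ℝ) * (n : ℝ) ^ (3 / 4 : ℝ)) := by
    positivity
  have h3 : |b| * (1 / √n / |b| ^ 2) ≤ Q ^ 4 * (Real.log n / (B * √n)) := by
    calc |b| * (1 / √n / |b| ^ 2) = 1 * (1 / √n) * (1 / |b|) := by field_simp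
      _ ≤ Real.log n * (1 / √n) * (Q / B) := by gcongr
      _ = Q * (Real.log n / (B * √n)) := by field_simp
      _ ≤ _ := by
        have : Q ≤ Q ^ 4 := le_self_pow₀ hQ (by norm_num)
        gcongr
  have h4 : |b| * (1 / |b| ^ 4) ≤ Q ^ 4 * (1 / B ^ 3) := by
    calc |b| * (1 / |b| ^ 4) = (1 / |b|) ^ 3 := by field_simp
      _ ≤ (Q / B) ^ 3 := by gcongr
      _ = Q ^ 3 * (1 / B ^ 3) := by rw [div_pow]; ring
      _ ≤ _ := by
        have : Q ^ 3 ≤ Q ^ 4 := pow_le_pow_right₀ hQ (by norm_num)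
        gcongr
  have h5 : 0 ≤ Q ^ 4 := by positivity
  unfold coreRate strengthRate
  nlinarith [mul_nonneg h5 h1, mul_nonneg h5 h2]

/-- The expansions of the iterate at the time `T`, up to signs. -/
structure Expanded {n m r : ℕ} (C R R' : ℝ) (T : ℕ) (β : Fin r → ℝ) (v : Fin r → Vec n)
    (p : Fin r) (u a : Vec n) (Z : Tensor n (m + 1)) (h : Vec n) : Prop where
  eq_smul : normIter (drift β v m (noiseMap Z)) u T =
    Real.sign (⟪v p, normIter (drift β v m (noiseMap Z)) u T⟫ : ℝ) • lift (v p) h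
  sign_step : ∀ t, 0 < (⟪v p, normIter (drift β v m (noiseMap Z)) u (t + 1)⟫ : ℝ) *
      (β p * (⟪v p, normIter (drift β v m (noiseMap Z)) u t⟫ : ℝ) ^ m)
  inner_ne_zero : ∀ t, (⟪v p, normIter (drift β v m (noiseMap Z)) u t⟫ : ℝ) ≠ 0
  direction : |(⟪a, lift (v p) h⟫ : ℝ) - ((1 - 1 / (2 * β p ^ 2)) * ⟪a, v p⟫ +
      (⟪a, noiseMap Z (v p)⟫ - ⟪a, v p⟫ * ⟪v p, noiseMap Z (v p)⟫) / β p)| ≤ C * R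
  strength : |energy β v m (noiseMap Z) (lift (v p) h) -
      (β p + ⟪v p, noiseMap Z (v p)⟫ - (((m + 1 : ℕ) : ℝ) / 2 - 1) / β p)| ≤ C * R'

lemma vecRate_nonneg (k n : ℕ) {B : ℝ} (hB : 0 ≤ B) (hn : 3 ≤ n) : 0 ≤ vecRate k n B := by
  have := one_le_log_natCast hn
  unfold vecRate; positivity

lemma strengthRate_nonneg (k n : ℕ) {B : ℝ} (hB : 0 ≤ B) (hn : 3 ≤ n) :
    0 ≤ strengthRate k n B := by
  have := one_le_log_natCast hn
  unfold strengthRate; positivity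

set_option maxHeartbeats 1000000 in
/-- The expansions hold with probability close to one. -/
theorem eventually_expanded {m r : ℕ} [NeZero r] (hm : 2 ≤ m) {κ c₀ ε δ : ℝ} (hc : 0 < c₀)
    (hε : 0 < ε) (hδ : 0 < δ) :
    ∃ C : ℝ, ∀ᶠ n : ℕ in atTop, ∀ (β : Fin r → ℝ) (v : Fin r → Vec n) (u : Vec n)
      (p : Fin r), Admissible (m + 1) r n κ c₀ ε β v u p → ∀ (a : Vec n) (T : ℕ), ‖a‖ = 1 →
      (arrivalTime m n κ |β 0| + 4 ≤ T ∨ (1 / 2 ≤ ε ∧ arrivalTime m n κ |β 0| + 3 ≤ T)) →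
      1 ≤ T ∧ noise n (m + 1) {Z | ¬ ∃ h, Expanded C (vecRate (m + 1) n |β 0|)
        (strengthRate (m + 1) n |β 0|) T β v p u a Z h} ≤ ENNReal.ofReal δ := by
  have hm1 : 1 ≤ m := by omega
  by_cases hκ : 1 ≤ κ
  swap
  · refine ⟨0, ?_⟩
    filter_upwards [eventually_gt_atTop 0] with n hn β v u p hA
    exact absurd (hA.one_le hc hn) hκ
  obtain ⟨K, hK, hinj⟩ := noise_injBound (m + 1)
  obtain ⟨σ, s₀, hs₀, hrec⟩ := exists_recursionBound hm1 hκ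
  set θ := Real.exp (-(1 / κ)) with hθ
  have hθ1 := (hrec s₀ hs₀.le le_rfl).lt_one
  obtain ⟨T₁, hT, -⟩ := exists_time (c := 0) (ρ := 1) hε (Real.exp_pos _).le hθ1 one_pos
  obtain ⟨s, hs, hss, hL⟩ := exists_lateHyp m hκ (Real.exp_pos (-(1 / κ))) T₁ hs₀
  have hRs := hrec s hs.le hss
  obtain ⟨M, hM⟩ := eventually_goodNoise (r := r) hκ hc hε hK hinj hs hT (half_pos hδ)
  obtain ⟨M', hM'1, hM'⟩ := exists_goodResponse m r (half_pos hδ)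
  have hreach := reach_pos (r := r) hκ
  have hK0 : 0 < K := by linarith
  set K' := K * (m + 1) * 2 ^ m with hK'
  have hK'0 : 0 < K' := by positivity
  set Q := κ ^ (m - 1) with hQ
  have hQ1 : 1 ≤ Q := one_le_pow₀ hκ
  obtain ⟨C₁, hC₁⟩ : ∃ x, x = 2 * (r * (κ + 16 * Q * (K / reach r κ ^ m)) + K / reach r κ ^ m) :=
    ⟨_, rfl⟩
  have hC₁0 : 0 ≤ C₁ := by rw [hC₁]; positivity
  obtain ⟨C, hC⟩ : ∃ x, x = 4 * K' + C₁ := ⟨_, rfl⟩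
  have hC0 : 0 ≤ C := by rw [hC]; positivity
  obtain ⟨L, hL'⟩ : ∃ x, x = responseConst m K' Q C M' := ⟨_, rfl⟩
  obtain ⟨c, hc'⟩ : ∃ x, x = coreConst r K' Q C L := ⟨_, rfl⟩
  obtain ⟨N, hN⟩ : ∃ x, x = 1344 * c ^ 4 + (1665 * ((m + 1 : ℕ) : ℝ) ^ 2 * c ^ 4 +
      (r * (36 * Q * (overlapConst Q C L + L) * c ^ 2) + 19 * c ^ 2)) := ⟨_, rfl⟩
  set s₁ := min s₀ (1 / 4) with hs₁
  have hs₁0 : 0 < s₁ := lt_min hs₀ (by norm_num)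
  have hpow := tendsto_natCast_rpow hε
  refine ⟨N * Q ^ 4, ?_⟩
  filter_upwards [hM, eventually_ge_atTop 3, hpow.eventually_ge_atTop 2,
    hpow.eventually_ge_atTop (8 * (1 + Q * m) * (1 + C)), hpow.eventually_ge_atTop (6 * c),
    (tendsto_const_div_rpow (K / reach r κ ^ m) hε).eventually_le_const
      (by positivity : 0 < s₁ ^ 2), eventually_le_arrivalTime hm hκ hε T₁]
    with n ⟨G, hG⟩ hn3 hn2 hn4 hn5 hn6 harr β v u p hA a T ha hTT
  have hn0 : 0 < n := by omega
  have hn1 : (1 : ℝ) ≤ n := by exact_mod_cast (by omega : 1 ≤ n)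
  have hS := hA.signalBound hc hn0
  have hle := hA.le_abs
  have hle0 : |β p| ≤ |β 0| := hA.abs_le_first p
  have hnε : 0 < (n : ℝ) ^ ε := by linarith
  have hβ0 : 0 < |β p| := by linarith
  have hB0 : 0 < |β 0| := by linarith
  have hsn : 1 ≤ √(n : ℝ) := Real.one_le_sqrt.2 hn1
  have harr0 : (T₁ : ℝ) ≤ arrivalTime m n κ |β 0| := harr _ (hle.trans hle0)
  -- The time is split into `t` steps until arrival, one step into the ball of radius `C / |β p|`,
  -- and `i + 2` contracting steps.
  obtain ⟨i, t, hi, rfl, ht⟩ : ∃ i t : ℕ, (i = 1 ∨ (i = 0 ∧ √(n : ℝ) ≤ |β p|)) ∧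
      T = t + 1 + (i + 2) ∧ arrivalTime m n κ |β 0| ≤ t := by
    have hT₁ := Nat.cast_nonneg (α := ℝ) T₁
    rcases hTT with h | ⟨hε2, h⟩
    · have h4 : 4 ≤ T := by exact_mod_cast (by linarith : (4 : ℝ) ≤ T)
      refine ⟨1, T - 4, Or.inl rfl, by omega, ?_⟩
      rw [Nat.cast_sub h4]; push_cast; linarith
    · have h3 : 3 ≤ T := by exact_mod_cast (by linarith : (3 : ℝ) ≤ T)
      refine ⟨0, T - 3, Or.inr ⟨rfl, ?_⟩, by omega, ?_⟩
      · rw [Real.sqrt_eq_rpow]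
        exact (Real.rpow_le_rpow_of_exponent_le hn1 hε2).trans hle
      · rw [Nat.cast_sub h3]; push_cast; linarith
  refine ⟨by omega, ?_⟩
  have hsub : {Z : Tensor n (m + 1) | ¬ ∃ h, Expanded (N * Q ^ 4) (vecRate (m + 1) n |β 0|)
      (strengthRate (m + 1) n |β 0|) (t + 1 + (i + 2)) β v p u a Z h} ⊆
      {Z | ¬ GoodNoise κ s K ((n : ℝ) ^ ε) G (T₁ * M / √n) (M / √n) T₁ β v p u Z} ∪
      {Z | ¬ GoodResponse M' β v p a Z} := by
    intro Z hZ
    by_contra hcon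
    simp only [Set.mem_union, Set.mem_ofPred_eq, not_or, not_not] at hcon
    obtain ⟨hgood, hresp⟩ := hcon
    refine hZ ?_
    have hI := trajInv hm1 hS hRs hgood.traj
    have hstep : ∀ t, chart (v p) (normIter (drift β v m (noiseMap Z)) u (t + 1)) =
        chartMap β v p m (noiseMap Z)
          (chart (v p) (normIter (drift β v m (noiseMap Z)) u t)) := fun t => by
      rw [(hI t).chart_step hm1 hS hRs hgood.traj,
        chart_drift (noiseMap_smul Z) (hI t).inner_ne_zero]
    have hsq : K / (reach r κ ^ m * |β p|) ≤ s₁ ^ 2 := by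
      rw [← div_div]
      exact (div_le_div_of_nonneg_left (by positivity) hnε hle).trans hn6
    -- The lower noise level of `decay_late` is the value of `s'` for which the bound `K` is just
    -- sufficient.
    have hs' : √(K / (reach r κ ^ m * |β p|)) ≤ s₁ := Real.sqrt_le_iff.2 ⟨hs₁0.le, hsq⟩
    have hcl := norm_chart_le_of_arrival hm hS hRs
      (hrec _ (Real.sqrt_nonneg _) (hs'.trans (min_le_left _ _)))
      (by linarith [hs'.trans (min_le_right _ _)]) hL hgood.traj
      (Real.sq_sqrt (by positivity)) (t := t) (by exact_mod_cast harr0.trans ht)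
      (by
        have h1 : 1 < √n * |β 0| := by nlinarith
        refine (exp_pow_le_of_arrivalTime_le hm (by linarith) h1 ht).trans ?_
        exact one_div_le_one_div_of_le hβ0 (by nlinarith))
    have hmem : chart (v p) (normIter (drift β v m (noiseMap Z)) u (t + 1)) ∈
        chartBall (v p) (C / |β p|) := by
      refine ⟨inner_chart_self (hS.orthonormal.1 p) (hI _).inner_ne_zero, hcl.trans ?_⟩
      rw [hC, hC₁]
      gcongr
      exact le_add_of_nonneg_left (by positivity)
    have H := responseHyp (Q := Q) (C := C) hm hn0 hS ha hQ hgood.bound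
      (by rw [hC]; exact le_add_of_nonneg_right hC₁0) hM'1 hresp (hn4.trans hle)
      (by rw [← hL', ← hc']; exact hn5.trans hle)
      (f := fun j => chart (v p) (normIter (drift β v m (noiseMap Z)) u (t + 1 + j)))
      (fun j => hstep _) hmem hi
    rw [← hL'] at H
    have hcore := H.coreHyp.coreRate_nonneg
    have hratio : |β 0| ≤ Q * |β p| := by
      by_cases h0 : (0 : Fin r) = p
      · rw [h0]; exact le_mul_of_one_le_left hβ0.le hQ1
      · have := hS.ratio 0 h0
        rwa [abs_div, div_le_iff₀ hβ0] at this
    have hr1 := coreRate_le_vecRate (m + 1) hn3 hB0 hQ1 hratio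
    have hr2 := mul_coreRate_le_strengthRate (m + 1) hn3 hB0 hQ1 hratio
    have hv0 := vecRate_nonneg (m + 1) n hB0.le hn3
    have hv0' := strengthRate_nonneg (m + 1) n hB0.le hn3
    have hov := H.overlapConst_nonneg
    have hL0 := H.L_nonneg
    have hN1 : 1344 * c ^ 4 ≤ N := by rw [hN]; exact le_add_of_nonneg_right (by positivity)
    have hN2 : (1665 * ((m + 1 : ℕ) : ℝ) ^ 2 * c ^ 4 +
        (r * (36 * Q * (overlapConst Q C L + L) * c ^ 2) + 19 * c ^ 2)) ≤ N := by
      rw [hN]; exact le_add_of_nonneg_left (by positivity)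
    have hN0 : 0 ≤ N := le_trans (by positivity) hN1
    refine ⟨chart (v p) (normIter (drift β v m (noiseMap Z)) u (t + 1 + (i + 2))),
      eq_sign_smul_lift (hI _).unit (hI _).inner_ne_zero,
      fun t => (hI t).sign_step hm1 hS hRs hgood.traj, fun t => (hI t).inner_ne_zero, ?_, ?_⟩
    · refine H.abs_inner_lift_sub_le.trans ?_
      rw [← hc']
      rw [mul_assoc N]
      exact mul_le_mul hN1 hr1 hcore hN0
    · refine (H.abs_energy_lift_sub_le (noiseMap_smul Z)).trans ?_
      rw [← hc']
      rw [mul_assoc N]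
      exact mul_le_mul hN2 hr2 (mul_nonneg hβ0.le hcore) hN0
  refine (measure_mono hsub).trans ((measure_union_le _ _).trans ((add_le_add (hG β v u p hA)
    (hM' n hn0 β v p a hA.orthonormal)).trans (le_of_eq ?_)))
  rw [← ENNReal.ofReal_add (by positivity) (by positivity), add_halves]

/-- The expansions transfer to the signed limit `τ v`. -/
lemma Expanded.of_sign {n m r : ℕ} {C R R' : ℝ} {T : ℕ} {β : Fin r → ℝ} {v : Fin r → Vec n}
    {p : Fin r} {u a : Vec n} {Z : Tensor n (m + 1)} {h : Vec n}
    (H : Expanded C R R' T β v p u a Z h) {τ : ℝ}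
    (hτ : Real.sign (⟪v p, normIter (drift β v m (noiseMap Z)) u T⟫ : ℝ) = τ) {b : ℝ} {w : Vec n}
    (hb : b = τ ^ (m + 1) * β p) (hw : w = τ • v p) :
    |(⟪a, powerIter (observation β v Z) u T⟫ : ℝ)
        - ((1 - 1 / (2 * b ^ 2)) * ⟪a, w⟫
          + (⟪a, act Z (tpow w m)⟫ - ⟪a, w⟫ * ⟪w, act Z (tpow w m)⟫) / b)| ≤ C * R ∧
    |SpikedTensor.strength (observation β v Z) u T
        - (b + ⟪act Z (tpow w m), w⟫ - (((m + 1 : ℕ) : ℝ) / 2 - 1) / b)| ≤ C * R' := by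
  have hτ1 : |τ| = 1 := by rw [← hτ]; exact abs_sign_eq_one (H.inner_ne_zero T)
  have hτ2 : τ * τ = 1 := by rw [← abs_mul_abs_self, hτ1, one_mul]
  set ρ := τ ^ m with hρ
  have hρ1 : |ρ| = 1 := by rw [hρ, abs_pow, hτ1, one_pow]
  have hρ2 : ρ * ρ = 1 := by rw [← abs_mul_abs_self, hρ1, one_mul]
  have hτ0 : τ ≠ 0 := by rintro rfl; simp at hτ2
  have hρ0 : ρ ≠ 0 := by rintro h; rw [h] at hρ2; simp at hρ2
  have hpow : τ ^ (m + 1) = ρ * τ := pow_succ _ _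
  have hU := H.eq_smul
  rw [hτ] at hU
  have hact : act Z (tpow w m) = ρ • noiseMap Z (v p) := by rw [hw]; exact noiseMap_smul Z τ (v p)
  have hβ : β p ≠ 0 := by
    intro h0
    have := H.sign_step 0
    rw [h0, zero_mul, mul_zero] at this
    exact lt_irrefl _ this
  rw [hact, hb, hw, hpow]
  constructor
  · refine le_trans (le_of_eq ?_) H.direction
    rw [powerIter_observation, hU]
    simp only [real_inner_smul_right, real_inner_smul_left]
    have h1 : (ρ * τ * β p) ^ 2 = β p ^ 2 := by
      calc (ρ * τ * β p) ^ 2 = (ρ * ρ) * (τ * τ) * β p ^ 2 := by ring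
        _ = _ := by rw [hρ2, hτ2]; ring
    have h2 : ∀ x y : ℝ, (ρ * x - τ * y * (ρ * (τ * ⟪v p, noiseMap Z (v p)⟫))) / (ρ * τ * β p) =
        τ * ((x - y * ⟪v p, noiseMap Z (v p)⟫) / β p) := by
      intro x y
      rw [mul_div_assoc', div_eq_div_iff (by positivity) hβ]
      linear_combination (-(ρ * β p) * (y * ⟪v p, noiseMap Z (v p)⟫) + ρ * β p * 0) * hτ2 +
        (ρ * β p * (y * ⟪v p, noiseMap Z (v p)⟫) - ρ * β p * x) * hτ2
    -- The direction formula is odd in the sign: with `τ² = 1` and `(τ^m)² = 1`, replacing `(β p, v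
    -- p)` by `(b, w)` multiplies the whole error by `τ`.
    rw [h1, h2, ← one_mul |(⟪a, lift (v p) h⟫ : ℝ) - _|, ← hτ1, ← abs_mul]
    congr 1
    ring
  · refine le_trans (le_of_eq ?_) H.strength
    rw [strength_observation, hU, energy_smul (noiseMap_smul Z), hpow]
    simp only [real_inner_smul_right, real_inner_smul_left]
    have h1 : ∀ x : ℝ, x / (ρ * τ * β p) = ρ * τ * (x / β p) := by
      intro x
      rw [mul_div_assoc', div_eq_div_iff (by positivity) hβ]
      linear_combination (-(x * β p) * (τ * τ)) * hρ2 + (-(x * β p)) * hτ2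
    rw [h1, real_inner_comm (v p) (noiseMap Z (v p)),
      ← one_mul |energy β v m (noiseMap Z) (lift (v p) h) - _|,
      ← (by rw [abs_mul, hρ1, hτ1, one_mul] : |ρ * τ| = 1), ← abs_mul]
    congr 1
    ring

/-- The expansions hold around `(τ ^ k β, τ v)` if the sign of the overlap is `τ`. -/
lemma gaussianExpansion_of_expanded {n m r : ℕ} [NeZero r] {C δ : ℝ} {T : ℕ} {β : Fin r → ℝ}
    {v : Fin r → Vec n} {p : Fin r} {u a : Vec n} (hv : ‖v p‖ = 1) (hδ : 0 ≤ δ)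
    (H : noise n (m + 1) {Z | ¬ ∃ h, Expanded C (vecRate (m + 1) n |β 0|)
        (strengthRate (m + 1) n |β 0|) T β v p u a Z h} ≤ ENNReal.ofReal δ) {τ : ℝ} (hτ : |τ| = 1)
    (hsign : ∀ (Z : Tensor n (m + 1)) (h : Vec n), Expanded C (vecRate (m + 1) n |β 0|)
        (strengthRate (m + 1) n |β 0|) T β v p u a Z h →
      Real.sign (⟪v p, normIter (drift β v m (noiseMap Z)) u T⟫ : ℝ) = τ) {b : ℝ} {w : Vec n}
    (hb : b = τ ^ (m + 1) * β p) (hw : w = τ • v p) :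
    GaussianExpansion m β v u a T b w C δ := by
  refine ⟨map_act_noise (tinner_tpow_self ?_), one_sub_le_measureReal hδ H fun Z hZ => ?_⟩
  · rw [hw, norm_smul, hv, Real.norm_eq_abs, hτ, one_mul]
  · simp only [Set.mem_ofPred_eq, not_not] at hZ
    obtain ⟨h, hh⟩ := hZ
    exact hh.of_sign (hsign Z h hh) hb hw

end SpikedTensor

end

/-! ### Assembly of the theorem -/

open SpikedTensor in
theorem theorem2p5 (k : ℕ) (hk : 2 ≤ k) (κ : ℝ) (hκ : 0 < κ) :
    ∃ ε₀ : ℝ, 0 < ε₀ ∧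
      ∀ (r : ℕ) [NeZero r] (c₀ ε : ℝ), 0 < c₀ → 0 < ε →
        -- convergence of the power iteration, with probability tending to one
        (∀ δ : ℝ, 0 < δ → ∃ N : ℕ, ∀ n : ℕ, N ≤ n →
          ∀ (β : Fin r → ℝ) (v : Fin r → Vec n) (u : Vec n) (p : Fin r),
            Admissible k r n κ c₀ ε β v u p →
            (Odd k → 0 < β p →
              1 - δ ≤ (noise n (k - 1 + 1)).real
                {Z | ConvergesNear (observation β v Z) u (β p) (v p) δ}) ∧
            (Odd k → β p < 0 →
              1 - δ ≤ (noise n (k - 1 + 1)).real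
                {Z | ConvergesNear (observation β v Z) u (-β p) (-v p) δ}) ∧
            (Even k → 0 < β p →
              1 - δ ≤ (noise n (k - 1 + 1)).real
                {Z | ConvergesNear (observation β v Z) u (β p)
                  (Real.sign (inner ℝ u (v p)) • v p) δ}) ∧
            (Even k → β p < 0 →
              1 - δ ≤ (noise n (k - 1 + 1)).real
                {Z | AlternatesNear (observation β v Z) u (β p)
                  (Real.sign (inner ℝ u (v p)) • v p) δ})) ∧
        -- first order expansions of the estimators, with errors bounded in probability
        (3 ≤ k → ∀ δ : ℝ, 0 < δ → ∃ (C : ℝ) (N : ℕ), ∀ n : ℕ, N ≤ n →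
          ∀ (β : Fin r → ℝ) (v : Fin r → Vec n) (u : Vec n) (p : Fin r),
            Admissible k r n κ c₀ ε β v u p →
            ∀ (a : Vec n) (T : ℕ), ‖a‖ = 1 →
              iterTime k n ε |β 0| ≤ T →
              (ε₀ < ε →
                iterTime k n ε |β 0| + Real.log κ / Real.log ((k : ℝ) - 1) ≤ T) →
              (Odd k → 0 < β p →
                GaussianExpansion (k - 1) β v u a T (β p) (v p) C δ) ∧
              (Odd k → β p < 0 →
                GaussianExpansion (k - 1) β v u a T (-β p) (-v p) C δ) ∧
              (Even k → 0 < β p →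
                GaussianExpansion (k - 1) β v u a T (β p)
                  (Real.sign (inner ℝ u (v p)) • v p) C δ) ∧
              (Even k → β p < 0 →
                GaussianExpansion (k - 1) β v u a T (β p)
                  (((-1 : ℝ) ^ T * Real.sign (inner ℝ u (v p))) • v p) C δ)) := by
  obtain ⟨m, rfl⟩ : ∃ m, k = m + 1 := ⟨k - 1, by omega⟩
  have hm1 : 1 ≤ m := by omega
  refine ⟨epsThreshold (m + 1) κ, epsThreshold_pos hk κ, fun r _ c₀ ε hc hε =>
    ⟨fun δ hδ => ?_, fun hk3 δ hδ => ?_⟩⟩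
  · obtain ⟨N, hN⟩ := eventually_atTop.1
      (eventually_converged (r := r) (κ := κ) hm1 hc hε hδ)
    refine ⟨N, fun n hn β v u p hA => ?_⟩
    have key : ∀ S : Set (Tensor n (m + 1)),
        (∀ Z h, Converged m β v p u (noiseMap Z) δ h → Z ∈ S) →
        1 - δ ≤ (noise n (m + 1)).real S := fun S hS =>
      one_sub_le_measureReal hδ.le (hN n hn β v u p hA) fun Z hZ => by
        simp only [Set.mem_ofPred_eq, not_not] at hZ
        exact hZ.elim fun h hh => hS Z h hh
    refine ⟨fun hodd hβ => key _ fun Z h hh => ?_, fun hodd hβ => key _ fun Z h hh => ?_,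
      fun heven hβ => key _ fun Z h hh => Converged.of_odd_pos hh ?_ hβ,
      fun heven hβ => key _ fun Z h hh => Converged.of_odd_neg hh ?_ hβ⟩
    · have := Converged.of_even hh (by grind) hβ.ne'
      rwa [Real.sign_of_pos hβ, one_mul, one_smul] at this
    · have := Converged.of_even hh (by grind) hβ.ne
      rwa [Real.sign_of_neg hβ, neg_one_mul, neg_one_smul] at this
    · grind
    · grind
  · have hm : 2 ≤ m := by omega
    obtain ⟨C, hC⟩ := eventually_expanded (r := r) (κ := κ) hm hc hε hδ
    obtain ⟨N, hN⟩ := eventually_atTop.1 hC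
    refine ⟨C, max N 2, fun n hn β v u p hA a T ha hT hT' => ?_⟩
    have hn2 : 2 ≤ n := le_of_max_le_right hn
    obtain ⟨hT1, hE⟩ := hN n (le_of_max_le_left hn) β v u p hA a T ha
      (arrivalTime_le hm hn2 hε (hA.le_abs.trans (hA.abs_le_first p)) hT hT')
    have hv := hA.orthonormal.1 p
    have hn0 : 0 < √(n : ℝ) := Real.sqrt_pos.2 (by positivity)
    have hu : (⟪u, v p⟫ : ℝ) ≠ 0 := abs_pos.1 ((div_pos hc hn0).trans_le (hA.overlap p))
    have hs := abs_sign_eq_one hu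
    -- The order is `m + 1`, so odd order means an even power in the sign recursion and conversely.
    -- For odd order `T ≥ 1` is needed, as the initial sign is arbitrary.
    have hsign : ∀ τ, (Real.sign (β p) = τ) → Odd (m + 1) → ∀ (Z : Tensor n (m + 1)) (h : Vec n),
        Expanded C (vecRate (m + 1) n |β 0|) (strengthRate (m + 1) n |β 0|) T β v p u a Z h →
        Real.sign (⟪v p, normIter (drift β v m (noiseMap Z)) u T⟫ : ℝ) = τ :=
      fun τ hτ hodd Z h H => hτ ▸ sign_eq_of_even
        (x := fun t => (⟪v p, normIter (drift β v m (noiseMap Z)) u t⟫ : ℝ)) (by grind)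
        H.sign_step hT1
    have hsign' : ∀ τ, (Real.sign (β p) ^ T = τ) → Even (m + 1) →
        ∀ (Z : Tensor n (m + 1)) (h : Vec n),
        Expanded C (vecRate (m + 1) n |β 0|) (strengthRate (m + 1) n |β 0|) T β v p u a Z h →
        Real.sign (⟪v p, normIter (drift β v m (noiseMap Z)) u T⟫ : ℝ) =
          τ * Real.sign (⟪u, v p⟫ : ℝ) := by
      intro τ hτ heven Z h H
      rw [← hτ, real_inner_comm (v p) u]
      exact sign_eq_of_odd
        (x := fun t => (⟪v p, normIter (drift β v m (noiseMap Z)) u t⟫ : ℝ)) (by grind)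
        H.sign_step T
    refine ⟨fun hodd hβ => ?_, fun hodd hβ => ?_, fun heven hβ => ?_, fun heven hβ => ?_⟩
    · exact gaussianExpansion_of_expanded hv hδ.le hE abs_one
        (hsign 1 (Real.sign_of_pos hβ) hodd) (by simp) (one_smul _ _).symm
    · exact gaussianExpansion_of_expanded hv hδ.le hE (by simp)
        (hsign (-1) (Real.sign_of_neg hβ) hodd) (by rw [hodd.neg_one_pow, neg_one_mul])
        (neg_one_smul _ _).symm
    · refine gaussianExpansion_of_expanded hv hδ.le hE hs (fun Z h H => ?_) ?_ rfl
      · rw [hsign' 1 (by rw [Real.sign_of_pos hβ, one_pow]) heven Z h H, one_mul]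
      · rw [← heven.pow_abs, hs, one_pow, one_mul]
    · have hs' : |(-1 : ℝ) ^ T * Real.sign (⟪u, v p⟫ : ℝ)| = 1 := by
        rw [abs_mul, abs_neg_one_pow, hs, one_mul]
      refine gaussianExpansion_of_expanded hv hδ.le hE hs'
        (hsign' _ (by rw [Real.sign_of_neg hβ]) heven) ?_ rfl
      rw [← heven.pow_abs, hs', one_pow, one_mul]
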